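/- **Setting.** Let $(W,\Sigma')$ be a non-empty measurable space, $(S,\Sigma)$ a measurable space, and $w\mapsto P^w$ a probability kernel from $W$ to $S$ such that there is a jointly measurable $U:W\times S\to\mathbb R$ with $U(w,\cdot)$ uniform on $[0,1]$ under $P^w$ for every $w$. Let $\tilde V$ be the set of bounded $\Sigma'\otimes\Sigma$-measurable $\tilde v:W\times S\to\mathbb R$, $\tilde V_0$ the finite-valued ones, $\tilde v^w=\tilde v(w,\cdot)$ and $F_{\tilde v}(w,t)=P^w[\tilde v^w\le t]$. Let $V,V_0$ be the elements of $\tilde V,\tilde V_0$ for which $F_{\tilde v}(w,\cdot)$ does not depend on $w$, and $V',V'_0$ those that do not depend on $s$. Real numbers are identified with constants. An event $A\in\Sigma'\otimes\Sigma$ is *unambiguous* if $P^w[A^w]$ does not depend on $w$, where $A^w=\{s:(w,s)\in A\}$; $t\,A\,x$ is the variable equal to $t$ on $A$ and $x$ off $A$. $\tilde v,\tilde u$ are *comonotonic* if $(\tilde v^w(s')-\tilde v^w(s))(\tilde u^w(s')-\tilde u^w(s))\ge0$ for all $w,s,s'$. Let $\Delta$ be the set of finitely additive probabilities on $(W,\Sigma')$,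 with the weak-$*$ topology given by the bounded measurable functions. For a binary relation $\succeq$ on $\tilde V_0$, with strict part $\succ$ and symmetric part $\sim$, $m_{\tilde v}\in\mathbb R$ denotes a certainty equivalent, $m_{\tilde v}\sim\tilde v$. An unambiguous $E$ is *essential* if $t\succ t\,E\,x\succ x$ for some $t>x$. For $t\succeq x$, $y$ is a *preference average* of $t,x$ given an essential $E$ if $t\succeq y\succeq x$ and $t\,E\,x\sim m_{tEt}\,E\,m_{xEx}\sim m_{tEy}\,E\,m_{yEx}$. The *subjective mixtures* $\alpha t\oplus(1-\alpha)x$, $\alpha\in[0,1]$, are obtained from $1t\oplus0x=t$ and $0t\oplus1x=x$ by iterating preference averages (averaging the weights) and taking limits. $z=2\otimes x$ if, for some essential $E$, either $x\ge0$, $z\succeq x$ and $z\,E\,0\sim m_{zEx}\,E\,m_{xE0}$, or $x<0$, $x\succeq z$ and $0\,E\,z\sim m_{0Ex}\,E\,m_{xEz}$; and $t\oplus x=2\otimes(\frac12t\oplus\frac12x)$ (it need not exist). These operations are applied to random variables pointwise. $\mathrm{sub}(vBr)$ is the random variable with value $m_{v(\cdot)\,B\,r(\cdot)}$ at each point. Write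 $\tilde v^w\succeq\tilde u^w$ if there are $v,u\in V_0$ with the distributions of $\tilde v^w,\tilde u^w$ and $v\succeq u$. **Axioms.** - A1: $\succeq$ is complete and transitive. - A2: $F_{\tilde v}=F_{\tilde u}$ implies $\tilde v\sim\tilde u$. - A3: if $v,u\in V_0$, $v\succ u$, and $v_n,u_n\in V_0$ are uniformly bounded and converge in distribution to $v,u$, then $v_n\succ u$ and $v\succ u_n$ for all large $n$; and for every $\tilde v\in\tilde V_0$ the sets $\{m\in\mathbb R:m\succ\tilde v\}$ and $\{m\in\mathbb R:\tilde v\succ m\}$ are open. - A4: if $v,u\in V_0$ and $F_v\le F_u$ everywhere then $v\succeq u$, and $v\succ u$ if moreover $F_v(t)<F_u(t)$ for some $t$. - A5: if $\tilde v^w\succeq\tilde u^w$ for all $w$, then $\tilde v\succeq\tilde u$. - A6: if $v',u'\in V'_0$, $\alpha\in(0,1)$ and $v'\sim u'$, then $\alpha v'\oplus(1-\alpha)u'\succeq v'$. - A7: if $\tilde v,\tilde u\in\tilde V_0$, $r\in V_0$, both $\tilde v,r$ and $\tilde u,r$ are comonotonic and $\tilde v\oplus r,\tilde u\oplus r$ exist,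 then $\tilde v\succeq\tilde u$ implies $\tilde v\oplus r\succeq\tilde u\oplus r$. - A8: if $A$ is essential, $B$ is unambiguous, $v=x\,A\,y$, $u=x'\,A\,y'$, $r=x''\,A\,y''$ are pairwise comonotonic, and either $x,x'\ge x''$ and $y,y'\ge y''$, or $x,x'\le x''$ and $y,y'\le y''$, then $v\succeq u$ implies $\mathrm{sub}(vBr)\succeq\mathrm{sub}(uBr)$. "A1–A8 on $\tilde V$" means the same with $\tilde V,V,V'$ in place of $\tilde V_0,V_0,V'_0$. **Theorem.** For $\psi:[0,1]\to[0,1]$ and bounded $X$ on $(S,P^w)$ with distribution function $F$, put $\int X\,d\nu_\psi=\int_{-\infty}^0(\psi(1-F(t))-1)\,dt+\int_0^\infty\psi(1-F(t))\,dt$. ($\alpha$) A relation $\succeq$ on $\tilde V_0$ satisfies A1–A8 if and only if there are a strictly increasing continuous $\psi:[0,1]\to[0,1]$ with $\psi(0)=0$, $\psi(1)=1$, a strictly increasing continuous $\phi:\mathbb R\to\mathbb R$, and a grounded (that is, $\min c=0$), convex, lower semicontinuous $c:\Delta\to[0,\infty]$ such that for all $\tilde v,\tilde u\in\tilde V_0$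 $$\tilde v\succeq\tilde u\iff\min_{Q\in\Delta}\Big\{E_Q\Big[\int\phi(\tilde v^{\cdot})\,d\nu_\psi\Big]+c(Q)\Big\}\ \ge\ \min_{Q\in\Delta}\Big\{E_Q\Big[\int\phi(\tilde u^{\cdot})\,d\nu_\psi\Big]+c(Q)\Big\},\qquad(*)$$ the minima being attained. Furthermore, for each $\phi$ (and $\psi$) occurring in such a representation, there is a unique minimal — indeed a least — penalty with which $(*)$ holds, namely $$c_{\min}(Q)=\sup_{v'\in V'_0}\big\{\phi(m_{v'})-E_Q[\phi(v')]\big\}.$$ ($\beta$) If $\succeq$ satisfies A1–A8, it has a unique extension to $\tilde V$ that satisfies A1–A8 on $\tilde V$; every $(\phi,\psi,c)$ that represents $\succeq$ on $\tilde V_0$ by $(*)$ also represents the extension on $\tilde V$ by $(*)$. -/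

import Mathlib

open MeasureTheory ProbabilityTheory Set Filter Topology
open scoped ENNReal

noncomputable section

namespace RDV

/-! ### Finitely additive probabilities -/

/-- A finitely additive probability on the measurable sets of `W`
(with the value `0` on sets that are not measurable, so that equality is equality on events). -/
structure FinAddProb (W : Type*) [MeasurableSpace W] where
  mass : Set W → ℝ
  mass_nonneg : ∀ A, 0 ≤ mass A
  mass_univ : mass univ = 1
  mass_union : ∀ A B, MeasurableSet A → MeasurableSet B → Disjoint A B →
    mass (A ∪ B) = mass A + mass B
  mass_of_not_measurable : ∀ A, ¬ MeasurableSet A → mass A = 0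

section FinAdd
variable {W : Type*} [MeasurableSpace W]

/-- The integral of a simple function. -/
def FinAddProb.simpleIntegral (Q : FinAddProb W) (g : SimpleFunc W ℝ) : ℝ :=
  ∑ y ∈ g.range, y * Q.mass (g ⁻¹' {y})

/-- The expectation `E_Q[f]` of a bounded measurable `f`: the supremum of the integrals of the
simple functions below `f`. -/
def FinAddProb.expect (Q : FinAddProb W) (f : W → ℝ) : ℝ :=
  sSup {a : ℝ | ∃ g : SimpleFunc W ℝ, (∀ w, g w ≤ f w) ∧ a = Q.simpleIntegral g}

/-- The weak-star topology: the coarsest one for which `Q ↦ E_Q[f]` is continuous for every bounded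
measurable `f`. -/
instance : TopologicalSpace (FinAddProb W) :=
  TopologicalSpace.induced
    (fun (Q : FinAddProb W) (f : {f : W → ℝ // Measurable f ∧ ∃ C, ∀ w, |f w| ≤ C}) =>
      Q.expect f.1) inferInstance

/-- `c` is grounded: its minimum is `0`. -/
def Grounded (c : FinAddProb W → ℝ≥0∞) : Prop :=
  IsLeast (range c) 0

/-- Convexity of a penalty on finitely additive probabilities. -/
def ConvexPenalty (c : FinAddProb W → ℝ≥0∞) : Prop :=
  ∀ (Q₁ Q₂ Q : FinAddProb W) (a : ℝ), 0 ≤ a → a ≤ 1 →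
    (∀ A, Q.mass A = a * Q₁.mass A + (1 - a) * Q₂.mass A) →
    c Q ≤ ENNReal.ofReal a * c Q₁ + ENNReal.ofReal (1 - a) * c Q₂

end FinAdd

/-! ### Two-stage random variables -/

section Setup
variable {W S : Type*} [MeasurableSpace W] [MeasurableSpace S]

/-- Richness: on every `(S, P w)` there is a uniform random variable, jointly measurable in
`(w, s)`. -/
def HasUniform (P : Kernel W S) : Prop :=
  ∃ U : W × S → ℝ, Measurable U ∧
    ∀ w, (P w).map (fun s => U (w, s)) = (volume : Measure ℝ).restrict (Icc 0 1)

/-- All bounded random variables on `W × S`. -/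
def boundedRV (W S : Type*) [MeasurableSpace W] [MeasurableSpace S] : Set (W × S → ℝ) :=
  {v | Measurable v ∧ ∃ C, ∀ x, |v x| ≤ C}

/-- The random variables on `W × S` with finitely many values. -/
def finiteRV (W S : Type*) [MeasurableSpace W] [MeasurableSpace S] : Set (W × S → ℝ) :=
  {v | Measurable v ∧ (range v).Finite}

/-- The conditional distribution function `F_v(w, t) = P^w[v^w ≤ t]`. -/
def condCDF (P : Kernel W S) (v : W × S → ℝ) (w : W) (t : ℝ) : ℝ :=
  (P w).real {s | v (w, s) ≤ t}

/-- `v` carries no ambiguity: its conditional distribution does not depend on `w`. -/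
def Unambiguous (P : Kernel W S) (v : W × S → ℝ) : Prop :=
  ∀ w₁ w₂ t, condCDF P v w₁ t = condCDF P v w₂ t

/-- An event whose conditional probability does not depend on `w`. -/
def UnambiguousEvent (P : Kernel W S) (A : Set (W × S)) : Prop :=
  MeasurableSet A ∧ ∀ w₁ w₂, P w₁ {s | (w₁, s) ∈ A} = P w₂ {s | (w₂, s) ∈ A}

/-- The constant random variable `m`. -/
def sure (m : ℝ) : W × S → ℝ := fun _ => m

/-- The random variable without risk given by a function of the state of the world. -/
def riskless (g : W → ℝ) : W × S → ℝ := fun x => g x.1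

open Classical in
/-- The bet `t A x`: `t` on `A` and `x` off `A`. -/
def bet (t : ℝ) (A : Set (W × S)) (x : ℝ) : W × S → ℝ := fun y => if y ∈ A then t else x

/-- Comonotonicity, state of the world by state of the world. -/
def Comonotonic (v u : W × S → ℝ) : Prop :=
  ∀ w s s', 0 ≤ (v (w, s') - v (w, s)) * (u (w, s') - u (w, s))

/-- Convergence in distribution of random variables that carry no ambiguity. -/
def ConvInDist (P : Kernel W S) (vs : ℕ → W × S → ℝ) (v : W × S → ℝ) : Prop :=
  ∀ w t, ContinuousAt (condCDF P v w) t →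
    Tendsto (fun n => condCDF P (vs n) w t) atTop (𝓝 (condCDF P v w t))

/-- A sequence of random variables with a common bound. -/
def UniformlyBounded (vs : ℕ → W × S → ℝ) : Prop :=
  ∃ C : ℝ, ∀ n x, |vs n x| ≤ C

/-! ### Preferences

A preference on a set `D` of random variables is a relation `R`, where `R v u` reads "`v` is weakly
preferred to `u`"; only its values on `D` are ever used. -/

/-- Strict preference. -/
def Strict (R : (W × S → ℝ) → (W × S → ℝ) → Prop) (v u : W × S → ℝ) : Prop := R v u ∧ ¬ R u v

/-- Indifference. -/
def Indiff (R : (W × S → ℝ) → (W × S → ℝ) → Prop) (v u : W × S → ℝ) : Prop := R v u ∧ R u v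

/-- `m` is a certainty equivalent of `v`. -/
def IsCE (R : (W × S → ℝ) → (W × S → ℝ) → Prop) (v : W × S → ℝ) (m : ℝ) : Prop :=
  Indiff R (sure m) v

/-- Essential events. -/
def Essential (P : Kernel W S) (R : (W × S → ℝ) → (W × S → ℝ) → Prop) (E : Set (W × S)) : Prop :=
  UnambiguousEvent P E ∧
    ∃ t x : ℝ, x < t ∧ Strict R (sure t) (bet t E x) ∧ Strict R (bet t E x) (sure x)

/-- For `t` weakly preferred to `x`: `y` lies between them in preference and
`t E x ∼ m_{tEt} E m_{xEx} ∼ m_{tEy} E m_{yEx}`. -/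
def OrderedPrefAverage (R : (W × S → ℝ) → (W × S → ℝ) → Prop) (E : Set (W × S)) (t x y : ℝ) :
    Prop :=
  R (sure t) (sure x) ∧ R (sure t) (sure y) ∧ R (sure y) (sure x) ∧
    ∃ a b c d : ℝ, IsCE R (bet t E t) a ∧ IsCE R (bet x E x) b ∧
      IsCE R (bet t E y) c ∧ IsCE R (bet y E x) d ∧
      Indiff R (bet t E x) (bet a E b) ∧ Indiff R (bet a E b) (bet c E d)

/-- `y` is a preference average of `t` and `x` given `E`, whichever of the two is preferred. -/
def PrefAverage (R : (W × S → ℝ) → (W × S → ℝ) → Prop) (E : Set (W × S)) (t x y : ℝ) : Prop :=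
  OrderedPrefAverage R E t x y ∨ OrderedPrefAverage R E x t y

/-- `SubjMix P R t x α z`: the amount `z` is the subjective mixture `α t ⊕ (1 - α) x`. Mixtures are
generated from the weights `0` and `1` by preference averages (given any essential event) and by
passing to limits. -/
inductive SubjMix (P : Kernel W S) (R : (W × S → ℝ) → (W × S → ℝ) → Prop) (t x : ℝ) :
    ℝ → ℝ → Prop
  | one : SubjMix P R t x 1 t
  | zero : SubjMix P R t x 0 x
  | average {α β y z r : ℝ} {E : Set (W × S)} :
      SubjMix P R t x α y → SubjMix P R t x β z → Essential P R E → PrefAverage R E y z r →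
      SubjMix P R t x ((α + β) / 2) r
  | limit {α z : ℝ} (a y : ℕ → ℝ) : (∀ n, SubjMix P R t x (a n) (y n)) →
      Tendsto a atTop (𝓝 α) → Tendsto y atTop (𝓝 z) → SubjMix P R t x α z

/-- `z` is a preference doubling `2 ⊗ x` given `E`. -/
def PrefDoubling (R : (W × S → ℝ) → (W × S → ℝ) → Prop) (E : Set (W × S)) (x z : ℝ) : Prop :=
  (0 ≤ x ∧ R (sure z) (sure x) ∧ ∃ a b : ℝ, IsCE R (bet z E x) a ∧ IsCE R (bet x E 0) b ∧
      Indiff R (bet z E 0) (bet a E b)) ∨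
  (x < 0 ∧ R (sure x) (sure z) ∧ ∃ a b : ℝ, IsCE R (bet 0 E x) a ∧ IsCE R (bet x E z) b ∧
      Indiff R (bet 0 E z) (bet a E b))

/-- `z` is the subjective sum `t ⊕ x = 2 ⊗ (1/2 t ⊕ 1/2 x)`. -/
def SubjSum (P : Kernel W S) (R : (W × S → ℝ) → (W × S → ℝ) → Prop) (t x z : ℝ) : Prop :=
  ∃ h : ℝ, SubjMix P R t x (1 / 2) h ∧ ∃ E, Essential P R E ∧ PrefDoubling R E h z

/-- `z` is the state-wise mixture `sub(v B r)`: at each point its value is the certainty equivalent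
of the bet on `B` between the values of `v` and `r` there. -/
def IsSub (R : (W × S → ℝ) → (W × S → ℝ) → Prop) (B : Set (W × S)) (v r z : W × S → ℝ) : Prop :=
  ∀ x, IsCE R (bet (v x) B (r x)) (z x)

/-- The preference between the roulette lotteries `v^w` and `u^w`, induced through unambiguous random
variables with the same distributions. -/
def LotteryPref (P : Kernel W S) (D : Set (W × S → ℝ)) (R : (W × S → ℝ) → (W × S → ℝ) → Prop)
    (w : W) (v u : W × S → ℝ) : Prop :=
  ∃ v₀ ∈ D, ∃ u₀ ∈ D, (∀ w' t, condCDF P v₀ w' t = condCDF P v w t) ∧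
    (∀ w' t, condCDF P u₀ w' t = condCDF P u w t) ∧ R v₀ u₀

/-! ### The axioms, for a preference `R` on the set `D` -/

/-- Weak order. -/
def AxiomWeakOrder (D : Set (W × S → ℝ)) (R : (W × S → ℝ) → (W × S → ℝ) → Prop) : Prop :=
  (∀ v ∈ D, ∀ u ∈ D, R v u ∨ R u v) ∧
  ∀ v ∈ D, ∀ u ∈ D, ∀ r ∈ D, R v u → R u r → R v r

/-- Neutrality. -/
def AxiomNeutrality (P : Kernel W S) (D : Set (W × S → ℝ))
    (R : (W × S → ℝ) → (W × S → ℝ) → Prop) : Prop :=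
  ∀ v ∈ D, ∀ u ∈ D, (∀ w t, condCDF P v w t = condCDF P u w t) → Indiff R v u

/-- Continuity. -/
def AxiomContinuity (P : Kernel W S) (D : Set (W × S → ℝ))
    (R : (W × S → ℝ) → (W × S → ℝ) → Prop) : Prop :=
  (∀ v ∈ D, ∀ u ∈ D, Unambiguous P v → Unambiguous P u → Strict R v u →
    ∀ vs us : ℕ → W × S → ℝ, (∀ n, vs n ∈ D ∧ Unambiguous P (vs n)) →
      (∀ n, us n ∈ D ∧ Unambiguous P (us n)) → UniformlyBounded vs → UniformlyBounded us →
      ConvInDist P vs v → ConvInDist P us u →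
      ∃ N, ∀ n ≥ N, Strict R (vs n) u ∧ Strict R v (us n)) ∧
  ∀ v ∈ D, IsOpen {m : ℝ | Strict R (sure m) v} ∧ IsOpen {m : ℝ | Strict R v (sure m)}

/-- Certainty first-order stochastic dominance and non-degeneracy. -/
def AxiomDominance (P : Kernel W S) (D : Set (W × S → ℝ))
    (R : (W × S → ℝ) → (W × S → ℝ) → Prop) : Prop :=
  ∀ v ∈ D, ∀ u ∈ D, Unambiguous P v → Unambiguous P u →
    (∀ w t, condCDF P v w t ≤ condCDF P u w t) →
    R v u ∧ ((∃ w t, condCDF P v w t < condCDF P u w t) → Strict R v u)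

/-- Monotonicity. -/
def AxiomMonotonicity (P : Kernel W S) (D : Set (W × S → ℝ))
    (R : (W × S → ℝ) → (W × S → ℝ) → Prop) : Prop :=
  ∀ v ∈ D, ∀ u ∈ D, (∀ w, LotteryPref P D R w v u) → R v u

/-- Dual ambiguity aversion. -/
def AxiomAmbiguityAversion (P : Kernel W S) (D : Set (W × S → ℝ))
    (R : (W × S → ℝ) → (W × S → ℝ) → Prop) : Prop :=
  ∀ (g h k : W → ℝ) (α : ℝ), riskless g ∈ D → riskless h ∈ D → riskless k ∈ D → 0 < α → α < 1 →
    Indiff R (riskless g) (riskless h) → (∀ w, SubjMix P R (g w) (h w) α (k w)) →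
    R (riskless k) (riskless g)

/-- Weak certainty dual independence (whenever the two subjective sums exist). -/
def AxiomDualIndependence (P : Kernel W S) (D : Set (W × S → ℝ))
    (R : (W × S → ℝ) → (W × S → ℝ) → Prop) : Prop :=
  ∀ v ∈ D, ∀ u ∈ D, ∀ r ∈ D, Unambiguous P r → Comonotonic v r → Comonotonic u r →
    ∀ v' ∈ D, ∀ u' ∈ D, (∀ x, SubjSum P R (v x) (r x) (v' x)) →
      (∀ x, SubjSum P R (u x) (r x) (u' x)) → R v u → R v' u'

/-- Binary comonotonic independence. -/
def AxiomBinaryIndependence (P : Kernel W S) (D : Set (W × S → ℝ))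
    (R : (W × S → ℝ) → (W × S → ℝ) → Prop) : Prop :=
  ∀ A B : Set (W × S), Essential P R A → UnambiguousEvent P B → ∀ x x' x'' y y' y'' : ℝ,
    Comonotonic (bet x A y) (bet x' A y') → Comonotonic (bet x A y) (bet x'' A y'') →
    Comonotonic (bet x' A y') (bet x'' A y'') →
    ((x'' ≤ x ∧ x'' ≤ x' ∧ y'' ≤ y ∧ y'' ≤ y') ∨ (x ≤ x'' ∧ x' ≤ x'' ∧ y ≤ y'' ∧ y' ≤ y'')) →
    ∀ v' ∈ D, ∀ u' ∈ D, IsSub R B (bet x A y) (bet x'' A y'') v' →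
      IsSub R B (bet x' A y') (bet x'' A y'') u' →
      R (bet x A y) (bet x' A y') → R v' u'

/-- The eight axioms together. -/
structure SatisfiesAxioms (P : Kernel W S) (D : Set (W × S → ℝ))
    (R : (W × S → ℝ) → (W × S → ℝ) → Prop) : Prop where
  weakOrder : AxiomWeakOrder D R
  neutrality : AxiomNeutrality P D R
  continuity : AxiomContinuity P D R
  dominance : AxiomDominance P D R
  monotonicity : AxiomMonotonicity P D R
  ambiguityAversion : AxiomAmbiguityAversion P D R
  dualIndependence : AxiomDualIndependence P D R
  binaryIndependence : AxiomBinaryIndependence P D R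

/-! ### The representation -/

/-- The rank-dependent integral `∫ X dν_ψ` of a bounded random variable on `(S, μ)`. -/
def rankIntegral (ψ : ℝ → ℝ) (μ : Measure S) (X : S → ℝ) : ℝ :=
  (∫ t in Iic (0 : ℝ), (ψ (1 - μ.real {s | X s ≤ t}) - 1)) +
    ∫ t in Ioi (0 : ℝ), ψ (1 - μ.real {s | X s ≤ t})

/-- The quantity `E_Q[∫ φ(v^·) dν_ψ] + c(Q)` that is minimized over `Q`. -/
def penalized (P : Kernel W S) (φ ψ : ℝ → ℝ) (c : FinAddProb W → ℝ≥0∞) (v : W × S → ℝ)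
    (Q : FinAddProb W) : EReal :=
  ((Q.expect fun w => rankIntegral ψ (P w) fun s => φ (v (w, s)) : ℝ) : EReal) + (c Q : EReal)

/-- `(φ, ψ, c)` is a rank-dependent variational representation of `R` on `D`; the minimum
`V v` over `Q` is required to be attained. -/
structure Represents (P : Kernel W S) (D : Set (W × S → ℝ))
    (R : (W × S → ℝ) → (W × S → ℝ) → Prop) (φ ψ : ℝ → ℝ) (c : FinAddProb W → ℝ≥0∞) : Prop where
  utility_continuous : Continuous φ
  utility_strictMono : StrictMono φ
  distortion_continuous : ContinuousOn ψ (Icc 0 1)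
  distortion_strictMono : StrictMonoOn ψ (Icc 0 1)
  distortion_zero : ψ 0 = 0
  distortion_one : ψ 1 = 1
  penalty_grounded : Grounded c
  penalty_convex : ConvexPenalty c
  penalty_lsc : LowerSemicontinuous c
  represents : ∃ V : (W × S → ℝ) → ℝ,
    (∀ v ∈ D, IsLeast (range (penalized P φ ψ c v)) (V v : EReal)) ∧
    ∀ v ∈ D, ∀ u ∈ D, (R v u ↔ V u ≤ V v)

/-- The penalty `Q ↦ sup {φ(m_v) - E_Q[φ(v)]}`, over the finite-valued random variables `v` without
risk, with `m_v` the certainty equivalent of `v`. (The supremum is at least `0`: take `v` constant.) -/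
def minPenalty (R : (W × S → ℝ) → (W × S → ℝ) → Prop) (φ : ℝ → ℝ) (Q : FinAddProb W) : ℝ≥0∞ :=
  ⨆ (g : W → ℝ) (m : ℝ) (_ : (riskless g : W × S → ℝ) ∈ finiteRV W S)
    (_ : IsCE R (riskless g) m), ENNReal.ofReal (φ m - Q.expect fun w => φ (g w))

end Setup

end RDV

end

open RDV

/-! Everything factors through the lottery utility of `v`, the function sending `w` to the
rank-dependent integral of `φ(v^w)`. The claim is that the preference is a monotone, translation
invariant, concave functional of this function; such functionals are exactly the minima of penalized
expectations.

From the representation to the axioms. A minimum over `Q` of expectations plus constants is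
monotone, concave and commutes with adding constants, and on unambiguous variables it is
rank-dependent utility. For every preference that ranks bets in this way (`BinRep`) the subjective
operations are arithmetic in utilities: a preference average is a midpoint, and the subjective sum
is addition measured from `φ 0`. Then ambiguity aversion is concavity, dual independence is
comonotonic additivity (`rankIntegral_add`) together with translation invariance, and binary
independence holds because the utility of a bet is affine while the ranking of its outcomes is
fixed.

From the axioms to the representation. The certainty equivalents of bets form a family of means `m p
t x`. Binary independence makes them bisymmetric (`BinaryMean.bisymm`), so compound weights do not
depend on the amounts (`BinaryMean.exists_law`), and the preference average is the mean with one
fixed weight `μ`. Dual independence says that sums, that is doubled averages, commute with means.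
Repeated halving and adding then yields a dyadic scale on a small interval in which each mean is a
weighted arithmetic mean (`TranslatableMean.scale_mean`); its weight is `ψ p`. The law of compound
weights carries this to the whole line and produces `φ`.

Dual independence next makes the value additive in comonotonic unambiguous summands, and peeling off
layers reduces unambiguous variables to bets (`BetUtility.value_eq_of_unambiguous`). By monotonicity
the value depends on the lottery utility alone, so riskless variables suffice. There it is a
functional `I` of simple functions, translation invariant by dual independence and concave by
ambiguity aversion (`BetUtility.concaveOn_utilityValue`). A Hahn–Banach supergradient of `I` at `f`
is a finitely additive probability `Q`, and it says precisely that `I g - E_Q g` is largest at `g =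
f`. So the penalty `sup (I g - E_Q g)` represents `I`, and rearranging the inequality `I g ≤ E_Q g +
c Q` shows that no penalty is smaller.

Extension. The formula itself extends the preference. It is unique because a bounded variable lies
between two finite-valued ones whose values are arbitrarily close.

A recurring obstacle is that the range of `φ` may be a bounded interval: sums of utilities can leave
it, so shifts are made in small steps and functions are capped. -/

noncomputable section

namespace RDV

/-! ### Integration against finitely additive probabilities -/

section FinAddLemmas
variable {W : Type*} [MeasurableSpace W]

/-- Boundedness of a real function. -/
def Bdd {α : Type*} (f : α → ℝ) : Prop := ∃ C, ∀ x, |f x| ≤ C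

theorem Bdd.of_mem_Icc {α : Type*} {f : α → ℝ} {a b : ℝ} (h : ∀ x, f x ∈ Icc a b) : Bdd f :=
  ⟨max |a| |b|, fun x => abs_le_max_abs_abs (h x).1 (h x).2⟩

theorem Bdd.exists_Icc {α : Type*} {f : α → ℝ} (h : Bdd f) : ∃ a b, a < b ∧ ∀ x, f x ∈ Icc a b := by
  obtain ⟨C, hC⟩ := h
  refine ⟨-(|C| + 1), |C| + 1, by have := abs_nonneg C; linarith, fun x => ?_⟩
  have h1 := abs_le.1 (hC x)
  have h2 := le_abs_self C
  exact ⟨by linarith, by linarith⟩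

theorem Bdd.const {α : Type*} (c : ℝ) : Bdd (fun _ : α => c) := ⟨|c|, fun _ => le_rfl⟩

theorem Bdd.add {α : Type*} {f g : α → ℝ} (hf : Bdd f) (hg : Bdd g) : Bdd (fun x => f x + g x) := by
  obtain ⟨C, hC⟩ := hf
  obtain ⟨D, hD⟩ := hg
  exact ⟨C + D, fun x => (abs_add_le _ _).trans (add_le_add (hC x) (hD x))⟩

theorem Bdd.const_mul {α : Type*} {f : α → ℝ} (hf : Bdd f) (c : ℝ) : Bdd (fun x => c * f x) := by
  obtain ⟨C, hC⟩ := hf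
  exact ⟨|c| * C, fun x => by rw [abs_mul]; exact mul_le_mul_of_nonneg_left (hC x) (abs_nonneg _)⟩

theorem Bdd.simpleFunc (g : SimpleFunc W ℝ) : Bdd g := by
  obtain ⟨C, hC⟩ := (g.finite_range.image (fun x => |x|)).bddAbove
  exact ⟨C, fun x => hC ⟨g x, ⟨x, rfl⟩, rfl⟩⟩

theorem Bdd.comp_continuous {α : Type*} {f : α → ℝ} (hf : Bdd f) {φ : ℝ → ℝ} (hφ : Continuous φ) :
    Bdd (fun x => φ (f x)) := by
  obtain ⟨a, b, -, hab⟩ := hf.exists_Icc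
  obtain ⟨C, hC⟩ := (isCompact_Icc (a := a) (b := b)).exists_bound_of_continuousOn hφ.continuousOn
  exact ⟨C, fun x => hC _ (hab x)⟩

variable (Q : FinAddProb W)

theorem FinAddProb.mass_mono {A B : Set W} (hA : MeasurableSet A) (hB : MeasurableSet B)
    (h : A ⊆ B) : Q.mass A ≤ Q.mass B := by
  have h1 := Q.mass_union A (B \ A) hA (hB.diff hA) disjoint_sdiff_right
  rw [union_sdiff_cancel h] at h1
  have := Q.mass_nonneg (B \ A)
  linarith

theorem FinAddProb.mass_le_one (A : Set W) : Q.mass A ≤ 1 := by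
  by_cases hA : MeasurableSet A
  · exact (Q.mass_mono hA MeasurableSet.univ (subset_univ _)).trans_eq Q.mass_univ
  · rw [Q.mass_of_not_measurable A hA]; exact zero_le_one

/-- The vector-valued set function used to see the integral of simple functions as an instance of
`SimpleFunc.setToSimpleFunc`. -/
def FinAddProb.setFun (A : Set W) : ℝ →L[ℝ] ℝ := Q.mass A • ContinuousLinearMap.id ℝ ℝ

theorem FinAddProb.simpleIntegral_eq (g : SimpleFunc W ℝ) :
    Q.simpleIntegral g = g.setToSimpleFunc Q.setFun := by
  simp [FinAddProb.simpleIntegral, SimpleFunc.setToSimpleFunc, FinAddProb.setFun, mul_comm]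

/-- The measure `0` is a dummy: for it every function is integrable and every set has finite mass,
so the linearity lemmas for `setToSimpleFunc` apply without side conditions. -/
theorem FinAddProb.finMeasAdditive : FinMeasAdditive (0 : Measure W) Q.setFun := by
  intro A B hA hB _ _ hd
  simp [FinAddProb.setFun, Q.mass_union A B hA hB hd, add_smul]

theorem FinAddProb.simpleIntegral_add (f g : SimpleFunc W ℝ) :
    Q.simpleIntegral (f + g) = Q.simpleIntegral f + Q.simpleIntegral g := by
  simp only [Q.simpleIntegral_eq]
  exact SimpleFunc.setToSimpleFunc_add _ Q.finMeasAdditive integrable_zero_measure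
    integrable_zero_measure

theorem FinAddProb.simpleIntegral_sub (f g : SimpleFunc W ℝ) :
    Q.simpleIntegral (f - g) = Q.simpleIntegral f - Q.simpleIntegral g := by
  simp only [Q.simpleIntegral_eq]
  exact SimpleFunc.setToSimpleFunc_sub _ Q.finMeasAdditive integrable_zero_measure
    integrable_zero_measure

theorem FinAddProb.simpleIntegral_smul (c : ℝ) (f : SimpleFunc W ℝ) :
    Q.simpleIntegral (c • f) = c * Q.simpleIntegral f := by
  simp only [Q.simpleIntegral_eq]
  exact SimpleFunc.setToSimpleFunc_smul_real _ Q.finMeasAdditive c integrable_zero_measure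

theorem FinAddProb.simpleIntegral_nonneg (g : SimpleFunc W ℝ) (h : ∀ w, 0 ≤ g w) :
    0 ≤ Q.simpleIntegral g := by
  refine Finset.sum_nonneg fun y hy => ?_
  obtain ⟨w, rfl⟩ := SimpleFunc.mem_range.1 hy
  exact mul_nonneg (h w) (Q.mass_nonneg _)

theorem FinAddProb.simpleIntegral_mono {f g : SimpleFunc W ℝ} (h : ∀ w, f w ≤ g w) :
    Q.simpleIntegral f ≤ Q.simpleIntegral g := by
  have := Q.simpleIntegral_nonneg (g - f) fun w => by simpa using h w
  rw [Q.simpleIntegral_sub] at this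
  linarith

theorem finite_range_floor {α : Type*} {f : α → ℝ} (hf : Bdd f) (ε : ℝ) :
    (range fun x => ε * (⌊f x / ε⌋ : ℝ)).Finite := by
  obtain ⟨a, b, -, hab⟩ := hf.exists_Icc
  have h1 : (range fun x => ⌊f x / ε⌋).Finite := by
    rcases le_total 0 ε with h | h
    · refine (Set.finite_Icc ⌊a / ε⌋ ⌊b / ε⌋).subset ?_
      rintro _ ⟨x, rfl⟩
      exact ⟨Int.floor_le_floor (div_le_div_of_nonneg_right (hab x).1 h),
        Int.floor_le_floor (div_le_div_of_nonneg_right (hab x).2 h)⟩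
    · refine (Set.finite_Icc ⌊b / ε⌋ ⌊a / ε⌋).subset ?_
      rintro _ ⟨x, rfl⟩
      exact ⟨Int.floor_le_floor (div_le_div_of_nonpos_of_le h (hab x).2),
        Int.floor_le_floor (div_le_div_of_nonpos_of_le h (hab x).1)⟩
  refine (h1.image fun k : ℤ => ε * (k : ℝ)).subset ?_
  rintro _ ⟨x, rfl⟩
  exact ⟨_, ⟨x, rfl⟩, rfl⟩

theorem floor_mul_le {ε : ℝ} (hε : 0 < ε) (y : ℝ) : ε * (⌊y / ε⌋ : ℝ) ≤ y := by
  have := Int.floor_le (y / ε)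
  rwa [le_div_iff₀' hε] at this

theorem lt_floor_mul_add {ε : ℝ} (hε : 0 < ε) (y : ℝ) : y < ε * (⌊y / ε⌋ : ℝ) + ε := by
  have := Int.lt_floor_add_one (y / ε)
  rw [div_lt_iff₀' hε] at this
  linarith

/-- Rounding down to multiples of `ε` leaves finitely many values of a bounded function. -/
theorem exists_simple_approx {f : W → ℝ} (hm : Measurable f) (hf : Bdd f) {ε : ℝ} (hε : 0 < ε) :
    ∃ g : SimpleFunc W ℝ, ∀ w, g w ≤ f w ∧ f w ≤ g w + ε := by
  have hmeas : Measurable fun w => ε * (⌊f w / ε⌋ : ℝ) := by fun_prop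
  exact ⟨⟨_, fun x => hmeas (measurableSet_singleton x), finite_range_floor hf ε⟩,
    fun w => ⟨floor_mul_le hε _, (lt_floor_mul_add hε _).le⟩⟩

/-- The penalized expectation `E_Q[f] + c(Q)`. -/
def penExpect (c : FinAddProb W → ℝ≥0∞) (f : W → ℝ) (Q : FinAddProb W) : EReal :=
  ((Q.expect f : ℝ) : EReal) + (c Q : EReal)

theorem penExpect_eq_coe {c : FinAddProb W → ℝ≥0∞} {f : W → ℝ} {Q : FinAddProb W} {r : ℝ}
    (h : penExpect c f Q = r) : c Q ≠ ⊤ ∧ r = Q.expect f + (c Q).toReal := by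
  have hc : c Q ≠ ⊤ := by
    intro hc
    simp [penExpect, hc] at h
  refine ⟨hc, ?_⟩
  rw [penExpect, ← ENNReal.ofReal_toReal hc, EReal.coe_ennreal_ofReal,
    max_eq_left ENNReal.toReal_nonneg, ← EReal.coe_add, EReal.coe_eq_coe_iff] at h
  exact h.symm

/-- Moving the expectation to the other side turns a lower bound on the penalized expectation into
one on the penalty. The truncation in `ENNReal.ofReal` costs nothing, as penalties are nonnegative.
-/
theorem coe_le_penExpect_iff {c : FinAddProb W → ℝ≥0∞} {f : W → ℝ} {Q : FinAddProb W} {r : ℝ} :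
    (r : EReal) ≤ penExpect c f Q ↔ ENNReal.ofReal (r - Q.expect f) ≤ c Q := by
  by_cases hc : c Q = ⊤
  · simp [penExpect, hc]
  · rw [penExpect, ← ENNReal.ofReal_toReal hc, EReal.coe_ennreal_ofReal,
      max_eq_left ENNReal.toReal_nonneg, ← EReal.coe_add, EReal.coe_le_coe_iff,
      ENNReal.ofReal_le_ofReal_iff ENNReal.toReal_nonneg]
    constructor <;> intro h <;> linarith

theorem coe_le_penExpect_of_ne_top {c : FinAddProb W → ℝ≥0∞} {f : W → ℝ} {Q : FinAddProb W} {r : ℝ}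
    (hc : c Q ≠ ⊤) : (r : EReal) ≤ penExpect c f Q ↔ r ≤ Q.expect f + (c Q).toReal := by
  rw [penExpect, ← ENNReal.ofReal_toReal hc, EReal.coe_ennreal_ofReal,
    max_eq_left ENNReal.toReal_nonneg, ← EReal.coe_add, EReal.coe_le_coe_iff,
    ENNReal.toReal_ofReal ENNReal.toReal_nonneg]

theorem FinAddProb.expect_nonempty {f : W → ℝ} (hf : Bdd f) :
    {a : ℝ | ∃ g : SimpleFunc W ℝ, (∀ w, g w ≤ f w) ∧ a = Q.simpleIntegral g}.Nonempty := by
  obtain ⟨C, hC⟩ := hf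
  exact ⟨_, SimpleFunc.const W (-C), fun w => (abs_le.1 (hC w)).1, rfl⟩

theorem continuous_expect {f : W → ℝ} (hm : Measurable f) (hf : Bdd f) :
    Continuous fun Q : FinAddProb W => Q.expect f := by
  have h : Continuous fun (Q : FinAddProb W)
      (f : {f : W → ℝ // Measurable f ∧ ∃ C, ∀ w, |f w| ≤ C}) => Q.expect f.1 :=
    continuous_induced_dom
  exact continuous_pi_iff.1 h ⟨f, hm, hf⟩

theorem FinAddProb.expect_le {f : W → ℝ} (hf : Bdd f) {r : ℝ}
    (h : ∀ g : SimpleFunc W ℝ, (∀ w, g w ≤ f w) → Q.simpleIntegral g ≤ r) : Q.expect f ≤ r := by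
  refine csSup_le (Q.expect_nonempty hf) ?_
  rintro _ ⟨g, hg, rfl⟩
  exact h g hg

variable [Nonempty W]

theorem FinAddProb.simpleIntegral_const (c : ℝ) :
    Q.simpleIntegral (SimpleFunc.const W c) = c := by
  have h : ⇑(SimpleFunc.const W c) ⁻¹' {c} = univ := by ext; simp
  simp [FinAddProb.simpleIntegral, SimpleFunc.range_const, -SimpleFunc.coe_const, h, Q.mass_univ]

theorem FinAddProb.expect_bddAbove {f : W → ℝ} (hf : Bdd f) :
    BddAbove {a : ℝ | ∃ g : SimpleFunc W ℝ, (∀ w, g w ≤ f w) ∧ a = Q.simpleIntegral g} := by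
  obtain ⟨C, hC⟩ := hf
  refine ⟨C, ?_⟩
  rintro _ ⟨g, hg, rfl⟩
  rw [← Q.simpleIntegral_const C]
  exact Q.simpleIntegral_mono fun w => (hg w).trans ((le_abs_self _).trans (hC w))

theorem FinAddProb.simpleIntegral_le_expect {f : W → ℝ} (hf : Bdd f) {g : SimpleFunc W ℝ}
    (h : ∀ w, g w ≤ f w) : Q.simpleIntegral g ≤ Q.expect f :=
  le_csSup (Q.expect_bddAbove hf) ⟨g, h, rfl⟩

theorem FinAddProb.expect_mono {f g : W → ℝ} (hf : Bdd f) (hg : Bdd g) (h : ∀ w, f w ≤ g w) :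
    Q.expect f ≤ Q.expect g :=
  Q.expect_le hf fun _ hk => Q.simpleIntegral_le_expect hg fun w => (hk w).trans (h w)

theorem FinAddProb.expect_simple (g : SimpleFunc W ℝ) : Q.expect g = Q.simpleIntegral g :=
  le_antisymm (Q.expect_le (Bdd.simpleFunc g) fun _ hk => Q.simpleIntegral_mono hk)
    (Q.simpleIntegral_le_expect (Bdd.simpleFunc g) fun _ => le_rfl)

theorem FinAddProb.expect_const (c : ℝ) : Q.expect (fun _ => c) = c :=
  (Q.expect_simple (SimpleFunc.const W c)).trans (Q.simpleIntegral_const c)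

/-- The expectation is a supremum over simple functions below, so superadditivity comes for free,
without measurability. It is enough here: only concavity and the addition of constants are used. -/
theorem FinAddProb.expect_add_le {f g : W → ℝ} (hf : Bdd f) (hg : Bdd g) :
    Q.expect f + Q.expect g ≤ Q.expect fun w => f w + g w := by
  rw [← le_sub_iff_add_le]
  refine Q.expect_le hf fun h hh => ?_
  rw [le_sub_comm]
  refine Q.expect_le hg fun k hk => ?_
  rw [le_sub_iff_add_le, add_comm, ← Q.simpleIntegral_add]
  exact Q.simpleIntegral_le_expect (hf.add hg) fun w => add_le_add (hh w) (hk w)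

theorem FinAddProb.expect_add_const {f : W → ℝ} (hf : Bdd f) (c : ℝ) :
    (Q.expect fun w => f w + c) = Q.expect f + c := by
  refine le_antisymm ?_ ?_
  · have := Q.expect_add_le (hf.add (Bdd.const c)) (Bdd.const (-c))
    simp only [add_neg_cancel_right, Q.expect_const] at this
    linarith
  · have := Q.expect_add_le hf (Bdd.const c)
    rwa [Q.expect_const] at this

theorem FinAddProb.expect_const_mul {f : W → ℝ} (hf : Bdd f) {c : ℝ} (hc : 0 ≤ c) :
    (Q.expect fun w => c * f w) = c * Q.expect f := by
  have key : ∀ {f : W → ℝ}, Bdd f → ∀ {c : ℝ}, 0 ≤ c →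
      c * Q.expect f ≤ Q.expect fun w => c * f w := by
    intro f hf c hc
    rcases hc.eq_or_lt with rfl | hc
    · simp [Q.expect_const]
    · rw [← le_div_iff₀' hc]
      refine Q.expect_le hf fun g hg => ?_
      rw [le_div_iff₀' hc, ← Q.simpleIntegral_smul]
      exact Q.simpleIntegral_le_expect (hf.const_mul c) fun w =>
        mul_le_mul_of_nonneg_left (hg w) hc.le
  refine le_antisymm ?_ (key hf hc)
  rcases hc.eq_or_lt with rfl | hc
  · simp [Q.expect_const]
  · have := key (hf.const_mul c) (inv_pos.2 hc).le
    simp only [inv_mul_cancel_left₀ hc.ne'] at this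
    rwa [inv_mul_le_iff₀ hc] at this

theorem FinAddProb.expect_concave {f g : W → ℝ} (hf : Bdd f) (hg : Bdd g) {a : ℝ} (ha : 0 ≤ a)
    (ha' : a ≤ 1) :
    a * Q.expect f + (1 - a) * Q.expect g ≤ Q.expect fun w => a * f w + (1 - a) * g w := by
  rw [← Q.expect_const_mul hf ha, ← Q.expect_const_mul hg (sub_nonneg.2 ha')]
  exact Q.expect_add_le (hf.const_mul a) (hg.const_mul _)

theorem FinAddProb.expect_le_add {f g : W → ℝ} (hf : Bdd f) (hg : Bdd g) {k : ℝ}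
    (h : ∀ w, f w ≤ g w + k) : Q.expect f ≤ Q.expect g + k := by
  rw [← Q.expect_add_const hg]
  exact Q.expect_mono hf (hg.add (Bdd.const k)) h

/-- Along an ultrafilter the masses converge in `[0, 1]` event by event, and the limits are again
finitely additive. Expectations of simple functions then converge, and uniform approximation by
simple functions gives all bounded measurable ones. -/
instance : CompactSpace (FinAddProb W) := by
  refine ⟨isCompact_iff_ultrafilter_le_nhds.2 fun 𝒰 _ => ?_⟩
  have hlim : ∀ A : Set W, ∃ l ∈ Icc (0 : ℝ) 1, Tendsto (fun Q : FinAddProb W => Q.mass A) 𝒰 (𝓝 l) := by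
    intro A
    have := isCompact_iff_ultrafilter_le_nhds.1 (isCompact_Icc (a := (0 : ℝ)) (b := 1))
      (𝒰.map fun Q : FinAddProb W => Q.mass A) (by
        rw [Ultrafilter.coe_map, le_principal_iff, mem_map]
        exact univ_mem' fun Q => ⟨Q.mass_nonneg A, Q.mass_le_one A⟩)
    exact this
  choose l hl hlt using hlim
  let Q₀ : FinAddProb W :=
    { mass := l
      mass_nonneg := fun A => (hl A).1
      mass_univ := tendsto_nhds_unique (hlt univ) (by
        simp only [FinAddProb.mass_univ]; exact tendsto_const_nhds)
      mass_union := fun A B hA hB hd => tendsto_nhds_unique (hlt _) (by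
        simp only [FinAddProb.mass_union _ A B hA hB hd]; exact (hlt A).add (hlt B))
      mass_of_not_measurable := fun A hA => tendsto_nhds_unique (hlt A) (by
        simp only [FinAddProb.mass_of_not_measurable _ A hA]; exact tendsto_const_nhds) }
  have hsimple : ∀ g : SimpleFunc W ℝ,
      Tendsto (fun Q : FinAddProb W => Q.simpleIntegral g) 𝒰 (𝓝 (Q₀.simpleIntegral g)) := fun g =>
    tendsto_finsetSum _ fun y _ => (hlt _).const_mul y
  refine ⟨Q₀, mem_univ _, ?_⟩
  rw [nhds_induced, ← tendsto_iff_comap, tendsto_pi_nhds]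
  rintro ⟨f, hm, hf⟩
  rw [Metric.tendsto_nhds]
  intro ε hε
  obtain ⟨g, hg⟩ := exists_simple_approx hm hf (show 0 < ε / 3 by positivity)
  filter_upwards [Metric.tendsto_nhds.1 (hsimple g) (ε / 3) (by positivity)] with Q hQ
  have hb : ∀ Q : FinAddProb W, Q.simpleIntegral g ≤ Q.expect f ∧
      Q.expect f ≤ Q.simpleIntegral g + ε / 3 := fun Q => by
    rw [← Q.expect_simple]
    exact ⟨Q.expect_mono (Bdd.simpleFunc g) hf fun w => (hg w).1,
      Q.expect_le_add hf (Bdd.simpleFunc g) fun w => (hg w).2⟩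
  have h1 := hb Q
  have h2 := hb Q₀
  rw [Real.dist_eq, abs_lt] at hQ ⊢
  constructor <;> linarith [h1.1, h1.2, h2.1, h2.2, hQ.1, hQ.2]

/-! ### Penalized expectations -/

theorem exists_isLeast_penExpect {c : FinAddProb W → ℝ≥0∞} (hg : Grounded c)
    (hc : LowerSemicontinuous c) {f : W → ℝ} (hm : Measurable f) (hf : Bdd f) :
    ∃ r : ℝ, IsLeast (range (penExpect c f)) (r : EReal) := by
  obtain ⟨⟨Q₁, hQ₁⟩, -⟩ := hg
  have hls : LowerSemicontinuous (penExpect c f) := by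
    refine LowerSemicontinuous.add' ?_ ?_ fun Q => ?_
    · exact (continuous_coe_real_ereal.comp (continuous_expect hm hf)).lowerSemicontinuous
    · exact Continuous.comp_lowerSemicontinuous continuous_coe_ennreal_ereal hc
        EReal.coe_ennreal_strictMono.monotone
    · exact EReal.continuousAt_add (Or.inl (EReal.coe_ne_top _)) (Or.inl (EReal.coe_ne_bot _))
  obtain ⟨Q, -, hQ⟩ := LowerSemicontinuousOn.exists_isMinOn (s := univ) ⟨Q₁, mem_univ _⟩
    isCompact_univ (hls.lowerSemicontinuousOn univ)
  have hle : ∀ Q', penExpect c f Q ≤ penExpect c f Q' := fun Q' => hQ (mem_univ Q')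
  -- The point `Q₁` of zero penalty keeps the minimum finite.
  have htop : c Q ≠ ⊤ := by
    intro h
    have := hle Q₁
    simp only [penExpect, h, hQ₁] at this
    simp at this
  refine ⟨Q.expect f + (c Q).toReal, ⟨Q, ?_⟩, ?_⟩
  · rw [penExpect, ← ENNReal.ofReal_toReal htop, EReal.coe_ennreal_ofReal,
      max_eq_left ENNReal.toReal_nonneg, ENNReal.toReal_ofReal ENNReal.toReal_nonneg,
      EReal.coe_add]
  · rintro _ ⟨Q', rfl⟩
    exact ((coe_le_penExpect_of_ne_top htop).2 le_rfl).trans' le_rfl |>.trans (hle Q')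

/-- A minimizer for `g` is a competitor for `f`. With `k` of either sign this contains monotonicity
and translation invariance. -/
theorem isLeast_penExpect_le {c : FinAddProb W → ℝ≥0∞} {f g : W → ℝ} (hf : Bdd f) (hg : Bdd g)
    {r s k : ℝ} (hr : IsLeast (range (penExpect c f)) (r : EReal))
    (hs : IsLeast (range (penExpect c g)) (s : EReal)) (h : ∀ w, f w ≤ g w + k) : r ≤ s + k := by
  obtain ⟨Q, hQ⟩ := hs.1
  obtain ⟨hc, rfl⟩ := penExpect_eq_coe hQ
  have h1 := (coe_le_penExpect_of_ne_top hc).1 (hr.2 ⟨Q, rfl⟩)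
  linarith [Q.expect_le_add hf hg h]

theorem isLeast_penExpect_concave {c : FinAddProb W → ℝ≥0∞} {f g : W → ℝ} (hf : Bdd f) (hg : Bdd g)
    {r s q a : ℝ} (ha : 0 ≤ a) (ha' : a ≤ 1) (hr : IsLeast (range (penExpect c f)) (r : EReal))
    (hs : IsLeast (range (penExpect c g)) (s : EReal))
    (hq : IsLeast (range (penExpect c fun w => a * f w + (1 - a) * g w)) (q : EReal)) :
    a * r + (1 - a) * s ≤ q := by
  obtain ⟨Q, hQ⟩ := hq.1
  obtain ⟨hc, rfl⟩ := penExpect_eq_coe hQ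
  have h1 := (coe_le_penExpect_of_ne_top hc).1 (hr.2 ⟨Q, rfl⟩)
  have h2 := (coe_le_penExpect_of_ne_top hc).1 (hs.2 ⟨Q, rfl⟩)
  have h3 := Q.expect_concave hf hg ha ha'
  nlinarith [mul_le_mul_of_nonneg_left h1 ha, mul_le_mul_of_nonneg_left h2 (sub_nonneg.2 ha')]

theorem isLeast_penExpect_const {c : FinAddProb W → ℝ≥0∞} (hc : Grounded c) (k : ℝ) :
    IsLeast (range (penExpect c fun _ => k)) (k : EReal) := by
  obtain ⟨⟨Q, hQ⟩, -⟩ := hc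
  refine ⟨⟨Q, by simp [penExpect, hQ, Q.expect_const]⟩, ?_⟩
  rintro _ ⟨Q', rfl⟩
  rw [coe_le_penExpect_iff, Q'.expect_const]
  simp

end FinAddLemmas

/-! ### Rank-dependent integrals -/

/-- Distortions of probabilities. -/
structure Distortion (ψ : ℝ → ℝ) : Prop where
  continuousOn : ContinuousOn ψ (Icc 0 1)
  strictMonoOn : StrictMonoOn ψ (Icc 0 1)
  zero : ψ 0 = 0
  one : ψ 1 = 1

namespace Distortion
variable {ψ : ℝ → ℝ} (hψ : Distortion ψ)
include hψ

theorem mem_Icc {p : ℝ} (hp : p ∈ Icc (0 : ℝ) 1) : ψ p ∈ Icc (0 : ℝ) 1 := by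
  have h0 := hψ.strictMonoOn.monotoneOn (left_mem_Icc.2 zero_le_one) hp hp.1
  have h1 := hψ.strictMonoOn.monotoneOn hp (right_mem_Icc.2 zero_le_one) hp.2
  rw [hψ.zero] at h0
  rw [hψ.one] at h1
  exact ⟨h0, h1⟩

theorem mem_Ioo {p : ℝ} (hp : p ∈ Ioo (0 : ℝ) 1) : ψ p ∈ Ioo (0 : ℝ) 1 := by
  have h0 := hψ.strictMonoOn (left_mem_Icc.2 zero_le_one) (Ioo_subset_Icc_self hp) hp.1
  have h1 := hψ.strictMonoOn (Ioo_subset_Icc_self hp) (right_mem_Icc.2 zero_le_one) hp.2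
  rw [hψ.zero] at h0
  rw [hψ.one] at h1
  exact ⟨h0, h1⟩

end Distortion

section Rank
variable {S : Type*} [MeasurableSpace S] {ψ : ℝ → ℝ} (hψ : Distortion ψ) (μ : Measure S)
  [IsProbabilityMeasure μ]

/-- The distorted decumulative distribution function. -/
def distTail (ψ : ℝ → ℝ) (μ : Measure S) (X : S → ℝ) (t : ℝ) : ℝ := ψ (1 - μ.real {s | X s ≤ t})

theorem one_sub_real_mem_Icc (A : Set S) : 1 - μ.real A ∈ Icc (0 : ℝ) 1 := by
  have h1 : μ.real A ≤ 1 := measureReal_le_one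
  have h0 : 0 ≤ μ.real A := measureReal_nonneg
  constructor <;> linarith

include hψ in
theorem distTail_le_of_le {X Y : S → ℝ} {t r : ℝ} (h : μ.real {s | X s ≤ t} ≤ μ.real {s | Y s ≤ r}) :
    distTail ψ μ Y r ≤ distTail ψ μ X t :=
  hψ.strictMonoOn.monotoneOn (one_sub_real_mem_Icc μ _) (one_sub_real_mem_Icc μ _) (by linarith)

include hψ in
theorem distTail_antitone (X : S → ℝ) : Antitone (distTail ψ μ X) := fun _ _ h =>
  distTail_le_of_le hψ μ (measureReal_mono fun _ hs => le_trans (mem_ofPred.1 hs) h)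

include hψ in
theorem distTail_mem_Icc (X : S → ℝ) (t : ℝ) : distTail ψ μ X t ∈ Icc (0 : ℝ) 1 :=
  hψ.mem_Icc (one_sub_real_mem_Icc μ _)

include hψ in
theorem distTail_of_lt {X : S → ℝ} {a t : ℝ} (h : ∀ s, a ≤ X s) (ht : t < a) :
    distTail ψ μ X t = 1 := by
  have : {s | X s ≤ t} = ∅ := eq_empty_of_forall_notMem fun s hs =>
    absurd (mem_ofPred.1 hs) (not_le.2 (ht.trans_le (h s)))
  simp [distTail, this, hψ.one]

include hψ in
theorem distTail_of_ge {X : S → ℝ} {b t : ℝ} (h : ∀ s, X s ≤ b) (ht : b ≤ t) :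
    distTail ψ μ X t = 0 := by
  have : {s | X s ≤ t} = univ := eq_univ_of_forall fun s => (h s).trans ht
  simp [distTail, this, hψ.zero]

include hψ in
theorem distTail_intervalIntegrable (X : S → ℝ) (a b : ℝ) :
    IntervalIntegrable (distTail ψ μ X) volume a b :=
  (distTail_antitone hψ μ X).intervalIntegrable

include hψ in
-- Below `a` the distorted tail is `1` and from `b` on it is `0`, so the two half-line integrals
-- collapse to one over a compact interval. Comparisons use this form with bounds common to both
-- variables.
theorem rankIntegral_eq {X : S → ℝ} {a b : ℝ} (hab : a ≤ b) (h : ∀ s, X s ∈ Icc a b) :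
    rankIntegral ψ μ X = a + ∫ t in a..b, distTail ψ μ X t := by
  set G := distTail ψ μ X with hG
  have hi := distTail_intervalIntegrable hψ μ X
  have hlow : ∀ a' b', b' ≤ a → a' ≤ b' → ∫ t in a'..b', G t = b' - a' := by
    intro a' b' h1 h2
    rw [intervalIntegral.integral_of_le h2, integral_Ioc_eq_integral_Ioo,
      setIntegral_congr_fun measurableSet_Ioo (g := fun _ => (1 : ℝ)) fun t ht =>
        distTail_of_lt hψ μ (fun s => (h s).1) (ht.2.trans_le h1)]
    simp [h2]
  have hhigh : ∀ a' b', b ≤ a' → a' ≤ b' → ∫ t in a'..b', G t = 0 := by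
    intro a' b' h1 h2
    rw [intervalIntegral.integral_of_le h2,
      setIntegral_congr_fun measurableSet_Ioc (g := fun _ => (0 : ℝ)) fun t ht =>
        distTail_of_ge hψ μ (fun s => (h s).2) (h1.trans ht.1.le)]
    simp
  have e1 : ∫ t in Iic (0 : ℝ), (G t - 1) = ∫ t in (min a 0)..0, (G t - 1) := by
    rw [intervalIntegral.integral_of_le (min_le_right _ _), integral_Ioc_eq_integral_Ioo,
      ← integral_Ico_eq_integral_Ioo, integral_Iic_eq_integral_Iio]
    refine setIntegral_eq_of_subset_of_forall_sdiff_eq_zero measurableSet_Iio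
      Ico_subset_Iio_self fun t ht => ?_
    have h1 : t < 0 := ht.1
    have h2 : t < a := by
      by_contra h2
      exact ht.2 ⟨(min_le_left _ _).trans (not_lt.1 h2), h1⟩
    rw [hG, distTail_of_lt hψ μ (fun s => (h s).1) h2, sub_self]
  have e2 : ∫ t in Ioi (0 : ℝ), G t = ∫ t in 0..(max b 0), G t := by
    rw [intervalIntegral.integral_of_le (le_max_right _ _)]
    refine setIntegral_eq_of_subset_of_forall_sdiff_eq_zero measurableSet_Ioi
      Ioc_subset_Ioi_self fun t ht => ?_
    have h1 : 0 < t := ht.1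
    have h2 : b ≤ t := by
      by_contra h2
      exact ht.2 ⟨h1, (not_le.1 h2).le.trans (le_max_left _ _)⟩
    exact distTail_of_ge hψ μ (fun s => (h s).2) h2
  have e3 : rankIntegral ψ μ X = (∫ t in Iic (0 : ℝ), (G t - 1)) + ∫ t in Ioi (0 : ℝ), G t := rfl
  rw [e3, e1, e2, intervalIntegral.integral_sub (hi _ _) (by simp), intervalIntegral.integral_const,
    smul_eq_mul, mul_one]
  have e4 := intervalIntegral.integral_add_adjacent_intervals (hi (min a 0) 0) (hi 0 (max b 0))
  have e5 := intervalIntegral.integral_add_adjacent_intervals (hi (min a 0) a) (hi a b)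
  have e6 := intervalIntegral.integral_add_adjacent_intervals (hi (min a 0) b) (hi b (max b 0))
  rw [hlow _ _ le_rfl (min_le_left _ _)] at e5
  rw [hhigh _ _ le_rfl (le_max_left _ _)] at e6
  linarith

include hψ in
theorem rankIntegral_mem_Icc {X : S → ℝ} {a b : ℝ} (hab : a ≤ b) (h : ∀ s, X s ∈ Icc a b) :
    rankIntegral ψ μ X ∈ Icc a b := by
  rw [rankIntegral_eq hψ μ hab h]
  have h0 : 0 ≤ ∫ t in a..b, distTail ψ μ X t :=
    intervalIntegral.integral_nonneg hab fun t _ => (distTail_mem_Icc hψ μ X t).1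
  have h1 : ∫ t in a..b, distTail ψ μ X t ≤ ∫ t in a..b, (1 : ℝ) :=
    intervalIntegral.integral_mono_on hab (distTail_intervalIntegrable hψ μ X a b) (by simp)
      fun t _ => (distTail_mem_Icc hψ μ X t).2
  simp only [intervalIntegral.integral_const, smul_eq_mul, mul_one] at h1
  constructor <;> linarith

include hψ in
theorem rankIntegral_const (a : ℝ) : rankIntegral ψ μ (fun _ => a) = a := by
  have := rankIntegral_mem_Icc hψ μ (X := fun _ => a) le_rfl fun _ => left_mem_Icc.2 le_rfl
  rwa [Icc_self] at this

include hψ in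
-- The two measures may differ, so lotteries in different states of the world can be compared.
theorem rankIntegral_mono_dist {S' : Type*} [MeasurableSpace S'] (μ' : Measure S')
    [IsProbabilityMeasure μ'] {X : S → ℝ} {Y : S' → ℝ} (hX : Bdd X) (hY : Bdd Y)
    (h : ∀ t, μ.real {s | X s ≤ t} ≤ μ'.real {s | Y s ≤ t}) :
    rankIntegral ψ μ' Y ≤ rankIntegral ψ μ X := by
  obtain ⟨a, b, -, hab⟩ := hX.exists_Icc
  obtain ⟨a', b', -, hab'⟩ := hY.exists_Icc
  have hS : Nonempty S := nonempty_of_isProbabilityMeasure μ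
  have hab0 : a ≤ b := (hab hS.some).1.trans (hab hS.some).2
  have hle : min a a' ≤ max b b' := (min_le_left _ _).trans (hab0.trans (le_max_left _ _))
  rw [rankIntegral_eq hψ μ hle fun s => ⟨(min_le_left _ _).trans (hab s).1,
      (hab s).2.trans (le_max_left _ _)⟩,
    rankIntegral_eq hψ μ' hle fun s => ⟨(min_le_right _ _).trans (hab' s).1,
      (hab' s).2.trans (le_max_right _ _)⟩]
  refine add_le_add le_rfl (intervalIntegral.integral_mono_on hle
    (distTail_intervalIntegrable hψ μ' Y _ _) (distTail_intervalIntegrable hψ μ X _ _) fun t _ => ?_)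
  exact hψ.strictMonoOn.monotoneOn (one_sub_real_mem_Icc μ' _) (one_sub_real_mem_Icc μ _)
    (by linarith [h t])

include hψ in
theorem rankIntegral_mono {X Y : S → ℝ} (hX : Bdd X) (hY : Bdd Y) (h : ∀ s, X s ≤ Y s) :
    rankIntegral ψ μ X ≤ rankIntegral ψ μ Y :=
  rankIntegral_mono_dist hψ μ μ hY hX fun _ => measureReal_mono fun s hs => (h s).trans hs

theorem tendsto_real_setOf_le {X : S → ℝ} (hX : Measurable X) (t : ℝ) :
    Tendsto (fun r => μ.real {s | X s ≤ r}) (𝓝[>] t) (𝓝 (μ.real {s | X s ≤ t})) := by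
  have hmono : Monotone fun r => μ.real {s | X s ≤ r} := fun _ _ h =>
    measureReal_mono fun _ hs => le_trans (mem_ofPred.1 hs) h
  have h1 := hmono.tendsto_nhdsGT t
  have h2 : Tendsto (fun n : ℕ => t + 1 / ((n : ℝ) + 1)) atTop (𝓝[>] t) := by
    refine tendsto_nhdsWithin_iff.2 ⟨?_, Eventually.of_forall fun n => ?_⟩
    · simpa using (tendsto_one_div_add_atTop_nhds_zero_nat (𝕜 := ℝ)).const_add t
    · show t < t + 1 / ((n : ℝ) + 1)
      have : (0 : ℝ) < 1 / ((n : ℝ) + 1) := by positivity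
      linarith
  have h3 : Tendsto (fun n : ℕ => μ.real {s | X s ≤ t + 1 / ((n : ℝ) + 1)}) atTop
      (𝓝 (μ.real {s | X s ≤ t})) := by
    have hI : {s | X s ≤ t} = ⋂ n : ℕ, {s | X s ≤ t + 1 / ((n : ℝ) + 1)} := by
      ext s
      simp only [mem_ofPred_eq, mem_iInter]
      refine ⟨fun h n => h.trans (lt_add_of_pos_right _ (by positivity)).le, fun h => ?_⟩
      refine ge_of_tendsto' (f := fun n : ℕ => t + 1 / ((n : ℝ) + 1)) (x := atTop) ?_ h
      simpa using (tendsto_one_div_add_atTop_nhds_zero_nat (𝕜 := ℝ)).const_add t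
    have := tendsto_measure_iInter_atTop (μ := μ)
      (s := fun n : ℕ => {s | X s ≤ t + 1 / ((n : ℝ) + 1)})
      (fun n => (measurableSet_le hX measurable_const).nullMeasurableSet)
      (fun n m hnm s hs => le_trans (mem_ofPred.1 hs) (by gcongr)) ⟨0, measure_ne_top _ _⟩
    rw [← hI] at this
    exact (ENNReal.tendsto_toReal (measure_ne_top _ _)).comp this
  have := tendsto_nhds_unique (h1.comp h2) h3
  rwa [this] at h1

include hψ in
-- A gap between the distribution functions at one point persists on an interval to its right, by
-- right continuity of the one and monotonicity of the other; so the tails differ on a set of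
-- positive length.
theorem rankIntegral_strict_mono_dist {S' : Type*} [MeasurableSpace S'] (μ' : Measure S')
    [IsProbabilityMeasure μ'] {X : S → ℝ} {Y : S' → ℝ} (hXm : Measurable X) (hX : Bdd X)
    (hY : Bdd Y) (h : ∀ t, μ.real {s | X s ≤ t} ≤ μ'.real {s | Y s ≤ t})
    {t₀ : ℝ} (h₀ : μ.real {s | X s ≤ t₀} < μ'.real {s | Y s ≤ t₀}) :
    rankIntegral ψ μ' Y < rankIntegral ψ μ X := by
  obtain ⟨a, b, -, hab⟩ := hX.exists_Icc
  obtain ⟨a', b', -, hab'⟩ := hY.exists_Icc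
  set A := min (min a a') t₀ with hA
  set B := max (max b b') (t₀ + 1) with hB
  have hAt : A ≤ t₀ := min_le_right _ _
  have htB : t₀ < B := (lt_add_one t₀).trans_le (le_max_right _ _)
  have hle : A < B := hAt.trans_lt htB
  have hXI : ∀ s, X s ∈ Icc A B := fun s =>
    ⟨((min_le_left _ _).trans (min_le_left _ _)).trans (hab s).1,
      (hab s).2.trans ((le_max_left _ _).trans (le_max_left _ _))⟩
  have hYI : ∀ s, Y s ∈ Icc A B := fun s =>
    ⟨((min_le_left _ _).trans (min_le_right _ _)).trans (hab' s).1,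
      (hab' s).2.trans ((le_max_right _ _).trans (le_max_left _ _))⟩
  rw [rankIntegral_eq hψ μ hle.le hXI, rankIntegral_eq hψ μ' hle.le hYI]
  refine add_lt_add_of_le_of_lt le_rfl ?_
  refine intervalIntegral.integral_lt_integral_of_ae_le_of_measure_setOfPred_lt_ne_zero hle.le
    (distTail_intervalIntegrable hψ μ' Y _ _) (distTail_intervalIntegrable hψ μ X _ _) ?_ ?_
  · exact Eventually.of_forall fun t => hψ.strictMonoOn.monotoneOn (one_sub_real_mem_Icc μ' _)
      (one_sub_real_mem_Icc μ _) (by linarith [h t])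
  · have hev := (tendsto_real_setOf_le μ hXm t₀).eventually_lt_const h₀
    obtain ⟨r, hr, hr'⟩ := mem_nhdsGT_iff_exists_Ioo_subset.1 hev
    have hsub : Ioo t₀ (min r B) ⊆ {t | distTail ψ μ' Y t < distTail ψ μ X t} ∩ Ioc A B := by
      intro t ht
      refine ⟨?_, hAt.trans_lt ht.1, (ht.2.trans_le (min_le_right _ _)).le⟩
      refine hψ.strictMonoOn (one_sub_real_mem_Icc μ' _) (one_sub_real_mem_Icc μ _) ?_
      have h1 : μ.real {s | X s ≤ t} < μ'.real {s | Y s ≤ t₀} :=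
        hr' ⟨ht.1, ht.2.trans_le (min_le_left _ _)⟩
      have h2 : μ'.real {s | Y s ≤ t₀} ≤ μ'.real {s | Y s ≤ t} :=
        measureReal_mono fun s hs => le_trans (mem_ofPred.1 hs) ht.1.le
      linarith
    rw [Measure.restrict_apply' measurableSet_Ioc]
    refine (lt_of_lt_of_le ?_ (measure_mono hsub)).ne'
    rw [Real.volume_Ioo, ENNReal.ofReal_pos, sub_pos]
    exact lt_min hr htB

/-- The law of a two-valued random variable determines its rank-dependent integral. -/
theorem rankIntegral_indicator (hψ : Distortion ψ) {X : S → ℝ} {A : Set S} (hA : MeasurableSet A)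
    {x y : ℝ} (hxy : y ≤ x) (h1 : ∀ s ∈ A, X s = x) (h2 : ∀ s ∉ A, X s = y) :
    rankIntegral ψ μ X = ψ (μ.real A) * x + (1 - ψ (μ.real A)) * y := by
  have hI : ∀ s, X s ∈ Icc y x := fun s => by
    by_cases hs : s ∈ A
    · rw [h1 s hs]; exact right_mem_Icc.2 hxy
    · rw [h2 s hs]; exact left_mem_Icc.2 hxy
  rw [rankIntegral_eq hψ μ hxy hI, intervalIntegral.integral_of_le hxy,
    integral_Ioc_eq_integral_Ioo,
    setIntegral_congr_fun measurableSet_Ioo (g := fun _ => ψ (μ.real A)) fun t ht => ?_]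
  · simp [hxy]; ring
  · have : {s | X s ≤ t} = Aᶜ := by
      ext s
      by_cases hs : s ∈ A
      · simp [h1 s hs, hs, ht.2]
      · simp [h2 s hs, hs, ht.1.le]
    simp only [distTail, this, probReal_compl_eq_one_sub hA, sub_sub_cancel]

/-- Two random variables are comonotonic on `S`. -/
def ComonotonicOn (X Y : S → ℝ) : Prop := ∀ s s', 0 ≤ (X s' - X s) * (Y s' - Y s)

/-- Two points that witness the failure of both inclusions would move `X` and `Y` in opposite
directions. -/
theorem ComonotonicOn.nested {S : Type*} [MeasurableSpace S] {X Y : S → ℝ} (h : ComonotonicOn X Y)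
    (t r : ℝ) : {s | X s ≤ t} ⊆ {s | Y s ≤ r} ∨ {s | Y s ≤ r} ⊆ {s | X s ≤ t} := by
  by_contra! hcon
  obtain ⟨h1, h2⟩ := hcon
  obtain ⟨s, hs, hs'⟩ := not_subset.1 h1
  obtain ⟨s', hr, hr'⟩ := not_subset.1 h2
  simp only [mem_ofPred_eq, not_le] at hs hs' hr hr'
  have := h s s'
  nlinarith [mul_pos (show 0 < X s' - X s by linarith) (show 0 < Y s - Y s' by linarith)]

include hψ in
-- The quantile is the supremum of the amounts at which the distorted tail exceeds `u`. Comonotonic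
-- additivity will be proved quantile by quantile.
theorem exists_quantile {X : S → ℝ} {a b : ℝ} (h : ∀ s, X s ∈ Icc a b) {u : ℝ} (hu : 0 < u)
    (hu' : u < 1) : ∃ q ∈ Icc a b, (∀ t < q, u < distTail ψ μ X t) ∧
      ∀ t, q < t → distTail ψ μ X t ≤ u := by
  set T := {t | u < distTail ψ μ X t} with hT
  have hlow : ∀ t < a, t ∈ T := fun t ht => by
    rw [hT, mem_ofPred_eq, distTail_of_lt hψ μ (fun s => (h s).1) ht]; exact hu'
  have hne : T.Nonempty := ⟨a - 1, hlow _ (by linarith)⟩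
  have hub : b ∈ upperBounds T := fun t ht => by
    by_contra hb
    rw [hT, mem_ofPred_eq, distTail_of_ge hψ μ (fun s => (h s).2) (not_le.1 hb).le] at ht
    linarith
  have hbdd : BddAbove T := ⟨b, hub⟩
  refine ⟨sSup T, ⟨?_, csSup_le hne hub⟩, fun t ht => ?_, fun t ht => ?_⟩
  · exact le_of_forall_lt fun t ht => by
      obtain ⟨t', h1, h2⟩ := exists_between ht
      exact h1.trans_le (le_csSup hbdd (hlow t' h2))
  · obtain ⟨t', h1, h2⟩ := exists_lt_of_lt_csSup hne ht
    exact lt_of_lt_of_le h1 (distTail_antitone hψ μ X h2.le)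
  · by_contra hcon
    exact absurd (le_csSup hbdd (not_le.1 hcon)) (not_le.2 ht)

theorem volume_superlevel {G : ℝ → ℝ} {a b q u : ℝ} (hq : q ∈ Icc a b)
    (h1 : ∀ t < q, u < G t) (h2 : ∀ t, q < t → G t ≤ u) :
    (volume.restrict (Ioc a b)).real {t | u < G t} = q - a := by
  have hm : (volume.restrict (Ioc a b)) {t | u < G t} = volume ({t | u < G t} ∩ Ioc a b) :=
    Measure.restrict_apply' measurableSet_Ioc
  have hA : Ioo a q ⊆ {t | u < G t} ∩ Ioc a b := fun t ht =>
    ⟨h1 t ht.2, ht.1, (ht.2.trans_le hq.2).le⟩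
  have hB : {t | u < G t} ∩ Ioc a b ⊆ Ioc a q := fun t ht =>
    ⟨ht.2.1, not_lt.1 fun hlt => absurd (h2 t hlt) (not_le.2 ht.1)⟩
  have : volume ({t | u < G t} ∩ Ioc a b) = ENNReal.ofReal (q - a) :=
    le_antisymm ((measure_mono hB).trans_eq Real.volume_Ioc)
      (Real.volume_Ioo.symm.trans_le (measure_mono hA))
  rw [measureReal_def, hm, this, ENNReal.toReal_ofReal (sub_nonneg.2 hq.1)]

include hψ in
-- The layer-cake formula: the integral over amounts becomes one over levels `u`, whose integrand is
-- a quantile minus the left end point.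
theorem integral_distTail_eq {X : S → ℝ} {a b : ℝ} (hab : a ≤ b) :
    ∫ t in a..b, distTail ψ μ X t =
      ∫ u in Ioo (0 : ℝ) 1, (volume.restrict (Ioc a b)).real {t | u < distTail ψ μ X t} := by
  rw [intervalIntegral.integral_of_le hab, Integrable.integral_eq_integral_meas_lt
    ((intervalIntegrable_iff_integrableOn_Ioc_of_le hab).1 (distTail_intervalIntegrable hψ μ X a b))
    (Eventually.of_forall fun t => (distTail_mem_Icc hψ μ X t).1)]
  refine setIntegral_eq_of_subset_of_forall_sdiff_eq_zero measurableSet_Ioi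
    Ioo_subset_Ioi_self fun u hu => ?_
  have hu1 : 1 ≤ u := by
    by_contra h
    exact hu.2 ⟨hu.1, not_le.1 h⟩
  have : {t | u < distTail ψ μ X t} = ∅ := eq_empty_of_forall_notMem fun t ht =>
    absurd (mem_ofPred.1 ht) (not_lt.2 ((distTail_mem_Icc hψ μ X t).2.trans hu1))
  simp [this]

theorem integrableOn_volume_superlevel (G : ℝ → ℝ) (a b : ℝ) :
    IntegrableOn (fun u => (volume.restrict (Ioc a b)).real {t | u < G t}) (Ioo 0 1) := by
  have hanti : Antitone fun u => (volume.restrict (Ioc a b)).real {t | u < G t} :=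
    fun u v huv => measureReal_mono fun t ht => lt_of_le_of_lt huv ht
  exact (hanti.antitoneOn _ |>.integrableOn_isCompact (isCompact_Icc (a := (0 : ℝ)) (b := 1))).mono_set
    Ioo_subset_Icc_self

include hψ in
/-- Comonotonic additivity. -/
theorem rankIntegral_add {X Y : S → ℝ} (hX : Bdd X) (hY : Bdd Y) (hXY : ComonotonicOn X Y) :
    rankIntegral ψ μ (fun s => X s + Y s) = rankIntegral ψ μ X + rankIntegral ψ μ Y := by
  obtain ⟨a, b, hab, hXI⟩ := hX.exists_Icc
  obtain ⟨a', b', hab', hYI⟩ := hY.exists_Icc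
  have hZI : ∀ s, X s + Y s ∈ Icc (a + a') (b + b') := fun s =>
    ⟨add_le_add (hXI s).1 (hYI s).1, add_le_add (hXI s).2 (hYI s).2⟩
  rw [rankIntegral_eq hψ μ hab.le hXI, rankIntegral_eq hψ μ hab'.le hYI,
    rankIntegral_eq hψ μ (add_le_add hab.le hab'.le) hZI, integral_distTail_eq hψ μ hab.le,
    integral_distTail_eq hψ μ hab'.le, integral_distTail_eq hψ μ (add_le_add hab.le hab'.le)]
  -- It remains to see that quantiles of comonotonic variables add at every level.
  suffices h : ∀ u ∈ Ioo (0 : ℝ) 1,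
      (volume.restrict (Ioc (a + a') (b + b'))).real
        {t | u < distTail ψ μ (fun s => X s + Y s) t} =
      (volume.restrict (Ioc a b)).real {t | u < distTail ψ μ X t} +
        (volume.restrict (Ioc a' b')).real {t | u < distTail ψ μ Y t} by
    rw [setIntegral_congr_fun measurableSet_Ioo h,
      integral_add (integrableOn_volume_superlevel _ a b)
        (integrableOn_volume_superlevel _ a' b')]
    ring
  intro u hu
  obtain ⟨q, hq, hq1, hq2⟩ := exists_quantile hψ μ hXI hu.1 hu.2
  obtain ⟨q', hq', hq1', hq2'⟩ := exists_quantile hψ μ hYI hu.1 hu.2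
  rw [volume_superlevel hq hq1 hq2, volume_superlevel hq' hq1' hq2',
    volume_superlevel (q := q + q') ⟨add_le_add hq.1 hq'.1, add_le_add hq.2 hq'.2⟩ ?_ ?_]
  · ring
  · intro t ht
    -- The shortfall of `t` is split equally. If `X + Y ≤ t`, one of the two variables is below its
    -- lowered quantile, so the point lies in the larger of the two nested sublevel sets.
    have h1 := hq1 (q - (q + q' - t) / 2) (by linarith)
    have h2 := hq1' (q' - (q + q' - t) / 2) (by linarith)
    rcases hXY.nested (q - (q + q' - t) / 2) (q' - (q + q' - t) / 2) with h | h
    · refine lt_of_lt_of_le h2 (distTail_le_of_le hψ μ (measureReal_mono fun s hs => ?_))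
      by_contra hcon
      have hY' : ¬ Y s ≤ q' - (q + q' - t) / 2 := hcon
      have hX' : ¬ X s ≤ q - (q + q' - t) / 2 := fun hx => hY' (h hx)
      have hs' : X s + Y s ≤ t := hs
      linarith
    · refine lt_of_lt_of_le h1 (distTail_le_of_le hψ μ (measureReal_mono fun s hs => ?_))
      by_contra hcon
      have hX' : ¬ X s ≤ q - (q + q' - t) / 2 := hcon
      have hY' : ¬ Y s ≤ q' - (q + q' - t) / 2 := fun hx => hX' (h hx)
      have hs' : X s + Y s ≤ t := hs
      linarith
  · intro t ht
    -- Dually, the smaller of the two nested sets is contained in the sublevel set of the sum.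
    have h1 := hq2 (q + (t - (q + q')) / 2) (by linarith)
    have h2 := hq2' (q' + (t - (q + q')) / 2) (by linarith)
    rcases hXY.nested (q + (t - (q + q')) / 2) (q' + (t - (q + q')) / 2) with h | h
    · refine le_trans (distTail_le_of_le hψ μ (measureReal_mono fun s hs => ?_)) h1
      have hs1 : X s ≤ q + (t - (q + q')) / 2 := hs
      have hs2 : Y s ≤ q' + (t - (q + q')) / 2 := h hs
      show X s + Y s ≤ t
      linarith
    · refine le_trans (distTail_le_of_le hψ μ (measureReal_mono fun s hs => ?_)) h2
      have hs1 : X s ≤ q + (t - (q + q')) / 2 := h hs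
      have hs2 : Y s ≤ q' + (t - (q + q')) / 2 := hs
      show X s + Y s ≤ t
      linarith

include hψ in
theorem rankIntegral_add_const {X : S → ℝ} (hX : Bdd X) (c : ℝ) :
    rankIntegral ψ μ (fun s => X s + c) = rankIntegral ψ μ X + c := by
  rw [rankIntegral_add hψ μ hX (Bdd.const c) fun s s' => by simp, rankIntegral_const hψ]

include hψ in
-- A countable exceptional set is null for the integral over amounts, and the tails are bounded by
-- `1`, so dominated convergence applies.
theorem rankIntegral_tendsto {X : ℕ → S → ℝ} {Y : S → ℝ} {a b : ℝ} (hab : a ≤ b)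
    (hX : ∀ n s, X n s ∈ Icc a b) (hY : ∀ s, Y s ∈ Icc a b) {N : Set ℝ} (hN : N.Countable)
    (h : ∀ t ∉ N, Tendsto (fun n => μ.real {s | X n s ≤ t}) atTop (𝓝 (μ.real {s | Y s ≤ t}))) :
    Tendsto (fun n => rankIntegral ψ μ (X n)) atTop (𝓝 (rankIntegral ψ μ Y)) := by
  simp only [rankIntegral_eq hψ μ hab (hX _), rankIntegral_eq hψ μ hab hY]
  refine Tendsto.const_add a (intervalIntegral.tendsto_integral_filter_of_dominated_convergence
    (fun _ => (1 : ℝ)) (Eventually.of_forall fun n =>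
      (distTail_antitone hψ μ (X n)).measurable.aestronglyMeasurable)
    (Eventually.of_forall fun n => Eventually.of_forall fun t _ => ?_) (by simp) ?_)
  · rw [Real.norm_eq_abs, abs_le]
    have := distTail_mem_Icc hψ μ (X n) t
    exact ⟨by linarith [this.1], this.2⟩
  · have : ∀ᵐ t : ℝ, t ∉ N := hN.ae_notMem volume
    filter_upwards [this] with t ht _
    have h1 := (hψ.continuousOn _ (one_sub_real_mem_Icc μ {s | Y s ≤ t})).tendsto
    exact h1.comp (tendsto_nhdsWithin_iff.2 ⟨(h t ht).const_sub 1,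
      Eventually.of_forall fun n => one_sub_real_mem_Icc μ _⟩)

end Rank

theorem measurable_rankIntegral {W S : Type*} [MeasurableSpace W] [MeasurableSpace S]
    (P : Kernel W S) [IsMarkovKernel P] {ψ : ℝ → ℝ} (hψ : Distortion ψ) {X : W × S → ℝ}
    (hm : Measurable X) (hX : Bdd X) :
    Measurable fun w => rankIntegral ψ (P w) fun s => X (w, s) := by
  obtain ⟨a, b, hab, hI⟩ := hX.exists_Icc
  have h1 : ∀ w, rankIntegral ψ (P w) (fun s => X (w, s)) =
      a + ∫ t in Ioc a b, distTail ψ (P w) (fun s => X (w, s)) t := fun w => by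
    rw [rankIntegral_eq hψ (P w) hab.le fun s => hI (w, s), intervalIntegral.integral_of_le hab.le]
  simp only [h1]
  refine Measurable.const_add (StronglyMeasurable.measurable ?_) a
  refine StronglyMeasurable.integral_prod_right (f := fun w t => distTail ψ (P w)
    (fun s => X (w, s)) t) ?_
  have h2 : Measurable fun p : W × ℝ => (P.comap Prod.fst measurable_fst) p
      (Prod.mk p ⁻¹' {q : (W × ℝ) × S | X (q.1.1, q.2) ≤ q.1.2}) :=
    Kernel.measurable_kernel_prodMk_left (measurableSet_le (by fun_prop) (by fun_prop))
  -- `ψ` is controlled on `[0, 1]` only; composing with the projection makes it continuous on the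
  -- line without changing the values that occur.
  have h3 : Continuous fun p : ℝ => ψ (projIcc 0 1 zero_le_one p) :=
    hψ.continuousOn.comp_continuous (by fun_prop) fun p => (projIcc 0 1 zero_le_one p).2
  have h4 : Measurable fun p : W × ℝ => 1 - ((P.comap Prod.fst measurable_fst) p
      (Prod.mk p ⁻¹' {q : (W × ℝ) × S | X (q.1.1, q.2) ≤ q.1.2})).toReal :=
    measurable_const.sub h2.ennreal_toReal
  have h5 := (h3.measurable.comp h4).stronglyMeasurable
  convert h5 using 1
  funext p
  show distTail ψ (P p.1) (fun s => X (p.1, s)) p.2 =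
    ψ (projIcc 0 1 zero_le_one (1 - (P p.1).real {s | X (p.1, s) ≤ p.2}))
  rw [projIcc_of_mem _ (one_sub_real_mem_Icc (P p.1) {s | X (p.1, s) ≤ p.2})]
  rfl

/-! ### Conditional distributions -/

section Dist
variable {W S : Type*} [MeasurableSpace W] [MeasurableSpace S]

theorem finiteRV_subset_boundedRV : finiteRV W S ⊆ boundedRV W S := by
  rintro v ⟨hv, hf⟩
  obtain ⟨C, hC⟩ := (hf.image fun x => |x|).bddAbove
  exact ⟨hv, C, fun x => hC ⟨v x, ⟨x, rfl⟩, rfl⟩⟩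

theorem measurable_section {v : W × S → ℝ} (hv : Measurable v) (w : W) :
    Measurable fun s => v (w, s) := hv.comp measurable_prodMk_left

theorem comp_mem_boundedRV {v : W × S → ℝ} (hv : v ∈ boundedRV W S) {φ : ℝ → ℝ}
    (hφ : Continuous φ) : (fun x => φ (v x)) ∈ boundedRV W S :=
  ⟨hφ.measurable.comp hv.1, Bdd.comp_continuous hv.2 hφ⟩

theorem comp_mem_finiteRV {v : W × S → ℝ} (hv : v ∈ finiteRV W S) {φ : ℝ → ℝ}
    (hφ : Measurable φ) : (fun x => φ (v x)) ∈ finiteRV W S :=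
  ⟨hφ.comp hv.1, (hv.2.image φ).subset (by rintro _ ⟨x, rfl⟩; exact ⟨v x, ⟨x, rfl⟩, rfl⟩)⟩

theorem sure_mem_finiteRV (m : ℝ) : (sure m : W × S → ℝ) ∈ finiteRV W S :=
  ⟨measurable_const, (finite_singleton m).subset (by rintro _ ⟨x, rfl⟩; rfl)⟩

theorem riskless_mem_finiteRV {g : W → ℝ} (hg : Measurable g) (hb : (range g).Finite) :
    (riskless g : W × S → ℝ) ∈ finiteRV W S :=
  ⟨hg.comp measurable_fst, hb.subset (by rintro _ ⟨x, rfl⟩; exact ⟨x.1, rfl⟩)⟩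

theorem measurable_of_riskless [Nonempty S] {g : W → ℝ}
    (h : Measurable (riskless g : W × S → ℝ)) : Measurable g := by
  have s : S := Classical.arbitrary S
  exact h.comp (measurable_prodMk_right (y := s))

/-- Sublevel sets of a continuous strictly increasing function are trivial or half-lines. -/
theorem sublevel_trichotomy {φ : ℝ → ℝ} (hc : Continuous φ) (hm : StrictMono φ) (t : ℝ) :
    (∃ y, φ y = t ∧ ∀ x, φ x ≤ t ↔ x ≤ y) ∨ (∀ x, φ x ≤ t) ∨ ∀ x, t < φ x := by
  by_cases h1 : ∀ x, φ x ≤ t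
  · exact Or.inr (Or.inl h1)
  by_cases h2 : ∀ x, t < φ x
  · exact Or.inr (Or.inr h2)
  push Not at h1 h2
  obtain ⟨x, hx⟩ := h1
  obtain ⟨z, hz⟩ := h2
  obtain ⟨y, hy⟩ := mem_range_of_exists_le_of_exists_ge hc ⟨z, hz⟩ ⟨x, hx.le⟩
  exact Or.inl ⟨y, hy, fun x => by rw [← hy, hm.le_iff_le]⟩

/-- The range of `φ` may be bounded, so a level `t` need not be a utility; the trichotomy of
sublevel sets covers the levels outside. -/
theorem real_comp_le_of_cdf_le {S' : Type*} [MeasurableSpace S'] {μ : Measure S} {μ' : Measure S'}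
    [IsProbabilityMeasure μ] [IsProbabilityMeasure μ'] {X : S → ℝ} {Y : S' → ℝ} {φ : ℝ → ℝ}
    (hc : Continuous φ) (hm : StrictMono φ)
    (h : ∀ t, μ.real {s | X s ≤ t} ≤ μ'.real {s | Y s ≤ t}) (t : ℝ) :
    μ.real {s | φ (X s) ≤ t} ≤ μ'.real {s | φ (Y s) ≤ t} := by
  rcases sublevel_trichotomy hc hm t with ⟨y, -, hy⟩ | h1 | h1
  · simpa only [hy] using h y
  · simp [h1]
  · simp [fun x => not_le.2 (h1 x)]

variable (P : Kernel W S) [IsMarkovKernel P]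

/-- The rank-dependent utility of the lottery `v^w`. -/
def lotteryUtility (φ ψ : ℝ → ℝ) (v : W × S → ℝ) (w : W) : ℝ :=
  rankIntegral ψ (P w) fun s => φ (v (w, s))

variable {P} {φ ψ : ℝ → ℝ} (hc : Continuous φ) (hm : StrictMono φ) (hψ : Distortion ψ)

theorem bdd_section {v : W × S → ℝ} (hv : v ∈ boundedRV W S) (w : W) :
    Bdd fun s => v (w, s) := hv.2.imp fun _ h s => h (w, s)

include hc hm hψ

theorem lotteryUtility_mono_dist {v u : W × S → ℝ} (hv : v ∈ boundedRV W S)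
    (hu : u ∈ boundedRV W S) {w w' : W} (h : ∀ t, condCDF P v w t ≤ condCDF P u w' t) :
    lotteryUtility P φ ψ u w' ≤ lotteryUtility P φ ψ v w :=
  rankIntegral_mono_dist hψ _ _ (bdd_section (comp_mem_boundedRV hv hc) w)
    (bdd_section (comp_mem_boundedRV hu hc) w') (real_comp_le_of_cdf_le hc hm h)

theorem lotteryUtility_strict_mono_dist {v u : W × S → ℝ} (hv : v ∈ boundedRV W S)
    (hu : u ∈ boundedRV W S) {w w' : W} (h : ∀ t, condCDF P v w t ≤ condCDF P u w' t) {t₀ : ℝ}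
    (h₀ : condCDF P v w t₀ < condCDF P u w' t₀) :
    lotteryUtility P φ ψ u w' < lotteryUtility P φ ψ v w :=
  rankIntegral_strict_mono_dist hψ _ _
    (measurable_section (comp_mem_boundedRV hv hc).1 w) (bdd_section (comp_mem_boundedRV hv hc) w)
    (bdd_section (comp_mem_boundedRV hu hc) w') (real_comp_le_of_cdf_le hc hm h)
    (t₀ := φ t₀) (by simpa only [hm.le_iff_le, condCDF] using h₀)

theorem lotteryUtility_congr_dist {v u : W × S → ℝ} (hv : v ∈ boundedRV W S)
    (hu : u ∈ boundedRV W S) {w w' : W} (h : ∀ t, condCDF P v w t = condCDF P u w' t) :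
    lotteryUtility P φ ψ v w = lotteryUtility P φ ψ u w' :=
  le_antisymm (lotteryUtility_mono_dist hc hm hψ hu hv fun t => (h t).ge)
    (lotteryUtility_mono_dist hc hm hψ hv hu fun t => (h t).le)

theorem lotteryUtility_mono {v u : W × S → ℝ} (hv : v ∈ boundedRV W S)
    (hu : u ∈ boundedRV W S) (w : W) (h : ∀ x, v x ≤ u x) :
    lotteryUtility P φ ψ v w ≤ lotteryUtility P φ ψ u w :=
  lotteryUtility_mono_dist hc hm hψ hu hv fun _ =>
    measureReal_mono fun _ hs => (h _).trans hs

omit hm hc in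
theorem lotteryUtility_mem_Icc {v : W × S → ℝ} {a b : ℝ} (hab : a ≤ b)
    (h : ∀ x, φ (v x) ∈ Icc a b) (w : W) : lotteryUtility P φ ψ v w ∈ Icc a b :=
  rankIntegral_mem_Icc hψ _ hab fun s => h (w, s)

omit hm in
theorem measurable_lotteryUtility {v : W × S → ℝ} (hv : v ∈ boundedRV W S) :
    Measurable (lotteryUtility P φ ψ v) :=
  measurable_rankIntegral P hψ (X := fun x => φ (v x)) (comp_mem_boundedRV hv hc).1
    (comp_mem_boundedRV hv hc).2

omit hm in
theorem bdd_lotteryUtility {v : W × S → ℝ} (hv : v ∈ boundedRV W S) :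
    Bdd (lotteryUtility P φ ψ v) := by
  have hb : Bdd fun x => φ (v x) := (comp_mem_boundedRV hv hc).2
  obtain ⟨a, b, hab, h⟩ := hb.exists_Icc
  have h2 : ∀ w, lotteryUtility P φ ψ v w ∈ Icc a b := fun w =>
    rankIntegral_mem_Icc hψ _ hab.le fun s => h (w, s)
  exact Bdd.of_mem_Icc h2

omit hc hm in
theorem lotteryUtility_riskless (g : W → ℝ) (w : W) :
    lotteryUtility P φ ψ (riskless g) w = φ (g w) := rankIntegral_const hψ (P w) (φ (g w))

omit hc hm in
theorem lotteryUtility_sure (m : ℝ) (w : W) :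
    lotteryUtility P φ ψ (sure m) w = φ m := rankIntegral_const hψ (P w) (φ m)

theorem lotteryUtility_tendsto {vs : ℕ → W × S → ℝ} {v : W × S → ℝ} (hv : v ∈ boundedRV W S)
    (hvs : UniformlyBounded vs) (hconv : ConvInDist P vs v) (w : W) :
    Tendsto (fun n => lotteryUtility P φ ψ (vs n) w) atTop (𝓝 (lotteryUtility P φ ψ v w)) := by
  obtain ⟨C, hC⟩ := hvs
  obtain ⟨D, hD⟩ := hv.2
  have hbd : ∀ {y : ℝ}, |y| ≤ max C D → φ y ∈ Icc (φ (-(max C D))) (φ (max C D)) := fun hy =>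
    ⟨hm.monotone (abs_le.1 hy).1, hm.monotone (abs_le.1 hy).2⟩
  have hle : φ (-(max C D)) ≤ φ (max C D) := by
    obtain ⟨s⟩ := nonempty_of_isProbabilityMeasure (P w)
    have := (abs_nonneg _).trans ((hD (w, s)).trans (le_max_right C D))
    exact hm.monotone (by linarith)
  have hmono : Monotone (condCDF P v w) := fun _ _ h =>
    measureReal_mono fun _ hs => le_trans (mem_ofPred.1 hs) h
  -- Convergence is known only at continuity points of the limit distribution function; the
  -- utilities of its countably many jumps form the exceptional set.
  refine rankIntegral_tendsto hψ _ hle (fun n s => hbd ((hC n _).trans (le_max_left _ _)))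
    (fun s => hbd ((hD _).trans (le_max_right _ _)))
    (N := φ '' {x | ¬ ContinuousAt (condCDF P v w) x})
    (hmono.countable_not_continuousAt.image φ) fun t ht => ?_
  rcases sublevel_trichotomy hc hm t with ⟨y, hy, hy'⟩ | h1 | h1
  · simp only [hy']
    refine hconv w y ?_
    by_contra hcon
    exact ht ⟨y, hcon, hy⟩
  · simp [h1]
  · simp [fun x => not_le.2 (h1 x)]

end Dist

/-! ### Copies of lotteries -/

section Copies
variable {W S : Type*} [MeasurableSpace W] [MeasurableSpace S] {P : Kernel W S} [IsMarkovKernel P]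

theorem nonempty_state [Nonempty W] (P : Kernel W S) [IsMarkovKernel P] : Nonempty S :=
  nonempty_of_isProbabilityMeasure (P (Classical.arbitrary W))

/-- `A` has to be an initial segment only inside `(0, 1)`, the rest being null. The slack is needed
for quantile functions, which are meaningless elsewhere. -/
theorem real_uniform_preimage {U : W × S → ℝ} (hU : Measurable U) {w : W}
    (h : (P w).map (fun s => U (w, s)) = (volume : Measure ℝ).restrict (Icc 0 1)) {A : Set ℝ}
    (hA : MeasurableSet A) {c : ℝ} (hc : c ∈ Icc (0 : ℝ) 1)
    (hAc : ∀ p ∈ Ioo (0 : ℝ) 1, p ∈ A ↔ p ≤ c) : (P w).real {s | U (w, s) ∈ A} = c := by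
  have h1 : (P w) {s | U (w, s) ∈ A} = ((volume : Measure ℝ).restrict (Icc 0 1)) A := by
    rw [← h, Measure.map_apply (measurable_section hU w) hA]; rfl
  have h2 : ((volume : Measure ℝ).restrict (Icc 0 1)) A = ENNReal.ofReal c := by
    rw [← Measure.restrict_congr_set Ioo_ae_eq_Icc, Measure.restrict_apply hA]
    refine le_antisymm ((measure_mono (t := Ioc 0 c) fun p hp => ?_).trans_eq ?_)
      (Eq.trans_le (b := volume (Ioo 0 c)) ?_ (measure_mono fun p hp => ?_))
    · exact ⟨hp.2.1, (hAc p hp.2).1 hp.1⟩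
    · simp
    · simp
    · have hp1 : p ∈ Ioo (0 : ℝ) 1 := ⟨hp.1, hp.2.trans_le hc.2⟩
      exact ⟨(hAc p hp1).2 hp.2.le, hp1⟩
  rw [measureReal_def, h1, h2, ENNReal.toReal_ofReal hc.1]

/-- Inverse transform: the quantile function of `v^w`, composed with the uniform variable, has the
law of `v^w` in every state of the world. -/
theorem exists_copy (hP : HasUniform P) {v : W × S → ℝ} (hv : v ∈ boundedRV W S) (w : W) :
    ∃ v₀ ∈ boundedRV W S, (∀ w' t, condCDF P v₀ w' t = condCDF P v w t) ∧
      (v ∈ finiteRV W S → v₀ ∈ finiteRV W S) := by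
  obtain ⟨U, hU, hUw⟩ := hP
  obtain ⟨s₀⟩ := nonempty_of_isProbabilityMeasure (P w)
  set F := condCDF P v w with hF
  have hmono : Monotone F := fun _ _ h =>
    measureReal_mono fun _ hs => le_trans (mem_ofPred.1 hs) h
  have hright : ∀ t, Tendsto F (𝓝[>] t) (𝓝 (F t)) :=
    tendsto_real_setOf_le (P w) (measurable_section hv.1 w)
  obtain ⟨a, b, hab, hI⟩ := Bdd.exists_Icc hv.2
  have hF01 : ∀ t, F t ∈ Icc (0 : ℝ) 1 := fun t => ⟨measureReal_nonneg, measureReal_le_one⟩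
  have hFb : F b = 1 := by
    have : {s | v (w, s) ≤ b} = univ := eq_univ_of_forall fun s => (hI (w, s)).2
    simp [hF, condCDF, this]
  have hFa : ∀ t < a, F t = 0 := fun t ht => by
    have : {s | v (w, s) ≤ t} = ∅ := eq_empty_of_forall_notMem fun s hs =>
      absurd ((hI (w, s)).1.trans hs) (not_le.2 ht)
    simp [hF, condCDF, this]
  classical
  -- Outside `(0, 1)` a value taken by `v` is used, so that the copy has no more values than `v`
  -- when `v` is finite-valued.
  let h : ℝ → ℝ := fun p => if p ∈ Ioo (0 : ℝ) 1 then sInf {t | p ≤ F t} else v (w, s₀)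
  have hbdd : ∀ p, 0 < p → BddBelow {t | p ≤ F t} := fun p hp => ⟨a, fun t ht => by
    by_contra hcon
    have : p ≤ F t := ht
    rw [hFa t (not_le.1 hcon)] at this
    linarith⟩
  have hne : ∀ p ≤ 1, {t | p ≤ F t}.Nonempty := fun p hp => ⟨b, by simpa [hFb] using hp⟩
  have hmem : ∀ p ∈ Ioo (0 : ℝ) 1, p ≤ F (h p) := fun p hp => by
    simp only [h, if_pos hp]
    refine ge_of_tendsto (hright _) ?_
    filter_upwards [self_mem_nhdsWithin] with r hr
    obtain ⟨t, ht, htr⟩ := exists_lt_of_csInf_lt (hne p hp.2.le) hr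
    exact le_trans ht (hmono htr.le)
  have hgal : ∀ p ∈ Ioo (0 : ℝ) 1, ∀ t, h p ≤ t ↔ p ≤ F t := fun p hp t =>
    ⟨fun ht => (hmem p hp).trans (hmono ht), fun ht => by
      simp only [h, if_pos hp]
      exact csInf_le (hbdd p hp.1) ht⟩
  have hset : ∀ t, {p | h p ≤ t} =
      (Ioo 0 1 ∩ Iic (F t)) ∪ ((Ioo 0 1)ᶜ ∩ {_p : ℝ | v (w, s₀) ≤ t}) := by
    intro t
    ext p
    by_cases hp : p ∈ Ioo (0 : ℝ) 1
    · simp only [mem_ofPred_eq, hgal p hp t, mem_union, mem_inter_iff, hp, mem_compl_iff,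
        not_true, true_and, false_and, or_false, mem_Iic]
    · simp only [mem_ofPred_eq, mem_union, mem_inter_iff, hp, mem_compl_iff,
        not_false_eq_true, true_and, false_and, false_or, h, if_false]
  have hmeas : Measurable h := by
    refine measurable_of_Iic fun t => ?_
    change MeasurableSet {p | h p ≤ t}
    rw [hset]
    exact (measurableSet_Ioo.inter measurableSet_Iic).union
      (measurableSet_Ioo.compl.inter (MeasurableSet.const _))
  have hhI : ∀ p, h p ∈ Icc a b := fun p => by
    by_cases hp : p ∈ Ioo (0 : ℝ) 1
    · refine ⟨?_, (hgal p hp b).2 (by rw [hFb]; exact hp.2.le)⟩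
      by_contra hcon
      have := hmem p hp
      rw [hFa _ (not_le.1 hcon)] at this
      exact absurd hp.1 (not_lt.2 this)
    · simp only [h, if_neg hp]
      exact hI _
  refine ⟨fun x => h (U x), ⟨hmeas.comp hU, Bdd.of_mem_Icc fun x => hhI (U x)⟩, fun w' t => ?_,
    fun hfin => ⟨hmeas.comp hU, hfin.2.subset ?_⟩⟩
  · exact real_uniform_preimage hU (hUw w') (A := {p | h p ≤ t})
      (hmeas measurableSet_Iic) (hF01 t) fun p hp => hgal p hp t
  · rintro _ ⟨x, rfl⟩
    by_cases hp : U x ∈ Ioo (0 : ℝ) 1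
    -- If the quantile were not a value of `v`, the distribution function would be constant just to
    -- its left, and a smaller amount would already reach the level `U x`.
    · by_contra hcon
      have hcl : IsClosed (range v) := hfin.2.isClosed
      obtain ⟨ε, hε, hball⟩ := Metric.isOpen_iff.1 hcl.isOpen_compl _ hcon
      have h1 : F (h (U x) - ε / 2) = F (h (U x)) := by
        simp only [hF, condCDF]
        congr 1
        ext s
        refine ⟨fun hs => le_trans (mem_ofPred.1 hs) (by linarith), fun hs => ?_⟩
        by_contra hlt
        refine (fun hx : v (w, s) ∈ Metric.ball (h (U x)) ε => hball hx ⟨_, rfl⟩) ?_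
        have hs' : v (w, s) ≤ h (U x) := hs
        have hlt' : h (U x) - ε / 2 < v (w, s) := not_le.1 hlt
        rw [Metric.mem_ball, Real.dist_eq, abs_lt]
        constructor <;> linarith
      have h2 := (hgal _ hp (h (U x) - ε / 2)).2 (by rw [h1]; exact hmem _ hp)
      linarith
    · simp only [h, if_neg hp]
      exact ⟨_, rfl⟩

end Copies

/-! ### Bets on unambiguous events -/

section Bets
variable {W S : Type*} [MeasurableSpace W] [MeasurableSpace S]

/-- `B` is an event with conditional probability `p` in every state of the world. -/
def HasProb (P : Kernel W S) (B : Set (W × S)) (p : ℝ) : Prop :=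
  MeasurableSet B ∧ ∀ w, (P w).real {s | (w, s) ∈ B} = p

variable {P : Kernel W S} [IsMarkovKernel P]

theorem UnambiguousEvent.exists_hasProb [Nonempty W] {B : Set (W × S)}
    (h : UnambiguousEvent P B) : ∃ p, HasProb P B p :=
  ⟨(P (Classical.arbitrary W)).real {s | (Classical.arbitrary W, s) ∈ B}, h.1, fun w => by
    rw [measureReal_def, measureReal_def, h.2 w]⟩

theorem HasProb.unambiguousEvent {B : Set (W × S)} {p : ℝ} (h : HasProb P B p) :
    UnambiguousEvent P B :=
  ⟨h.1, fun w₁ w₂ => by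
    rw [← ENNReal.toReal_eq_toReal_iff' (measure_ne_top _ _) (measure_ne_top _ _)]
    exact (h.2 w₁).trans (h.2 w₂).symm⟩

theorem HasProb.mem_Icc [Nonempty W] {B : Set (W × S)} {p : ℝ} (h : HasProb P B p) :
    p ∈ Icc (0 : ℝ) 1 := by
  rw [← h.2 (Classical.arbitrary W)]
  exact ⟨measureReal_nonneg, measureReal_le_one⟩

theorem measurableSet_eventSection {B : Set (W × S)} (h : MeasurableSet B) (w : W) :
    MeasurableSet {s | (w, s) ∈ B} := measurable_prodMk_left h

theorem HasProb.compl {B : Set (W × S)} {p : ℝ} (h : HasProb P B p) : HasProb P Bᶜ (1 - p) :=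
  ⟨h.1.compl, fun w => by
    rw [← h.2 w, ← probReal_compl_eq_one_sub (measurableSet_eventSection h.1 w)]; rfl⟩

theorem exists_event (hP : HasUniform P) : ∃ E : ℝ → Set (W × S), ∀ p ∈ Icc (0 : ℝ) 1,
    HasProb P (E p) p := by
  obtain ⟨U, hU, hUw⟩ := hP
  exact ⟨fun p => {x | U x ≤ p}, fun p hp => ⟨measurableSet_le hU measurable_const, fun w =>
    real_uniform_preimage hU (hUw w) measurableSet_Iic hp fun _ _ => Iff.rfl⟩⟩

omit [MeasurableSpace W] [MeasurableSpace S] in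
theorem bet_of_mem {t x : ℝ} {B : Set (W × S)} {y : W × S} (h : y ∈ B) : bet t B x y = t :=
  if_pos h

omit [MeasurableSpace W] [MeasurableSpace S] in
theorem bet_of_notMem {t x : ℝ} {B : Set (W × S)} {y : W × S} (h : y ∉ B) : bet t B x y = x :=
  if_neg h

omit [MeasurableSpace W] [MeasurableSpace S] in
theorem bet_compl (t x : ℝ) (B : Set (W × S)) : bet t Bᶜ x = bet x B t := by
  funext y
  by_cases h : y ∈ B
  · rw [bet_of_mem h, bet_of_notMem (not_not.2 h)]
  · rw [bet_of_notMem h, bet_of_mem h]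

omit [MeasurableSpace W] [MeasurableSpace S] in
theorem bet_self (t : ℝ) (B : Set (W × S)) : bet t B t = sure t := by
  funext y
  by_cases h : y ∈ B
  · rw [bet_of_mem h]; rfl
  · rw [bet_of_notMem h]; rfl

theorem bet_mem_finiteRV {B : Set (W × S)} (hB : MeasurableSet B) (t x : ℝ) :
    bet t B x ∈ finiteRV W S := by
  classical
  refine ⟨Measurable.ite hB measurable_const measurable_const, (toFinite {t, x}).subset ?_⟩
  rintro _ ⟨y, rfl⟩
  by_cases h : y ∈ B
  · rw [bet_of_mem h]; exact mem_insert _ _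
  · rw [bet_of_notMem h]; exact mem_insert_of_mem _ rfl

theorem condCDF_bet {B : Set (W × S)} {p : ℝ} (h : HasProb P B p) (t x r : ℝ) (w : W) :
    condCDF P (bet t B x) w r = (if t ≤ r then p else 0) + if x ≤ r then 1 - p else 0 := by
  have h0 := h.2 w
  have h1 : (P w).real {s | (w, s) ∈ Bᶜ} = 1 - p := h.compl.2 w
  have hset : {s | bet t B x (w, s) ≤ r} =
      {s | (w, s) ∈ B ∧ t ≤ r} ∪ {s | (w, s) ∈ Bᶜ ∧ x ≤ r} := by
    ext s
    by_cases hs : (w, s) ∈ B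
    · simp [bet_of_mem hs, hs]
    · simp [bet_of_notMem hs, hs]
  rw [condCDF, hset]
  by_cases ht : t ≤ r <;> by_cases hx : x ≤ r <;> simp only [ht, hx, and_true, and_false, if_true,
    if_false, ofPred_false, empty_union, union_empty, h0, h1, add_zero, zero_add,
    measureReal_empty]
  have : {s | (w, s) ∈ B} ∪ {s | (w, s) ∈ Bᶜ} = univ := union_compl_self {s | (w, s) ∈ B}
  rw [this]
  simp

theorem unambiguous_bet {B : Set (W × S)} {p : ℝ} (h : HasProb P B p) (t x : ℝ) :
    Unambiguous P (bet t B x) := fun w₁ w₂ r => by rw [condCDF_bet h, condCDF_bet h]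

theorem unambiguous_sure (m : ℝ) : Unambiguous P (sure m) := fun w₁ w₂ r => by
  simp only [condCDF, sure]
  by_cases h : m ≤ r <;> simp [h]

/-- The rank-dependent value of a bet with utilities `s` (with probability `p`) and `y`. -/
def binVal (ψ : ℝ → ℝ) (p s y : ℝ) : ℝ :=
  if y ≤ s then ψ p * s + (1 - ψ p) * y else (1 - ψ (1 - p)) * s + ψ (1 - p) * y

theorem binVal_of_le {ψ : ℝ → ℝ} {p s y : ℝ} (h : y ≤ s) :
    binVal ψ p s y = ψ p * s + (1 - ψ p) * y := if_pos h

theorem binVal_of_ge {ψ : ℝ → ℝ} {p s y : ℝ} (h : s ≤ y) :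
    binVal ψ p s y = (1 - ψ (1 - p)) * s + ψ (1 - p) * y := by
  rcases h.eq_or_lt with rfl | h
  · rw [binVal_of_le le_rfl]; ring
  · exact if_neg (not_le.2 h)

theorem binVal_self {ψ : ℝ → ℝ} (p s : ℝ) : binVal ψ p s s = s := by
  rw [binVal_of_le le_rfl]; ring

theorem binVal_compl {ψ : ℝ → ℝ} (p s y : ℝ) : binVal ψ (1 - p) y s = binVal ψ p s y := by
  rcases le_total y s with h | h
  · rw [binVal_of_le h, binVal_of_ge h, sub_sub_cancel]; ring
  · rw [binVal_of_le h, binVal_of_ge h]; ring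

theorem lotteryUtility_bet {φ ψ : ℝ → ℝ} (hm : Monotone φ) (hψ : Distortion ψ) {B : Set (W × S)}
    {p : ℝ} (h : HasProb P B p) (t x : ℝ) (w : W) :
    lotteryUtility P φ ψ (bet t B x) w = binVal ψ p (φ t) (φ x) := by
  have key : ∀ {B : Set (W × S)} {p : ℝ}, HasProb P B p → ∀ t x : ℝ, x ≤ t →
      lotteryUtility P φ ψ (bet t B x) w = binVal ψ p (φ t) (φ x) := by
    intro B p h t x hxt
    rw [binVal_of_le (hm hxt), ← h.2 w]
    exact rankIntegral_indicator (P w) hψ (measurableSet_eventSection h.1 w) (hm hxt)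
      (fun s hs => congrArg φ (bet_of_mem (B := B) (mem_ofPred.1 hs)))
      (fun s hs => congrArg φ (bet_of_notMem (B := B) hs))
  rcases le_total x t with hxt | hxt
  · exact key h t x hxt
  · rw [← bet_compl, key h.compl x t hxt, binVal_compl]

end Bets

/-! ### Preferences with a rank-dependent representation of bets -/

section BinRep
variable {W S : Type*} [MeasurableSpace W] [MeasurableSpace S]

/-- `R` ranks bets on unambiguous events by rank-dependent utility. -/
def BinRep (P : Kernel W S) (R : (W × S → ℝ) → (W × S → ℝ) → Prop) (φ ψ : ℝ → ℝ) : Prop :=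
  ∀ B B' p p', HasProb P B p → HasProb P B' p' → ∀ t x t' x',
    R (bet t B x) (bet t' B' x') ↔ binVal ψ p' (φ t') (φ x') ≤ binVal ψ p (φ t) (φ x)

theorem binVal_mem_Icc {ψ : ℝ → ℝ} (hψ : Distortion ψ) {p : ℝ} (hp : p ∈ Icc (0 : ℝ) 1) {s y : ℝ}
    (h : y ≤ s) : binVal ψ p s y ∈ Icc y s := by
  rw [binVal_of_le h]
  have := hψ.mem_Icc hp
  constructor <;> nlinarith [mul_nonneg this.1 (sub_nonneg.2 h),
    mul_nonneg (sub_nonneg.2 this.2) (sub_nonneg.2 h)]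

theorem hasProb_univ (P : Kernel W S) [IsMarkovKernel P] : HasProb P univ 1 :=
  ⟨MeasurableSet.univ, fun w => by simp⟩

variable [Nonempty W] {P : Kernel W S} [IsMarkovKernel P]
  {R : (W × S → ℝ) → (W × S → ℝ) → Prop} {φ ψ : ℝ → ℝ}
  (H : BinRep P R φ ψ) (hc : Continuous φ) (hm : StrictMono φ) (hψ : Distortion ψ)

theorem exists_utility_eq_binVal (hc : Continuous φ) (hm : StrictMono φ) (hψ : Distortion ψ)
    {p : ℝ} (hp : p ∈ Icc (0 : ℝ) 1) (t x : ℝ) : ∃ m, φ m = binVal ψ p (φ t) (φ x) := by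
  have key : ∀ {p : ℝ}, p ∈ Icc (0 : ℝ) 1 → ∀ {t x : ℝ}, x ≤ t →
      ∃ m, φ m = binVal ψ p (φ t) (φ x) := fun hp _ _ h => by
    have := binVal_mem_Icc hψ hp (hm.monotone h)
    exact mem_range_of_exists_le_of_exists_ge hc ⟨_, this.1⟩ ⟨_, this.2⟩
  rcases le_total x t with h | h
  · exact key hp h
  · have := key (p := 1 - p) ⟨by linarith [hp.2], by linarith [hp.1]⟩ h
    rwa [binVal_compl] at this

omit [Nonempty W] in
include H in
theorem BinRep.indiff_bet {B B' : Set (W × S)} {p p' : ℝ} (h : HasProb P B p)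
    (h' : HasProb P B' p') (t x t' x' : ℝ) : Indiff R (bet t B x) (bet t' B' x') ↔
      binVal ψ p (φ t) (φ x) = binVal ψ p' (φ t') (φ x') := by
  rw [Indiff, H _ _ _ _ h h', H _ _ _ _ h' h, le_antisymm_iff, and_comm]

omit [Nonempty W] in
include H in
theorem BinRep.sure_bet {B : Set (W × S)} {p : ℝ} (h : HasProb P B p) (m t x : ℝ) :
    R (sure m) (bet t B x) ↔ binVal ψ p (φ t) (φ x) ≤ φ m := by
  rw [← bet_self m univ, H _ _ _ _ (hasProb_univ P) h, binVal_self]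

omit [Nonempty W] in
include H in
theorem BinRep.bet_sure {B : Set (W × S)} {p : ℝ} (h : HasProb P B p) (m t x : ℝ) :
    R (bet t B x) (sure m) ↔ φ m ≤ binVal ψ p (φ t) (φ x) := by
  rw [← bet_self m univ, H _ _ _ _ h (hasProb_univ P), binVal_self]

omit [Nonempty W] in
include H in
theorem BinRep.isCE_bet {B : Set (W × S)} {p : ℝ} (h : HasProb P B p) (m t x : ℝ) :
    IsCE R (bet t B x) m ↔ φ m = binVal ψ p (φ t) (φ x) := by
  rw [IsCE, Indiff, H.sure_bet h, H.bet_sure h, le_antisymm_iff, and_comm]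

omit [Nonempty W] in
include H hm in
theorem BinRep.sure_sure (m t : ℝ) : R (sure m) (sure t) ↔ t ≤ m := by
  rw [← bet_self t univ, H.sure_bet (hasProb_univ P), binVal_self, hm.le_iff_le]

include H hm hψ in
-- A bet is strictly between its outcomes exactly when the decision weight `ψ p` is strictly between
-- `0` and `1`; strict monotonicity of `ψ` makes this a condition on `p`.
theorem BinRep.essential_iff {E : Set (W × S)} :
    Essential P R E ↔ ∃ p ∈ Ioo (0 : ℝ) 1, HasProb P E p := by
  constructor
  · rintro ⟨hE, t, x, hxt, h1, h2⟩
    obtain ⟨p, hp⟩ := hE.exists_hasProb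
    have h1 := h1.2
    have h2 := h2.2
    rw [H.bet_sure hp, not_le, binVal_of_le (hm hxt).le] at h1
    rw [H.sure_bet hp, not_le, binVal_of_le (hm hxt).le] at h2
    have hI := hp.mem_Icc
    refine ⟨p, ⟨hI.1.lt_of_ne ?_, hI.2.lt_of_ne ?_⟩, hp⟩
    · rintro rfl
      rw [hψ.zero] at h2
      linarith
    · rintro rfl
      rw [hψ.one] at h1
      linarith
  · rintro ⟨p, hp, hE⟩
    have hI := hψ.mem_Ioo hp
    have h01 := hm zero_lt_one
    refine ⟨hE.unambiguousEvent, 1, 0, zero_lt_one, ⟨?_, ?_⟩, ?_, ?_⟩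
    · rw [H.sure_bet hE, binVal_of_le h01.le]
      nlinarith [hI.1, hI.2]
    · rw [H.bet_sure hE, binVal_of_le h01.le]
      nlinarith [hI.1, hI.2]
    · rw [H.bet_sure hE, binVal_of_le h01.le]
      nlinarith [hI.1, hI.2]
    · rw [H.sure_bet hE, binVal_of_le h01.le]
      nlinarith [hI.1, hI.2]

omit [Nonempty W] in
include H hm hψ in
-- When the indifference is expanded, the difference of its sides is `ψ p * (1 - ψ p) * (φ t + φ x -
-- 2 * φ y)`, and the first two factors are positive. So the event and the distortion drop out.
theorem BinRep.orderedPrefAverage_utility {E : Set (W × S)} {p : ℝ} (hp : p ∈ Ioo (0 : ℝ) 1)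
    (hE : HasProb P E p) {t x y : ℝ} (h : OrderedPrefAverage R E t x y) :
    φ y = (φ t + φ x) / 2 := by
  obtain ⟨h1, h2, h3, a, b, c, d, ha, hb, hc, hd, h4, h5⟩ := h
  rw [H.sure_sure hm] at h1 h2 h3
  rw [H.isCE_bet hE] at ha hb hc hd
  rw [H.indiff_bet hE hE] at h4 h5
  have i1 := hm.monotone h2
  have i2 := hm.monotone h3
  have hI := hψ.mem_Ioo hp
  have hIc := Ioo_subset_Icc_self hp
  have j1 := (binVal_mem_Icc hψ hIc i1).1
  have j2 := (binVal_mem_Icc hψ hIc i2).2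
  rw [← h4, hc, hd, binVal_of_le (hm.monotone h1), binVal_of_le (j2.trans j1), binVal_of_le i1,
    binVal_of_le i2] at h5
  have h0 : 0 < ψ p * (1 - ψ p) := mul_pos hI.1 (by linarith [hI.2])
  have h6 : ψ p * (1 - ψ p) * (φ t + φ x - 2 * φ y) = 0 := by linear_combination h5
  rcases mul_eq_zero.1 h6 with h7 | h7 <;> linarith

omit [Nonempty W] in
include H hm hψ in
theorem BinRep.prefAverage_utility {E : Set (W × S)} {p : ℝ} (hp : p ∈ Ioo (0 : ℝ) 1)
    (hE : HasProb P E p) {t x y : ℝ} (h : PrefAverage R E t x y) :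
    φ y = (φ t + φ x) / 2 := by
  rcases h with h | h
  · exact H.orderedPrefAverage_utility hm hψ hp hE h
  · rw [H.orderedPrefAverage_utility hm hψ hp hE h]; ring

omit [Nonempty W] in
include H hc hm hψ in
theorem BinRep.prefAverage_of_utility {E : Set (W × S)} {p : ℝ} (hp : p ∈ Ioo (0 : ℝ) 1)
    (hE : HasProb P E p) {t x y : ℝ} (h : φ y = (φ t + φ x) / 2) : PrefAverage R E t x y := by
  have key : ∀ {t x : ℝ}, x ≤ t → φ y = (φ t + φ x) / 2 → OrderedPrefAverage R E t x y := by
    intro t x hxt h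
    have i0 := hm.monotone hxt
    have i1 : φ y ≤ φ t := by linarith
    have i2 : φ x ≤ φ y := by linarith
    have hIc := Ioo_subset_Icc_self hp
    obtain ⟨c, hcc⟩ := exists_utility_eq_binVal hc hm hψ hIc t y
    obtain ⟨d, hd⟩ := exists_utility_eq_binVal hc hm hψ hIc y x
    have j1 := (binVal_mem_Icc hψ hIc i1).1
    have j2 := (binVal_mem_Icc hψ hIc i2).2
    refine ⟨(H.sure_sure hm _ _).2 hxt, (H.sure_sure hm _ _).2 (hm.le_iff_le.1 i1),
      (H.sure_sure hm _ _).2 (hm.le_iff_le.1 i2), t, x, c, d, ?_, ?_, ?_, ?_, ?_, ?_⟩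
    · rw [H.isCE_bet hE, binVal_self]
    · rw [H.isCE_bet hE, binVal_self]
    · rw [H.isCE_bet hE, hcc]
    · rw [H.isCE_bet hE, hd]
    · rw [H.indiff_bet hE hE]
    · rw [H.indiff_bet hE hE, hcc, hd, binVal_of_le (j2.trans j1), binVal_of_le i0,
        binVal_of_le i1, binVal_of_le i2, h]
      ring
  rcases le_total x t with hxt | hxt
  · exact Or.inl (key hxt h)
  · exact Or.inr (key hxt (by rw [h]; ring))

include H hc hm hψ in
-- Induction on the generation of mixtures: averages of weights go with averages of utilities, and
-- limits are covered by continuity of `φ`.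
theorem BinRep.subjMix_utility {t x α z : ℝ} (h : SubjMix P R t x α z) :
    φ z = α * φ t + (1 - α) * φ x := by
  induction h with
  | one => ring
  | zero => ring
  | average _ _ hE hav ih1 ih2 =>
    obtain ⟨p, hp, hE⟩ := (H.essential_iff hm hψ).1 hE
    rw [H.prefAverage_utility hm hψ hp hE hav, ih1, ih2]
    ring
  | limit a y _ ha hy ih =>
    refine tendsto_nhds_unique ((hc.tendsto _).comp hy) ?_
    have h2 := (ha.mul_const (φ t)).add ((ha.const_sub 1).mul_const (φ x))
    exact h2.congr fun n => (ih n).symm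

include H hc hm hψ in
theorem BinRep.subjMix_half (hP : HasUniform P) {t x y : ℝ} (h : φ y = (φ t + φ x) / 2) :
    SubjMix P R t x (1 / 2) y := by
  obtain ⟨E, hE⟩ := exists_event hP
  have hp : (1 / 2 : ℝ) ∈ Ioo (0 : ℝ) 1 := by norm_num
  have hE := hE _ (Ioo_subset_Icc_self hp)
  have := SubjMix.average (P := P) (R := R) SubjMix.one SubjMix.zero
    ((H.essential_iff hm hψ).2 ⟨_, hp, hE⟩) (H.prefAverage_of_utility hc hm hψ hp hE h)
  convert this using 1
  norm_num

include H hc hm hψ in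
-- The sign of `x` decides whether `z` or `0` is the better outcome. In both cases a factor `ψ p *
-- (1 - ψ p)` cancels and `φ x` is left as the midpoint of `φ z` and `φ 0`.
theorem BinRep.prefDoubling_iff {E : Set (W × S)} {p : ℝ} (hp : p ∈ Ioo (0 : ℝ) 1)
    (hE : HasProb P E p) {x z : ℝ} :
    PrefDoubling R E x z ↔ φ z = 2 * φ x - φ 0 := by
  have hI := hψ.mem_Ioo hp
  have hIc := Ioo_subset_Icc_self hp
  have h0 : 0 < ψ p * (1 - ψ p) := mul_pos hI.1 (by linarith [hI.2])
  simp only [PrefDoubling, H.sure_sure hm, H.isCE_bet hE, H.indiff_bet hE hE]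
  constructor
  · rintro (⟨h1, h2, a, b, ha, hb, h3⟩ | ⟨h1, h2, a, b, ha, hb, h3⟩)
    · have i1 := hm.monotone h1
      have i2 := hm.monotone h2
      have j1 := (binVal_mem_Icc hψ hIc i2).1
      have j2 := (binVal_mem_Icc hψ hIc i1).2
      rw [ha, hb, binVal_of_le (i1.trans i2), binVal_of_le (j2.trans j1), binVal_of_le i1,
        binVal_of_le i2] at h3
      have h6 : ψ p * (1 - ψ p) * (φ z - 2 * φ x + φ 0) = 0 := by linear_combination h3
      rcases mul_eq_zero.1 h6 with h7 | h7 <;> linarith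
    · have i1 := hm.monotone h1.le
      have i2 := hm.monotone h2
      have j1 := (binVal_mem_Icc hψ hIc i1).1
      have j2 := (binVal_mem_Icc hψ hIc i2).2
      rw [ha, hb, binVal_of_le (i2.trans i1), binVal_of_le (j2.trans j1), binVal_of_le i1,
        binVal_of_le i2] at h3
      have h6 : ψ p * (1 - ψ p) * (φ z - 2 * φ x + φ 0) = 0 := by linear_combination h3
      rcases mul_eq_zero.1 h6 with h7 | h7 <;> linarith
  · intro h
    rcases le_or_gt 0 x with h1 | h1
    · have i1 := hm.monotone h1
      have i2 : φ x ≤ φ z := by linarith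
      obtain ⟨a, ha⟩ := exists_utility_eq_binVal hc hm hψ hIc z x
      obtain ⟨b, hb⟩ := exists_utility_eq_binVal hc hm hψ hIc x 0
      have j1 := (binVal_mem_Icc hψ hIc i2).1
      have j2 := (binVal_mem_Icc hψ hIc i1).2
      refine Or.inl ⟨h1, hm.le_iff_le.1 i2, a, b, ha, hb, ?_⟩
      rw [ha, hb, binVal_of_le (i1.trans i2), binVal_of_le (j2.trans j1), binVal_of_le i1,
        binVal_of_le i2, h]
      ring
    · have i1 := hm.monotone h1.le
      have i2 : φ z ≤ φ x := by linarith
      obtain ⟨a, ha⟩ := exists_utility_eq_binVal hc hm hψ hIc 0 x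
      obtain ⟨b, hb⟩ := exists_utility_eq_binVal hc hm hψ hIc x z
      have j1 := (binVal_mem_Icc hψ hIc i1).1
      have j2 := (binVal_mem_Icc hψ hIc i2).2
      refine Or.inr ⟨h1, hm.le_iff_le.1 i2, a, b, ha, hb, ?_⟩
      rw [ha, hb, binVal_of_le (i2.trans i1), binVal_of_le (j2.trans j1), binVal_of_le i1,
        binVal_of_le i2, h]
      ring

include H hc hm hψ in
-- Halving and doubling cancel, which leaves addition of utilities measured from `φ 0`.
theorem BinRep.subjSum_utility {t x z : ℝ} (h : SubjSum P R t x z) :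
    φ z = φ t + φ x - φ 0 := by
  obtain ⟨y, hy, E, hE, hd⟩ := h
  obtain ⟨p, hp, hE⟩ := (H.essential_iff hm hψ).1 hE
  rw [(H.prefDoubling_iff hc hm hψ hp hE).1 hd, H.subjMix_utility hc hm hψ hy]
  ring

include H hc hm hψ in
-- Existence of a subjective sum is only a question of the range of `φ`; the midpoint needed on the
-- way always exists.
theorem BinRep.subjSum_of_utility (hP : HasUniform P) {t x z : ℝ} (h : φ z = φ t + φ x - φ 0) :
    SubjSum P R t x z := by
  have hmid : ∃ y, φ y = (φ t + φ x) / 2 := by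
    rcases le_total (φ t) (φ x) with h1 | h1
    · exact mem_range_of_exists_le_of_exists_ge hc ⟨t, by linarith⟩ ⟨x, by linarith⟩
    · exact mem_range_of_exists_le_of_exists_ge hc ⟨x, by linarith⟩ ⟨t, by linarith⟩
  obtain ⟨y, hy⟩ := hmid
  obtain ⟨E, hE⟩ := exists_event hP
  have hp : (1 / 2 : ℝ) ∈ Ioo (0 : ℝ) 1 := by norm_num
  have hE := hE _ (Ioo_subset_Icc_self hp)
  exact ⟨y, H.subjMix_half hc hm hψ hP hy, _, (H.essential_iff hm hψ).2 ⟨_, hp, hE⟩,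
    (H.prefDoubling_iff hc hm hψ hp hE).2 (by rw [hy, h]; ring)⟩

end BinRep

/-! ### The representation implies the axioms -/

section Sufficiency
variable {W S : Type*} [MeasurableSpace W] [MeasurableSpace S] [Nonempty W] {P : Kernel W S}
  [IsMarkovKernel P] {D : Set (W × S → ℝ)} {R : (W × S → ℝ) → (W × S → ℝ) → Prop} {φ ψ : ℝ → ℝ}
  {c : FinAddProb W → ℝ≥0∞}

omit [Nonempty W] [IsMarkovKernel P] in
theorem Represents.distortion (h : Represents P D R φ ψ c) : Distortion ψ :=
  ⟨h.distortion_continuous, h.distortion_strictMono, h.distortion_zero, h.distortion_one⟩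

/-- The value functional of a representation. -/
structure IsValue (P : Kernel W S) (D : Set (W × S → ℝ))
    (R : (W × S → ℝ) → (W × S → ℝ) → Prop) (φ ψ : ℝ → ℝ) (c : FinAddProb W → ℝ≥0∞)
    (V : (W × S → ℝ) → ℝ) : Prop where
  isLeast : ∀ v ∈ D, IsLeast (range (penExpect c (lotteryUtility P φ ψ v))) (V v : EReal)
  rel_iff : ∀ v ∈ D, ∀ u ∈ D, (R v u ↔ V u ≤ V v)

omit [Nonempty W] [IsMarkovKernel P] in
theorem Represents.exists_isValue (h : Represents P D R φ ψ c) :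
    ∃ V, IsValue P D R φ ψ c V := by
  obtain ⟨V, h1, h2⟩ := h.represents
  exact ⟨V, h1, h2⟩

variable {V : (W × S → ℝ) → ℝ} (hV : IsValue P D R φ ψ c V) (hψ : Distortion ψ)
  (hc : Continuous φ) (hm : StrictMono φ) (hg : Grounded c)
  (hDf : finiteRV W S ⊆ D) (hDb : D ⊆ boundedRV W S)

include hV hψ hc hDb in
theorem IsValue.le_add {v u : W × S → ℝ} (hv : v ∈ D) (hu : u ∈ D) {k : ℝ}
    (h : ∀ w, lotteryUtility P φ ψ v w ≤ lotteryUtility P φ ψ u w + k) : V v ≤ V u + k :=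
  isLeast_penExpect_le (bdd_lotteryUtility hc hψ (hDb hv)) (bdd_lotteryUtility hc hψ (hDb hu))
    (hV.isLeast v hv) (hV.isLeast u hu) h

include hV hψ hc hDb in
theorem IsValue.mono {v u : W × S → ℝ} (hv : v ∈ D) (hu : u ∈ D)
    (h : ∀ w, lotteryUtility P φ ψ v w ≤ lotteryUtility P φ ψ u w) : V v ≤ V u := by
  have := hV.le_add hψ hc hDb hv hu (k := 0) (by simpa using h)
  rwa [add_zero] at this

omit [IsMarkovKernel P] in
include hV hg in
theorem IsValue.eq_of_const {v : W × S → ℝ} (hv : v ∈ D) {k : ℝ}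
    (h : ∀ w, lotteryUtility P φ ψ v w = k) : V v = k := by
  have h1 := hV.isLeast v hv
  have h2 : lotteryUtility P φ ψ v = fun _ => k := funext h
  rw [h2] at h1
  exact EReal.coe_eq_coe_iff.1 (h1.unique (isLeast_penExpect_const hg k))

include hV hψ hg hDf in
theorem IsValue.sure (m : ℝ) : V (sure m) = φ m :=
  hV.eq_of_const hg (hDf (sure_mem_finiteRV m)) (lotteryUtility_sure hψ m)

include hV hψ hm hc hg hDb in
theorem IsValue.eq_of_unambiguous {v : W × S → ℝ} (hv : v ∈ D) (hu : Unambiguous P v) (w : W) :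
    V v = lotteryUtility P φ ψ v w :=
  hV.eq_of_const hg hv fun w' =>
    lotteryUtility_congr_dist hc hm hψ (hDb hv) (hDb hv) fun t => hu w' w t

include hV hψ hm hg hDf in
theorem IsValue.binRep : BinRep P R φ ψ := by
  intro B B' p p' h h' t x t' x'
  rw [hV.rel_iff _ (hDf (bet_mem_finiteRV h.1 t x)) _ (hDf (bet_mem_finiteRV h'.1 t' x')),
    hV.eq_of_const hg (hDf (bet_mem_finiteRV h.1 t x)) (lotteryUtility_bet hm.monotone hψ h t x),
    hV.eq_of_const hg (hDf (bet_mem_finiteRV h'.1 t' x'))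
      (lotteryUtility_bet hm.monotone hψ h' t' x')]

omit [Nonempty W] in
-- As `0 < p < 1`, both the event and its complement have points in the state `w`, and
-- comonotonicity is tested on such a pair.
theorem comonotonic_bet_iff {A : Set (W × S)} {p : ℝ} (hA : HasProb P A p)
    (hp : p ∈ Ioo (0 : ℝ) 1) (w : W) {x y x' y' : ℝ}
    (h : Comonotonic (bet x A y) (bet x' A y')) : (y ≤ x ∧ y' ≤ x') ∨ (x ≤ y ∧ x' ≤ y') := by
  have h1 : {s | (w, s) ∈ A}.Nonempty := by
    by_contra hcon
    have := hA.2 w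
    rw [not_nonempty_iff_eq_empty.1 hcon, measureReal_empty] at this
    exact hp.1.ne this
  have h2 : {s | (w, s) ∈ Aᶜ}.Nonempty := by
    by_contra hcon
    have := hA.compl.2 w
    rw [not_nonempty_iff_eq_empty.1 hcon, measureReal_empty] at this
    linarith [hp.2]
  obtain ⟨s, hs⟩ := h1
  obtain ⟨s', hs'⟩ := h2
  have h3 := h w s' s
  have hs0 : (w, s) ∈ A := hs
  have hs0' : (w, s') ∉ A := hs'
  rw [bet_of_mem hs0, bet_of_mem hs0, bet_of_notMem hs0', bet_of_notMem hs0'] at h3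
  rcases mul_nonneg_iff.1 h3 with h4 | h4
  · exact Or.inl ⟨by linarith [h4.1], by linarith [h4.2]⟩
  · exact Or.inr ⟨by linarith [h4.1], by linarith [h4.2]⟩

/-- Rank-dependent utility of a bet is affine as long as the ranking of the outcomes is kept. -/
theorem binVal_mix {ψ : ℝ → ℝ} {β p s y s' y' : ℝ} (h0 : 0 ≤ β) (h1 : β ≤ 1)
    (h : (y ≤ s ∧ y' ≤ s') ∨ (s ≤ y ∧ s' ≤ y')) :
    binVal ψ p (β * s + (1 - β) * s') (β * y + (1 - β) * y') =
      β * binVal ψ p s y + (1 - β) * binVal ψ p s' y' := by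
  rcases h with h | h
  · rw [binVal_of_le h.1, binVal_of_le h.2, binVal_of_le
      (add_le_add (mul_le_mul_of_nonneg_left h.1 h0)
        (mul_le_mul_of_nonneg_left h.2 (sub_nonneg.2 h1)))]
    ring
  · rw [binVal_of_ge h.1, binVal_of_ge h.2, binVal_of_ge
      (add_le_add (mul_le_mul_of_nonneg_left h.1 h0)
        (mul_le_mul_of_nonneg_left h.2 (sub_nonneg.2 h1)))]
    ring

theorem BinRep.isSub_eq_bet {R : (W × S → ℝ) → (W × S → ℝ) → Prop} (H : BinRep P R φ ψ)
    (hc : Continuous φ) (hm : StrictMono φ) (hψ : Distortion ψ) {A B : Set (W × S)} {q : ℝ}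
    (hB : HasProb P B q) {β : ℝ} {x y x'' y'' : ℝ}
    (hx : binVal ψ q (φ x) (φ x'') = β * φ x + (1 - β) * φ x'')
    (hy : binVal ψ q (φ y) (φ y'') = β * φ y + (1 - β) * φ y'')
    {v' : W × S → ℝ} (h : IsSub R B (bet x A y) (bet x'' A y'') v') :
    ∃ a b, v' = bet a A b ∧ φ a = β * φ x + (1 - β) * φ x'' ∧
      φ b = β * φ y + (1 - β) * φ y'' := by
  obtain ⟨a, ha⟩ := exists_utility_eq_binVal hc hm hψ hB.mem_Icc x x''
  obtain ⟨b, hb⟩ := exists_utility_eq_binVal hc hm hψ hB.mem_Icc y y''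
  refine ⟨a, b, funext fun z => hm.injective ?_, ha.trans hx, hb.trans hy⟩
  have hz := (H.isCE_bet hB _ _ _).1 (h z)
  by_cases hzA : z ∈ A
  · rw [bet_of_mem hzA, bet_of_mem hzA] at hz
    rw [bet_of_mem hzA, hz, ha]
  · rw [bet_of_notMem hzA, bet_of_notMem hzA] at hz
    rw [bet_of_notMem hzA, hz, hb]

/-- The dominance condition places the outcomes of the common bet on one side of all the others, so
the state-wise mixtures all use the same utility weight `β`, namely `ψ q` or `1 - ψ (1 - q)`. By
comonotonicity the value of a mixture is then the `β`-mixture of the values. -/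
theorem BinRep.axiomBinaryIndependence {R : (W × S → ℝ) → (W × S → ℝ) → Prop}
    (H : BinRep P R φ ψ) (hc : Continuous φ) (hm : StrictMono φ) (hψ : Distortion ψ)
    (D : Set (W × S → ℝ)) : AxiomBinaryIndependence P D R := by
  intro A B hA hB x x' x'' y y' y'' _ hvr hur hdom v' _ u' _ hv' hu' hvu
  obtain ⟨p, hp, hA⟩ := (H.essential_iff hm hψ).1 hA
  obtain ⟨q, hB⟩ := hB.exists_hasProb
  have w : W := Classical.arbitrary W
  have hq := hB.mem_Icc
  have hq' : 1 - q ∈ Icc (0 : ℝ) 1 := ⟨by linarith [hq.2], by linarith [hq.1]⟩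
  have hb1 := hψ.mem_Icc hq
  have hb2 := hψ.mem_Icc hq'
  obtain ⟨β, hβ, e1, e2, e3, e4⟩ : ∃ β ∈ Icc (0 : ℝ) 1,
      binVal ψ q (φ x) (φ x'') = β * φ x + (1 - β) * φ x'' ∧
      binVal ψ q (φ y) (φ y'') = β * φ y + (1 - β) * φ y'' ∧
      binVal ψ q (φ x') (φ x'') = β * φ x' + (1 - β) * φ x'' ∧
      binVal ψ q (φ y') (φ y'') = β * φ y' + (1 - β) * φ y'' := by
    rcases hdom with ⟨h1, h2, h3, h4⟩ | ⟨h1, h2, h3, h4⟩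
    · exact ⟨ψ q, hb1, binVal_of_le (hm.monotone h1), binVal_of_le (hm.monotone h3),
        binVal_of_le (hm.monotone h2), binVal_of_le (hm.monotone h4)⟩
    · refine ⟨1 - ψ (1 - q), ⟨by linarith [hb2.2], by linarith [hb2.1]⟩, ?_, ?_, ?_, ?_⟩
      · rw [binVal_of_ge (hm.monotone h1)]; ring
      · rw [binVal_of_ge (hm.monotone h3)]; ring
      · rw [binVal_of_ge (hm.monotone h2)]; ring
      · rw [binVal_of_ge (hm.monotone h4)]; ring
  obtain ⟨a, b, rfl, ha, hb⟩ := H.isSub_eq_bet hc hm hψ hB e1 e2 hv'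
  obtain ⟨a', b', rfl, ha', hb'⟩ := H.isSub_eq_bet hc hm hψ hB e3 e4 hu'
  have hmono : ∀ {x y x' y' : ℝ}, (y ≤ x ∧ y' ≤ x') ∨ (x ≤ y ∧ x' ≤ y') →
      (φ y ≤ φ x ∧ φ y' ≤ φ x') ∨ (φ x ≤ φ y ∧ φ x' ≤ φ y') := fun h =>
    h.imp (fun h => ⟨hm.monotone h.1, hm.monotone h.2⟩) fun h => ⟨hm.monotone h.1, hm.monotone h.2⟩
  rw [H _ _ _ _ hA hA] at hvu ⊢
  rw [ha, hb, ha', hb', binVal_mix hβ.1 hβ.2 (hmono (comonotonic_bet_iff hA hp w hvr)),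
    binVal_mix hβ.1 hβ.2 (hmono (comonotonic_bet_iff hA hp w hur))]
  linarith [mul_le_mul_of_nonneg_left hvu hβ.1]

theorem Comonotonic.comonotonicOn {W S : Type*} [MeasurableSpace W] [MeasurableSpace S]
    {φ : ℝ → ℝ} (hm : Monotone φ) {v r : W × S → ℝ}
    (h : Comonotonic v r) (w : W) :
    ComonotonicOn (fun s => φ (v (w, s))) fun s => φ (r (w, s)) := by
  intro s s'
  rcases mul_nonneg_iff.1 (h w s s') with ⟨h1, h2⟩ | ⟨h1, h2⟩
  · exact mul_nonneg (sub_nonneg.2 (hm (sub_nonneg.1 h1))) (sub_nonneg.2 (hm (sub_nonneg.1 h2)))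
  · exact mul_nonneg_of_nonpos_of_nonpos (sub_nonpos.2 (hm (sub_nonpos.1 h1)))
      (sub_nonpos.2 (hm (sub_nonpos.1 h2)))

omit [Nonempty W] in
/-- Comonotonic additivity of the utility of lotteries. -/
theorem lotteryUtility_add (hψ : Distortion ψ) (hc : Continuous φ) (hm : Monotone φ)
    {v r v' : W × S → ℝ} (hv : v ∈ boundedRV W S) (hr : r ∈ boundedRV W S)
    (hvr : Comonotonic v r) {k : ℝ} (h : ∀ x, φ (v' x) = φ (v x) + φ (r x) - k) (w : W) :
    lotteryUtility P φ ψ v' w = lotteryUtility P φ ψ v w + lotteryUtility P φ ψ r w - k := by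
  have hv1 := bdd_section (comp_mem_boundedRV hv hc) w
  have hr1 := bdd_section (comp_mem_boundedRV hr hc) w
  have h1 : lotteryUtility P φ ψ v' w =
      rankIntegral ψ (P w) fun s => (φ (v (w, s)) + φ (r (w, s))) + -k := by
    simp only [lotteryUtility, h, sub_eq_add_neg]
  rw [h1, rankIntegral_add_const hψ (P w) (hv1.add hr1),
    rankIntegral_add hψ (P w) hv1 hr1 (hvr.comonotonicOn hm w), ← sub_eq_add_neg]
  rfl

include hDf hDb in
-- The value is monotone and translation invariant in the lottery utility (`IsValue.le_add`) and
-- equals it when it is constant in `w`, while `BinRep` turns the subjective operations into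
-- arithmetic; each axiom is then an inequality between utilities.
theorem Represents.satisfiesAxioms (hR : Represents P D R φ ψ c) : SatisfiesAxioms P D R := by
  obtain ⟨V, hV⟩ := hR.exists_isValue
  have hψ := hR.distortion
  have hc := hR.utility_continuous
  have hm := hR.utility_strictMono
  have hg := hR.penalty_grounded
  have H := hV.binRep hψ hm hg hDf
  have w₀ : W := Classical.arbitrary W
  have : Nonempty S := nonempty_state P
  have hstrict : ∀ v ∈ D, ∀ u ∈ D, (Strict R v u ↔ V u < V v) := fun v hv u hu => by
    rw [Strict, hV.rel_iff v hv u hu, hV.rel_iff u hu v hv, not_le]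
    exact ⟨fun h => h.2, fun h => ⟨h.le, h⟩⟩
  refine ⟨⟨?_, ?_⟩, ?_, ⟨?_, ?_⟩, ?_, ?_, ?_, ?_, H.axiomBinaryIndependence hc hm hψ D⟩
  · intro v hv u hu
    rw [hV.rel_iff v hv u hu, hV.rel_iff u hu v hv]
    exact le_total _ _
  · intro v hv u hu r hr h1 h2
    rw [hV.rel_iff v hv u hu] at h1
    rw [hV.rel_iff u hu r hr] at h2
    rw [hV.rel_iff v hv r hr]
    exact h2.trans h1
  · intro v hv u hu h
    have h1 : ∀ w, lotteryUtility P φ ψ v w = lotteryUtility P φ ψ u w := fun w =>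
      lotteryUtility_congr_dist hc hm hψ (hDb hv) (hDb hu) (h w)
    rw [Indiff, hV.rel_iff v hv u hu, hV.rel_iff u hu v hv]
    exact ⟨hV.mono hψ hc hDb hu hv fun w => (h1 w).ge, hV.mono hψ hc hDb hv hu fun w => (h1 w).le⟩
  · intro v hv u hu hvu huu hs vs us hvs hus hvb hub hvc huc
    rw [hstrict v hv u hu] at hs
    have t1 : Tendsto (fun n => V (vs n)) atTop (𝓝 (V v)) := by
      simp only [fun n => hV.eq_of_unambiguous hψ hc hm hg hDb (hvs n).1 (hvs n).2 w₀,
        hV.eq_of_unambiguous hψ hc hm hg hDb hv hvu w₀]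
      exact lotteryUtility_tendsto hc hm hψ (hDb hv) hvb hvc w₀
    have t2 : Tendsto (fun n => V (us n)) atTop (𝓝 (V u)) := by
      simp only [fun n => hV.eq_of_unambiguous hψ hc hm hg hDb (hus n).1 (hus n).2 w₀,
        hV.eq_of_unambiguous hψ hc hm hg hDb hu huu w₀]
      exact lotteryUtility_tendsto hc hm hψ (hDb hu) hub huc w₀
    obtain ⟨N, hN⟩ := eventually_atTop.1
      ((t1.eventually_const_lt hs).and (t2.eventually_lt_const hs))
    exact ⟨N, fun n hn => ⟨(hstrict _ (hvs n).1 _ hu).2 (hN n hn).1,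
      (hstrict _ hv _ (hus n).1).2 (hN n hn).2⟩⟩
  · intro v hv
    have hsm := fun m => hDf (sure_mem_finiteRV (W := W) (S := S) m)
    simp only [fun m => hstrict _ (hsm m) v hv, fun m => hstrict v hv _ (hsm m),
      hV.sure hψ hg hDf]
    exact ⟨isOpen_lt continuous_const hc, isOpen_lt hc continuous_const⟩
  · intro v hv u hu hvu huu h
    have e1 := hV.eq_of_unambiguous hψ hc hm hg hDb hv hvu
    have e2 := hV.eq_of_unambiguous hψ hc hm hg hDb hu huu
    refine ⟨?_, ?_⟩
    · rw [hV.rel_iff v hv u hu, e1 w₀, e2 w₀]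
      exact lotteryUtility_mono_dist hc hm hψ (hDb hv) (hDb hu) (h w₀)
    · rintro ⟨w, t, hlt⟩
      rw [hstrict v hv u hu, e1 w, e2 w]
      exact lotteryUtility_strict_mono_dist hc hm hψ (hDb hv) (hDb hu) (h w) hlt
  · intro v hv u hu h
    rw [hV.rel_iff v hv u hu]
    refine hV.mono hψ hc hDb hu hv fun w => ?_
    obtain ⟨v₀, hv₀, u₀, hu₀, e1, e2, h3⟩ := h w
    rw [hV.rel_iff v₀ hv₀ u₀ hu₀,
      hV.eq_of_const hg hu₀ fun w' => lotteryUtility_congr_dist hc hm hψ (hDb hu₀) (hDb hu) (e2 w'),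
      hV.eq_of_const hg hv₀ fun w' =>
        lotteryUtility_congr_dist hc hm hψ (hDb hv₀) (hDb hv) (e1 w')] at h3
    exact h3
  · intro g h k α hg' hh hk h0 h1 hgh hmix
    rw [Indiff, hV.rel_iff _ hg' _ hh, hV.rel_iff _ hh _ hg', ← le_antisymm_iff] at hgh
    rw [hV.rel_iff _ hk _ hg']
    -- A subjective mixture mixes utilities state by state, so the axiom becomes concavity of a
    -- minimum of concave functionals.
    have ek : lotteryUtility P φ ψ (riskless k) = fun w =>
        α * lotteryUtility P φ ψ (riskless g) w +
          (1 - α) * lotteryUtility P φ ψ (riskless h) w := funext fun w => by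
      simp only [lotteryUtility_riskless hψ]
      exact H.subjMix_utility hc hm hψ (hmix w)
    have hl := hV.isLeast _ hk
    rw [ek] at hl
    have := isLeast_penExpect_concave (bdd_lotteryUtility hc hψ (hDb hg'))
      (bdd_lotteryUtility hc hψ (hDb hh)) h0.le h1.le (hV.isLeast _ hg') (hV.isLeast _ hh) hl
    rw [hgh] at this
    rw [← hgh]
    linarith
  · intro v hv u hu r hr hru hvr hur v' hv' u' hu' h1 h2 hvu
    rw [hV.rel_iff v hv u hu] at hvu
    rw [hV.rel_iff v' hv' u' hu']
    -- An unambiguous summand has the same utility in every state, so by comonotonic additivity both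
    -- lottery utilities are shifted by one constant.
    have er : ∀ w, lotteryUtility P φ ψ r w = V r := fun w =>
      (hV.eq_of_unambiguous hψ hc hm hg hDb hr hru w).symm
    have ev := lotteryUtility_add (P := P) hψ hc hm.monotone (hDb hv) (hDb hr) hvr fun x =>
      H.subjSum_utility hc hm hψ (h1 x)
    have eu := lotteryUtility_add (P := P) hψ hc hm.monotone (hDb hu) (hDb hr) hur fun x =>
      H.subjSum_utility hc hm hψ (h2 x)
    have a1 := hV.le_add hψ hc hDb hv hv' (k := -(V r - φ 0)) fun w => by
      rw [ev w, er w]; linarith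
    have a2 := hV.le_add hψ hc hDb hu' hu (k := V r - φ 0) fun w => by
      rw [eu w, er w]; linarith
    linarith

end Sufficiency

/-! ### The minimal penalty -/

section MinPenalty
variable {W S : Type*} [MeasurableSpace W] [MeasurableSpace S] [Nonempty W]

omit [Nonempty W] in
/-- A bounded measurable function of the state of the world is approximated by the utilities of
riskless random variables with finitely many values. -/
theorem exists_riskless_approx {φ : ℝ → ℝ} (hc : Continuous φ) {f : W → ℝ} (hf : Measurable f)
    {a b : ℝ} (h : ∀ w, f w ∈ Icc (φ a) (φ b)) {k : ℝ} (hk : 0 < k) :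
    ∃ g : SimpleFunc W ℝ, ∀ w, φ (g w) ≤ f w ∧ f w ≤ φ (g w) + k := by
  obtain ⟨s, hs⟩ := exists_simple_approx hf (Bdd.of_mem_Icc h) hk
  -- Rounding down may leave the range of `φ`; raising the result to at least `φ a` prevents this
  -- and spoils neither inequality.
  refine ⟨s.map fun y => Function.invFun φ (max y (φ a)), fun w => ?_⟩
  have h1 : ∃ x, φ x = max (s w) (φ a) := by
    refine mem_range_of_exists_le_of_exists_ge hc ⟨a, le_max_right _ _⟩ ⟨b, max_le ?_ ?_⟩
    · exact (hs w).1.trans (h w).2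
    · exact (h w).1.trans (h w).2
  have h2 : φ ((s.map fun y => Function.invFun φ (max y (φ a))) w) = max (s w) (φ a) :=
    Function.invFun_eq h1
  rw [h2]
  exact ⟨max_le (hs w).1 (h w).1, (hs w).2.trans (add_le_add (le_max_left _ _) le_rfl)⟩

omit [Nonempty W] in
theorem exists_utility_bounds {φ ψ : ℝ → ℝ} (hψ : Distortion ψ) (hm : StrictMono φ)
    {P : Kernel W S} [IsMarkovKernel P] {v : W × S → ℝ} (hv : v ∈ boundedRV W S) :
    ∃ a b, ∀ w, lotteryUtility P φ ψ v w ∈ Icc (φ a) (φ b) := by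
  have hb : Bdd v := hv.2
  obtain ⟨a, b, hab, h⟩ := hb.exists_Icc
  exact ⟨a, b, lotteryUtility_mem_Icc hψ (hm.monotone hab.le)
    fun x => ⟨hm.monotone (h x).1, hm.monotone (h x).2⟩⟩

variable (R : (W × S → ℝ) → (W × S → ℝ) → Prop) {φ : ℝ → ℝ}

omit [Nonempty W] in
theorem le_minPenalty {g : W → ℝ} {m : ℝ} (hg : (riskless g : W × S → ℝ) ∈ finiteRV W S)
    (hm : IsCE R (riskless g) m) (Q : FinAddProb W) :
    ENNReal.ofReal (φ m - Q.expect fun w => φ (g w)) ≤ minPenalty R φ Q :=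
  le_iSup_of_le g (le_iSup_of_le m (le_iSup_of_le hg (le_iSup_of_le hm le_rfl)))

omit [Nonempty W] in
theorem minPenalty_le {Q : FinAddProb W} {k : ℝ≥0∞}
    (h : ∀ (g : W → ℝ) (m : ℝ), (riskless g : W × S → ℝ) ∈ finiteRV W S → IsCE R (riskless g) m →
      ENNReal.ofReal (φ m - Q.expect fun w => φ (g w)) ≤ k) : minPenalty R φ Q ≤ k :=
  iSup_le fun g => iSup_le fun m => iSup_le fun hg => iSup_le fun hm => h g m hg hm

/-- The simple function of the utilities of a riskless random variable. -/
theorem exists_simpleFunc_of_riskless [Nonempty S] (φ : ℝ → ℝ) {g : W → ℝ}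
    (hg : (riskless g : W × S → ℝ) ∈ finiteRV W S) :
    ∃ s : SimpleFunc W ℝ, (s : W → ℝ) = fun w => φ (g w) := by
  have h1 : Measurable g := measurable_of_riskless hg.1
  have h2 : (range g).Finite := hg.2.subset (by
    rintro _ ⟨w, rfl⟩
    exact ⟨(w, Classical.arbitrary S), rfl⟩)
  exact ⟨(⟨g, fun x => h1 (measurableSet_singleton x), h2⟩ : SimpleFunc W ℝ).map φ, rfl⟩

/-- A supremum of functions of `Q` that are continuous by the choice of the topology. -/
theorem lowerSemicontinuous_minPenalty [Nonempty S] : LowerSemicontinuous (minPenalty R φ) := by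
  refine lowerSemicontinuous_iSup fun g => lowerSemicontinuous_iSup fun m =>
    lowerSemicontinuous_iSup fun hg => lowerSemicontinuous_iSup fun _ => ?_
  obtain ⟨s, hs⟩ := exists_simpleFunc_of_riskless φ hg
  rw [← hs]
  exact (ENNReal.continuous_ofReal.comp (continuous_const.sub
    (continuous_expect s.measurable (Bdd.simpleFunc s)))).lowerSemicontinuous

/-- A supremum of positive parts of functions affine in `Q`: the expectation of a simple function is
a finite combination of masses. -/
theorem convexPenalty_minPenalty [Nonempty S] : ConvexPenalty (minPenalty R φ) := by
  intro Q₁ Q₂ Q a h0 h1 hQ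
  refine minPenalty_le R fun g m hg hm => ?_
  obtain ⟨s, hs⟩ := exists_simpleFunc_of_riskless φ hg
  have e : ∀ Q : FinAddProb W, (Q.expect fun w => φ (g w)) = Q.simpleIntegral s := fun Q => by
    rw [← hs, Q.expect_simple]
  have elin : Q.simpleIntegral s = a * Q₁.simpleIntegral s + (1 - a) * Q₂.simpleIntegral s := by
    simp only [FinAddProb.simpleIntegral, hQ, Finset.mul_sum, ← Finset.sum_add_distrib]
    exact Finset.sum_congr rfl fun _ _ => by ring
  have l1 := le_minPenalty (φ := φ) R hg hm Q₁
  have l2 := le_minPenalty (φ := φ) R hg hm Q₂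
  rw [e] at l1 l2 ⊢
  calc ENNReal.ofReal (φ m - Q.simpleIntegral s)
      = ENNReal.ofReal (a * (φ m - Q₁.simpleIntegral s) +
          (1 - a) * (φ m - Q₂.simpleIntegral s)) := by rw [elin]; congr 1; ring
    _ ≤ ENNReal.ofReal (a * (φ m - Q₁.simpleIntegral s)) +
          ENNReal.ofReal ((1 - a) * (φ m - Q₂.simpleIntegral s)) := ENNReal.ofReal_add_le
    _ = ENNReal.ofReal a * ENNReal.ofReal (φ m - Q₁.simpleIntegral s) +
          ENNReal.ofReal (1 - a) * ENNReal.ofReal (φ m - Q₂.simpleIntegral s) := by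
        rw [ENNReal.ofReal_mul h0, ENNReal.ofReal_mul (sub_nonneg.2 h1)]
    _ ≤ _ := add_le_add (mul_le_mul_right l1 _) (mul_le_mul_right l2 _)

variable {R} {P : Kernel W S} [IsMarkovKernel P] {ψ : ℝ → ℝ}

/-- A value functional that is monotone and translation invariant is below the penalized
expectations for the minimal penalty. -/
theorem le_penExpect_minPenalty (hc : Continuous φ) (hm : StrictMono φ) (hψ : Distortion ψ)
    {V : (W × S → ℝ) → ℝ} {v : W × S → ℝ} (hv : v ∈ boundedRV W S)
    (hce : ∀ g : SimpleFunc W ℝ, ∃ m, IsCE R (riskless g) m ∧ V (riskless g) = φ m)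
    (hV : ∀ (g : SimpleFunc W ℝ) (k : ℝ), 0 < k →
      (∀ w, lotteryUtility P φ ψ v w ≤ φ (g w) + k) → V v ≤ V (riskless g) + k)
    (Q : FinAddProb W) :
    (V v : EReal) ≤ penExpect (minPenalty R φ) (lotteryUtility P φ ψ v) Q := by
  by_cases htop : minPenalty R φ Q = ⊤
  · simp [penExpect, htop]
  rw [coe_le_penExpect_of_ne_top htop]
  refine le_of_forall_pos_le_add fun k hk => ?_
  -- For riskless variables the bound is the definition of the penalty; `v` is compared with a
  -- riskless `g` whose utility lies below its lottery utility by at most `k`.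
  obtain ⟨a, b, hab⟩ := exists_utility_bounds (P := P) hψ hm hv
  obtain ⟨g, hg⟩ := exists_riskless_approx hc (measurable_lotteryUtility (P := P) hc hψ hv) hab hk
  obtain ⟨m, hm1, hm2⟩ := hce g
  have h1 := hV g k hk fun w => (hg w).2
  have h2 := coe_le_penExpect_iff.2 (le_minPenalty (φ := φ) R
    (riskless_mem_finiteRV g.measurable g.finite_range) hm1 Q)
  rw [coe_le_penExpect_of_ne_top htop] at h2
  have h3 := Q.expect_mono (Bdd.comp_continuous (Bdd.simpleFunc g) hc)
    (bdd_lotteryUtility (P := P) hc hψ hv) fun w => (hg w).1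
  linarith

theorem exists_utility_eq_of_bounds {φ : ℝ → ℝ} (hc : Continuous φ) {a b y : ℝ} (h : y ∈ Icc (φ a) (φ b)) :
    ∃ m, φ m = y := mem_range_of_exists_le_of_exists_ge hc ⟨a, h.1⟩ ⟨b, h.2⟩

variable {c : FinAddProb W → ℝ≥0∞} {D : Set (W × S → ℝ)}

theorem IsValue.exists_isCE {V : (W × S → ℝ) → ℝ} (hV : IsValue P D R φ ψ c V) (hψ : Distortion ψ)
    (hc : Continuous φ) (hm : StrictMono φ) (hg : Grounded c) (hDf : finiteRV W S ⊆ D)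
    (hDb : D ⊆ boundedRV W S) {v : W × S → ℝ} (hv : v ∈ D) : ∃ m, IsCE R v m ∧ V v = φ m := by
  obtain ⟨a, b, hab⟩ := exists_utility_bounds (P := P) hψ hm (hDb hv)
  have ha := hDf (sure_mem_finiteRV (W := W) (S := S) a)
  have hb := hDf (sure_mem_finiteRV (W := W) (S := S) b)
  have h1 := hV.mono hψ hc hDb ha hv fun w => by rw [lotteryUtility_sure hψ]; exact (hab w).1
  have h2 := hV.mono hψ hc hDb hv hb fun w => by rw [lotteryUtility_sure hψ]; exact (hab w).2
  rw [hV.sure hψ hg hDf] at h1 h2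
  obtain ⟨m, hm'⟩ := exists_utility_eq_of_bounds hc ⟨h1, h2⟩
  have hs := hDf (sure_mem_finiteRV (W := W) (S := S) m)
  refine ⟨m, ?_, hm'.symm⟩
  rw [IsCE, Indiff, hV.rel_iff _ hs _ hv, hV.rel_iff _ hv _ hs, hV.sure hψ hg hDf, hm']
  exact ⟨le_rfl, le_rfl⟩

/-- The value is at most `E_Q + c Q` for each `Q`; solving for `c Q` gives the terms of the
supremum. As `ψ` does not enter for riskless variables, the bound is the same for every distortion.
-/
theorem Represents.minPenalty_le (h : Represents P (finiteRV W S) R φ ψ c) (Q : FinAddProb W) :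
    minPenalty R φ Q ≤ c Q := by
  obtain ⟨V, hV⟩ := h.exists_isValue
  refine RDV.minPenalty_le R fun g m hg hm => ?_
  have hs := sure_mem_finiteRV (W := W) (S := S) m
  rw [IsCE, Indiff, hV.rel_iff _ hs _ hg, hV.rel_iff _ hg _ hs, ← le_antisymm_iff,
    hV.sure h.distortion h.penalty_grounded Subset.rfl] at hm
  have h1 := (hV.isLeast _ hg).2 ⟨Q, rfl⟩
  rw [hm, coe_le_penExpect_iff] at h1
  rwa [show lotteryUtility P φ ψ (riskless g) = fun w => φ (g w) from
    funext (lotteryUtility_riskless h.distortion g)] at h1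

/-- Lowering the penalty can only lower the penalized expectations, while `le_penExpect_minPenalty`
keeps them above the value; so the old minimizer still attains it. -/
theorem Represents.minPenalty (h : Represents P (finiteRV W S) R φ ψ c) :
    Represents P (finiteRV W S) R φ ψ (minPenalty R φ) := by
  have : Nonempty S := nonempty_state P
  obtain ⟨V, hV⟩ := h.exists_isValue
  have hψ := h.distortion
  have hc := h.utility_continuous
  have hm := h.utility_strictMono
  have hg := h.penalty_grounded
  refine ⟨hc, hm, hψ.continuousOn, hψ.strictMonoOn, hψ.zero, hψ.one, ?_,
    convexPenalty_minPenalty R, lowerSemicontinuous_minPenalty R, V, fun v hv => ?_, hV.rel_iff⟩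
  · obtain ⟨⟨Q, hQ⟩, -⟩ := hg
    exact ⟨⟨Q, le_antisymm ((h.minPenalty_le Q).trans_eq hQ) bot_le⟩, fun _ _ => bot_le⟩
  · have hlow := le_penExpect_minPenalty (R := R) (P := P) (V := V) hc hm hψ
      (finiteRV_subset_boundedRV hv) (fun g => hV.exists_isCE hψ hc hm hg Subset.rfl
        finiteRV_subset_boundedRV (riskless_mem_finiteRV g.measurable g.finite_range))
      fun g k hk hle => hV.le_add hψ hc finiteRV_subset_boundedRV hv
        (riskless_mem_finiteRV g.measurable g.finite_range) fun w => by
          rw [lotteryUtility_riskless hψ]; exact hle w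
    obtain ⟨Q, hQ⟩ := (hV.isLeast v hv).1
    refine ⟨⟨Q, le_antisymm (le_of_le_of_eq ?_ hQ) (hlow Q)⟩, ?_⟩
    · exact add_le_add le_rfl (EReal.coe_ennreal_le_coe_ennreal_iff.2 (h.minPenalty_le Q))
    · rintro _ ⟨Q', rfl⟩
      exact hlow Q'

end MinPenalty

/-! ### Certainty equivalents from the axioms -/

section Axioms
variable {W S : Type*} [MeasurableSpace W] [MeasurableSpace S] [Nonempty W] {P : Kernel W S}
  [IsMarkovKernel P] {D : Set (W × S → ℝ)} {R : (W × S → ℝ) → (W × S → ℝ) → Prop}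
  (hA : SatisfiesAxioms P D R) (hDf : finiteRV W S ⊆ D) (hDb : D ⊆ boundedRV W S)
  (hcopy : ∀ v ∈ D, ∀ w, ∃ v₀ ∈ D, ∀ w' t, condCDF P v₀ w' t = condCDF P v w t)

omit [Nonempty W] in
theorem exists_copy_finiteRV (hP : HasUniform P) : ∀ v ∈ finiteRV W S, ∀ w,
    ∃ v₀ ∈ finiteRV W S, ∀ w' t, condCDF P v₀ w' t = condCDF P v w t := fun v hv w => by
  obtain ⟨v₀, -, h1, h2⟩ := exists_copy hP (finiteRV_subset_boundedRV hv) w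
  exact ⟨v₀, h2 hv, h1⟩

omit [Nonempty W] in
theorem exists_copy_boundedRV (hP : HasUniform P) : ∀ v ∈ boundedRV W S, ∀ w,
    ∃ v₀ ∈ boundedRV W S, ∀ w' t, condCDF P v₀ w' t = condCDF P v w t := fun v hv w => by
  obtain ⟨v₀, h0, h1, -⟩ := exists_copy hP hv w
  exact ⟨v₀, h0, h1⟩

omit [Nonempty W] [IsMarkovKernel P] in
include hA hcopy in
-- Dominance concerns unambiguous variables only; copies of the conditional lotteries and the
-- monotonicity axiom extend it state by state.
theorem SatisfiesAxioms.of_cdf_le {v u : W × S → ℝ} (hv : v ∈ D) (hu : u ∈ D)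
    (h : ∀ w t, condCDF P v w t ≤ condCDF P u w t) : R v u := by
  refine hA.monotonicity v hv u hu fun w => ?_
  obtain ⟨v₀, hv₀, hv1⟩ := hcopy v hv w
  obtain ⟨u₀, hu₀, hu1⟩ := hcopy u hu w
  exact ⟨v₀, hv₀, u₀, hu₀, hv1, hu1, (hA.dominance v₀ hv₀ u₀ hu₀
    (fun w₁ w₂ t => by rw [hv1, hv1]) (fun w₁ w₂ t => by rw [hu1, hu1])
    fun w' t => by rw [hv1, hu1]; exact h w t).1⟩

omit [Nonempty W] in
include hA hcopy in
theorem SatisfiesAxioms.of_le {v u : W × S → ℝ} (hv : v ∈ D) (hu : u ∈ D)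
    (h : ∀ x, u x ≤ v x) : R v u :=
  hA.of_cdf_le hcopy hv hu fun _ _ => measureReal_mono fun _ hs => (h _).trans hs

include hA hDf in
theorem SatisfiesAxioms.sure_sure {m t : ℝ} : R (sure m) (sure t) ↔ t ≤ m := by
  have h : ∀ {m t : ℝ}, t ≤ m → R (sure m) (sure t) ∧ (t < m → Strict R (sure m) (sure t)) := by
    intro m t htm
    have h0 := hA.dominance _ (hDf (sure_mem_finiteRV m)) _ (hDf (sure_mem_finiteRV t))
      (unambiguous_sure m) (unambiguous_sure t) fun w r => measureReal_mono
        fun s hs => htm.trans hs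
    refine ⟨h0.1, fun hlt => h0.2 ⟨Classical.arbitrary W, t, ?_⟩⟩
    simp [condCDF, sure, not_le.2 hlt]
  refine ⟨fun h1 => ?_, fun h1 => (h h1).1⟩
  by_contra hcon
  exact ((h (not_le.1 hcon).le).2 (not_le.1 hcon)).2 h1

omit [Nonempty W] in
include hA hDf hDb hcopy in
-- The constants strictly better and those strictly worse than `v` form open sets. Without a
-- certainty equivalent they would cover the connected line, both nonempty since `v` is bounded, and
-- so would meet.
theorem SatisfiesAxioms.exists_isCE {v : W × S → ℝ} (hv : v ∈ D) : ∃ m, IsCE R v m := by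
  have hb : Bdd v := (hDb hv).2
  obtain ⟨a, b, hab, hI⟩ := hb.exists_Icc
  have hs := fun m => hDf (sure_mem_finiteRV (W := W) (S := S) m)
  obtain ⟨o1, o2⟩ := hA.continuity.2 v hv
  by_contra! hcon
  have hne : ∀ m, Strict R (sure m) v ∨ Strict R v (sure m) := fun m => by
    have h1 := hcon m
    rw [IsCE, Indiff, not_and_or] at h1
    rcases hA.weakOrder.1 _ (hs m) v hv with h2 | h2
    · exact Or.inl ⟨h2, h1.resolve_left (not_not.2 h2)⟩
    · exact Or.inr ⟨h2, h1.resolve_right (not_not.2 h2)⟩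
  have hbm : Strict R (sure b) v := (hne b).resolve_right fun h =>
    h.2 (hA.of_le hcopy (hs b) hv fun x => (hI x).2)
  have ham : Strict R v (sure a) := (hne a).resolve_left fun h =>
    h.2 (hA.of_le hcopy hv (hs a) fun x => (hI x).1)
  obtain ⟨m, -, h1, h2⟩ := isPreconnected_univ _ _ o1 o2 (fun m _ => hne m)
    ⟨b, mem_univ _, hbm⟩ ⟨a, mem_univ _, ham⟩
  exact h1.2 h2.1

/-! ### The extension to bounded random variables -/

open Classical in
/-- The value functional of `(φ, ψ, c)` on bounded random variables. -/
def extVal (P : Kernel W S) (φ ψ : ℝ → ℝ) (c : FinAddProb W → ℝ≥0∞) (v : W × S → ℝ) : ℝ :=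
  if h : ∃ r : ℝ, IsLeast (range (penExpect c (lotteryUtility P φ ψ v))) (r : EReal)
    then h.choose else 0

/-- The preference represented by `(φ, ψ, c)` on bounded random variables. -/
def extRel (P : Kernel W S) (φ ψ : ℝ → ℝ) (c : FinAddProb W → ℝ≥0∞) (v u : W × S → ℝ) : Prop :=
  extVal P φ ψ c u ≤ extVal P φ ψ c v

variable {φ ψ : ℝ → ℝ} {c : FinAddProb W → ℝ≥0∞}

theorem isValue_extVal (hψ : Distortion ψ) (hc : Continuous φ) (hg : Grounded c)
    (hl : LowerSemicontinuous c) :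
    IsValue P (boundedRV W S) (extRel P φ ψ c) φ ψ c (extVal P φ ψ c) := by
  refine ⟨fun v hv => ?_, fun _ _ _ _ => Iff.rfl⟩
  have h := exists_isLeast_penExpect hg hl (measurable_lotteryUtility (P := P) hc hψ hv)
    (bdd_lotteryUtility (P := P) hc hψ hv)
  rw [extVal, dif_pos h]
  exact h.choose_spec

theorem Represents.extRel (h : Represents P D R φ ψ c) :
    Represents P (boundedRV W S) (extRel P φ ψ c) φ ψ c :=
  ⟨h.utility_continuous, h.utility_strictMono, h.distortion_continuous, h.distortion_strictMono,
    h.distortion_zero, h.distortion_one, h.penalty_grounded, h.penalty_convex, h.penalty_lsc,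
    _, (isValue_extVal h.distortion h.utility_continuous h.penalty_grounded h.penalty_lsc).1,
    fun _ _ _ _ => Iff.rfl⟩

theorem Represents.extRel_iff (h : Represents P (finiteRV W S) R φ ψ c) {v u : W × S → ℝ}
    (hv : v ∈ finiteRV W S) (hu : u ∈ finiteRV W S) : RDV.extRel P φ ψ c v u ↔ R v u := by
  obtain ⟨V, hV⟩ := h.exists_isValue
  have hE := isValue_extVal (P := P) h.distortion h.utility_continuous h.penalty_grounded
    h.penalty_lsc
  have e : ∀ v ∈ finiteRV W S, extVal P φ ψ c v = V v := fun v hv =>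
    EReal.coe_eq_coe_iff.1 ((hE.isLeast v (finiteRV_subset_boundedRV hv)).unique
      (hV.isLeast v hv))
  rw [RDV.extRel, e v hv, e u hu, hV.rel_iff v hv u hu]

/-- A preference on bounded random variables that satisfies the axioms is determined by its
restriction to the finite-valued ones. -/
theorem Represents.extension_unique (hP : HasUniform P)
    (h : Represents P (finiteRV W S) R φ ψ c) {R'' : (W × S → ℝ) → (W × S → ℝ) → Prop}
    (hR : ∀ v ∈ finiteRV W S, ∀ u ∈ finiteRV W S, (R'' v u ↔ R v u))
    (hA : SatisfiesAxioms P (boundedRV W S) R'') {v u : W × S → ℝ} (hv : v ∈ boundedRV W S)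
    (hu : u ∈ boundedRV W S) : R'' v u ↔ RDV.extRel P φ ψ c v u := by
  have hψ := h.distortion
  have hc := h.utility_continuous
  have hm := h.utility_strictMono
  have hg := h.penalty_grounded
  have hE := isValue_extVal (P := P) hψ hc hg h.penalty_lsc
  have hcopy := exists_copy_boundedRV hP
  have hsm := fun m => sure_mem_finiteRV (W := W) (S := S) m
  have hsb := fun m => finiteRV_subset_boundedRV (hsm m)
  have hEs := hE.sure hψ hg finiteRV_subset_boundedRV
  -- It is enough that certainty equivalents for `R''` have the utility given by the formula. They
  -- are squeezed between two finite-valued variables, where `R''` is known, whose values differ by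
  -- at most `ε`.
  have key : ∀ v ∈ boundedRV W S, ∀ m, IsCE R'' v m → extVal P φ ψ c v = φ m := by
    intro v hv m hvm
    refine eq_of_abs_sub_le_all fun ε hε => ?_
    have hb : Bdd v := hv.2
    obtain ⟨a, b, hab, hI⟩ := hb.exists_Icc
    have huc := isCompact_Icc (a := a - 1) (b := b + 1) |>.uniformContinuousOn_of_continuous
      hc.continuousOn
    obtain ⟨δ, hδ, hδε⟩ := Metric.uniformContinuousOn_iff.1 huc ε hε
    -- `d < δ` makes the utilities of `v₁` and `v₁ + d` differ by less than `ε`, and `d ≤ 1` keeps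
    -- both in `[a - 1, b + 1]`.
    set d := min (δ / 2) 1 with hd
    have hd0 : 0 < d := lt_min (by positivity) one_pos
    set v₁ : W × S → ℝ := fun x => d * (⌊v x / d⌋ : ℝ) with hv₁
    have hm₁ : Measurable v₁ := by have := hv.1; fun_prop
    have f1 : v₁ ∈ finiteRV W S := ⟨hm₁, finite_range_floor hb d⟩
    have f2 : (fun x => v₁ x + d) ∈ finiteRV W S :=
      comp_mem_finiteRV f1 (φ := fun y => y + d) (by fun_prop)
    have b1 := finiteRV_subset_boundedRV f1
    have b2 := finiteRV_subset_boundedRV f2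
    have l1 : ∀ x, v₁ x ≤ v x := fun x => floor_mul_le hd0 _
    have l2 : ∀ x, v x ≤ v₁ x + d := fun x => (lt_floor_mul_add hd0 _).le
    have trans := hA.weakOrder.2
    have r1 : R'' (sure m) v₁ :=
      trans _ (hsb m) v hv v₁ b1 hvm.1 (hA.of_le hcopy hv b1 l1)
    have r2 : R'' (fun x => v₁ x + d) (sure m) :=
      trans _ b2 v hv _ (hsb m) (hA.of_le hcopy b2 hv l2) hvm.2
    rw [hR _ (hsm m) _ f1, ← h.extRel_iff (hsm m) f1, RDV.extRel, hEs] at r1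
    rw [hR _ f2 _ (hsm m), ← h.extRel_iff f2 (hsm m), RDV.extRel, hEs] at r2
    have s1 := hE.mono hψ hc Subset.rfl b1 hv (lotteryUtility_mono hc hm hψ b1 hv · l1)
    have s2 := hE.mono hψ hc Subset.rfl hv b2 (lotteryUtility_mono hc hm hψ hv b2 · l2)
    have s3 := hE.le_add hψ hc Subset.rfl b2 b1 (k := ε) fun w => by
      have hb1 : Bdd fun s => φ (v₁ (w, s)) := bdd_section (comp_mem_boundedRV b1 hc) w
      have hb2 : Bdd fun s => φ (v₁ (w, s) + d) := bdd_section (comp_mem_boundedRV b2 hc) w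
      have h3 := rankIntegral_mono hψ (P w) hb2 (hb1.add (Bdd.const ε)) fun s => by
        have i1 := l1 (w, s)
        have i2 := l2 (w, s)
        have i3 := hI (w, s)
        have i4 : d ≤ 1 := min_le_right _ _
        have i5 : d ≤ δ / 2 := min_le_left _ _
        have := hδε (v₁ (w, s) + d) ⟨by linarith [i3.1], by linarith [i3.2]⟩ (v₁ (w, s))
          ⟨by linarith [i3.1], by linarith [i3.2]⟩ (by
            rw [Real.dist_eq, add_sub_cancel_left, abs_of_pos hd0]; linarith)
        rw [Real.dist_eq] at this
        linarith [le_abs_self (φ (v₁ (w, s) + d) - φ (v₁ (w, s)))]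
      rwa [rankIntegral_add_const hψ (P w) hb1] at h3
    rw [abs_le]
    constructor <;> linarith
  obtain ⟨m, hvm⟩ := hA.exists_isCE finiteRV_subset_boundedRV Subset.rfl hcopy hv
  obtain ⟨t, hut⟩ := hA.exists_isCE finiteRV_subset_boundedRV Subset.rfl hcopy hu
  rw [RDV.extRel, key v hv m hvm, key u hu t hut, hm.le_iff_le,
    ← hA.sure_sure finiteRV_subset_boundedRV (m := m) (t := t)]
  have trans := hA.weakOrder.2
  exact ⟨fun h1 => trans _ (hsb m) u hu _ (hsb t) (trans _ (hsb m) v hv u hu hvm.1 h1) hut.2,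
    fun h1 => trans v hv _ (hsb m) u hu hvm.2 (trans _ (hsb m) _ (hsb t) u hu h1 hut.1)⟩

end Axioms

/-! ### Binary means

The certainty equivalent `m p t x` of a bet that pays `t` with probability `p` and `x` otherwise. -/

/-- Continuous, strictly monotone means of two amounts with a weight, such that better bets remain
better when they are mixed, outcome by outcome, with a bet that dominates or is dominated. -/
structure BinaryMean (m : ℝ → ℝ → ℝ → ℝ) : Prop where
  cont : ContinuousOn (fun z : ℝ × ℝ × ℝ => m z.1 z.2.1 z.2.2) (Icc 0 1 ×ˢ univ)
  zero : ∀ t x, m 0 t x = x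
  one : ∀ t x, m 1 t x = t
  self : ∀ p ∈ Icc (0 : ℝ) 1, ∀ x, m p x x = x
  lt_left : ∀ p ∈ Ioc (0 : ℝ) 1, ∀ {t t'} x, t < t' → m p t x < m p t' x
  lt_right : ∀ p ∈ Ico (0 : ℝ) 1, ∀ t {x x'}, x < x' → m p t x < m p t x'
  lt_weight : ∀ p ∈ Icc (0 : ℝ) 1, ∀ q ∈ Icc (0 : ℝ) 1, ∀ {t x}, x < t → p < q →
    m p t x < m q t x
  indep_low : ∀ a ∈ Ioo (0 : ℝ) 1, ∀ b ∈ Icc (0 : ℝ) 1, ∀ {x x' x'' y y' y''}, y ≤ x → y' ≤ x' →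
    y'' ≤ x'' → x'' ≤ x → x'' ≤ x' → y'' ≤ y → y'' ≤ y' → m a x' y' ≤ m a x y →
    m a (m b x' x'') (m b y' y'') ≤ m a (m b x x'') (m b y y'')
  indep_high : ∀ a ∈ Ioo (0 : ℝ) 1, ∀ b ∈ Icc (0 : ℝ) 1, ∀ {x x' x'' y y' y''}, y ≤ x → y' ≤ x' →
    y'' ≤ x'' → x ≤ x'' → x' ≤ x'' → y ≤ y'' → y' ≤ y'' → m a x' y' ≤ m a x y →
    m a (m b x'' x') (m b y'' y') ≤ m a (m b x'' x) (m b y'' y)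

namespace BinaryMean
variable {m : ℝ → ℝ → ℝ → ℝ} (hm : BinaryMean m)
include hm

theorem continuousOn_weight (t x : ℝ) : ContinuousOn (fun p => m p t x) (Icc 0 1) :=
  hm.cont.comp (f := fun p : ℝ => (p, t, x)) (by fun_prop) fun _ hp => ⟨hp, mem_univ _⟩

theorem continuous_pair {p : ℝ} (hp : p ∈ Icc (0 : ℝ) 1) :
    Continuous fun z : ℝ × ℝ => m p z.1 z.2 :=
  hm.cont.comp_continuous (f := fun z : ℝ × ℝ => (p, z.1, z.2)) (by fun_prop)
    fun _ => ⟨hp, mem_univ _⟩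

theorem continuous_left {p : ℝ} (hp : p ∈ Icc (0 : ℝ) 1) (x : ℝ) : Continuous fun t => m p t x :=
  (hm.continuous_pair hp).comp (f := fun t : ℝ => (t, x)) (by fun_prop)

theorem continuous_right {p : ℝ} (hp : p ∈ Icc (0 : ℝ) 1) (t : ℝ) : Continuous fun x => m p t x :=
  (hm.continuous_pair hp).comp (f := fun x : ℝ => (t, x)) (by fun_prop)

theorem le_left {p : ℝ} (hp : p ∈ Icc (0 : ℝ) 1) {t t' : ℝ} (x : ℝ) (h : t ≤ t') :
    m p t x ≤ m p t' x := by
  rcases hp.1.eq_or_lt with rfl | h0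
  · rw [hm.zero, hm.zero]
  · rcases h.eq_or_lt with rfl | h
    · exact le_rfl
    · exact (hm.lt_left p ⟨h0, hp.2⟩ x h).le

theorem le_right {p : ℝ} (hp : p ∈ Icc (0 : ℝ) 1) (t : ℝ) {x x' : ℝ} (h : x ≤ x') :
    m p t x ≤ m p t x' := by
  rcases hp.2.eq_or_lt with rfl | h0
  · rw [hm.one, hm.one]
  · rcases h.eq_or_lt with rfl | h
    · exact le_rfl
    · exact (hm.lt_right p ⟨hp.1, h0⟩ t h).le

theorem mono {p : ℝ} (hp : p ∈ Icc (0 : ℝ) 1) {t t' x x' : ℝ} (h : t ≤ t') (h' : x ≤ x') :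
    m p t x ≤ m p t' x' := (hm.le_left hp x h).trans (hm.le_right hp t' h')

theorem mem_Icc {p : ℝ} (hp : p ∈ Icc (0 : ℝ) 1) {t x : ℝ} (h : x ≤ t) : m p t x ∈ Icc x t :=
  ⟨(hm.self p hp x).symm.trans_le (hm.le_left hp x h),
    (hm.le_right hp t h).trans_eq (hm.self p hp t)⟩

theorem left_injective {p : ℝ} (hp : p ∈ Ioc (0 : ℝ) 1) {t t' x : ℝ} (h : m p t x = m p t' x) :
    t = t' := by
  rcases lt_trichotomy t t' with h1 | h1 | h1
  · exact absurd h (hm.lt_left p hp x h1).ne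
  · exact h1
  · exact absurd h (hm.lt_left p hp x h1).ne'

theorem right_injective {p : ℝ} (hp : p ∈ Ico (0 : ℝ) 1) {t x x' : ℝ} (h : m p t x = m p t x') :
    x = x' := by
  rcases lt_trichotomy x x' with h1 | h1 | h1
  · exact absurd h (hm.lt_right p hp t h1).ne
  · exact h1
  · exact absurd h (hm.lt_right p hp t h1).ne'

theorem le_weight_iff {p q : ℝ} (hp : p ∈ Icc (0 : ℝ) 1) (hq : q ∈ Icc (0 : ℝ) 1) {t x : ℝ}
    (h : x < t) : m p t x ≤ m q t x ↔ p ≤ q := by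
  refine ⟨fun h1 => ?_, fun h1 => ?_⟩
  · by_contra hcon
    exact absurd h1 (not_le.2 (hm.lt_weight q hq p hp h (not_le.1 hcon)))
  · rcases h1.eq_or_lt with rfl | h1
    · exact le_rfl
    · exact (hm.lt_weight p hp q hq h h1).le

theorem weight_injective {p q : ℝ} (hp : p ∈ Icc (0 : ℝ) 1) (hq : q ∈ Icc (0 : ℝ) 1) {t x : ℝ}
    (h : x < t) (h1 : m p t x = m q t x) : p = q :=
  le_antisymm ((hm.le_weight_iff hp hq h).1 h1.le) ((hm.le_weight_iff hq hp h).1 h1.ge)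

theorem le_weight {p q : ℝ} (hp : p ∈ Icc (0 : ℝ) 1) (hq : q ∈ Icc (0 : ℝ) 1) {t x : ℝ}
    (h : x ≤ t) (hpq : p ≤ q) : m p t x ≤ m q t x := by
  rcases h.eq_or_lt with rfl | h
  · rw [hm.self p hp, hm.self q hq]
  · exact (hm.le_weight_iff hp hq h).2 hpq

theorem exists_weight {t x y : ℝ} (h1 : x ≤ y) (h2 : y ≤ t) :
    ∃ p ∈ Icc (0 : ℝ) 1, m p t x = y := by
  have := intermediate_value_Icc zero_le_one (hm.continuousOn_weight t x)
  rw [hm.zero, hm.one] at this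
  exact this ⟨h1, h2⟩

/-- Bisymmetry. -/
theorem bisymm {a b : ℝ} (ha : a ∈ Ioo (0 : ℝ) 1) (hb : b ∈ Icc (0 : ℝ) 1) {x y x'' y'' : ℝ}
    (hxy : y ≤ x) (hxy'' : y'' ≤ x'') (hx : x'' ≤ x) (hy : y'' ≤ y) :
    m a (m b x x'') (m b y y'') = m b (m a x y) (m a x'' y'') := by
  have haI := Ioo_subset_Icc_self ha
  have ha1 : a ∈ Ioc (0 : ℝ) 1 := ⟨ha.1, ha.2.le⟩
  have ha2 : a ∈ Ico (0 : ℝ) 1 := ⟨ha.1.le, ha.2⟩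
  set z := m a x y with hz
  set z'' := m a x'' y'' with hz''
  have hzz : z'' ≤ z := hm.mono haI hx hy
  -- If the two bets have equal value, strict monotonicity makes them identical and nothing is
  -- mixed.
  rcases hzz.eq_or_lt with heq | hlt
  · have h1 : x'' = x := by
      by_contra hne
      exact absurd heq ((hm.lt_left a ha1 y'' (lt_of_le_of_ne hx hne)).trans_le
        (hm.le_right haI x hy)).ne
    have h2 : y'' = y := by
      by_contra hne
      exact absurd heq ((hm.lt_right a ha2 x'' (lt_of_le_of_ne hy hne)).trans_le
        (hm.le_left haI y hx)).ne
    rw [h1, h2, hm.self b hb, hm.self b hb, heq, hm.self b hb]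
  have hzI := hm.mem_Icc haI hxy
  -- The bet `(x, y)` is slid along its indifference curve `(s, η s)` to the sure amount `(z, z)`,
  -- where the claim is evident. At each `s` it is mixed with a low bet of value `z''`, obtained by
  -- lowering both outcomes by the same `ε s`; `G s` is the value of this mixture.
  have hex : ∀ s ∈ Icc z x, ∃ η ∈ Icc y s, m a s η = z := fun s hs => by
    refine intermediate_value_Icc (hzI.1.trans hs.1) (hm.continuous_right haI s).continuousOn
      ⟨hm.le_left haI y hs.2, ?_⟩
    rw [hm.self a haI]
    exact hs.1
  choose! η hη hηz using hex
  have hex2 : ∀ s ∈ Icc z x, ∃ ε, 0 < ε ∧ m a (s - ε) (η s - ε) = z'' := fun s hs => by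
    have h0 : 0 ≤ s - z'' := by linarith [hs.1]
    have hcont : Continuous fun ε : ℝ => m a (s - ε) (η s - ε) :=
      (hm.continuous_pair haI).comp (f := fun ε : ℝ => (s - ε, η s - ε)) (by fun_prop)
    have hlow : m a (s - (s - z'')) (η s - (s - z'')) ≤ z'' := by
      have h2 := (hm.mem_Icc haI (show η s - (s - z'') ≤ s - (s - z'') by
        linarith [(hη s hs).2])).2
      linarith
    obtain ⟨ε, hε, hεz⟩ := intermediate_value_Icc' h0 hcont.continuousOn
      ⟨hlow, show z'' ≤ m a (s - 0) (η s - 0) by rw [sub_zero, sub_zero, hηz s hs]; exact hlt.le⟩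
    refine ⟨ε, hε.1.lt_of_ne ?_, hεz⟩
    rintro rfl
    simp only [sub_zero, hηz s hs] at hεz
    exact hlt.ne' hεz
  choose! ε hε hεz using hex2
  set G : ℝ → ℝ := fun s => m a (m b s (s - ε s)) (m b (η s) (η s - ε s)) with hG
  -- With the high bet fixed, dominated low bets of equal value are interchangeable (`indep_high` in
  -- both directions).
  have claimA : ∀ s ∈ Icc z x, ∀ x₁ y₁, y₁ ≤ x₁ → x₁ ≤ s → y₁ ≤ η s → m a x₁ y₁ = z'' →
      m a (m b s x₁) (m b (η s) y₁) = G s := by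
    intro s hs x₁ y₁ h1 h2 h3 h4
    have e1 : s - ε s ≤ s := by linarith [hε s hs]
    have e2 : η s - ε s ≤ η s := by linarith [hε s hs]
    have e3 : η s - ε s ≤ s - ε s := by linarith [(hη s hs).2]
    exact le_antisymm
      (hm.indep_high a ha b hb e3 h1 (hη s hs).2 e1 h2 e2 h3 (h4.trans (hεz s hs).symm).le)
      (hm.indep_high a ha b hb h1 e3 (hη s hs).2 h2 e1 h3 e2 (h4.trans (hεz s hs).symm).ge)
  -- With the low bet fixed, two points of the indifference curve are interchangeable if both
  -- dominate it (`indep_low`).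
  have claimB : ∀ s ∈ Icc z x, ∀ s' ∈ Icc z x, s - ε s ≤ s' → η s - ε s ≤ η s' → G s' = G s := by
    intro s hs s' hs' h1 h2
    have e1 : s - ε s ≤ s := by linarith [hε s hs]
    have e2 : η s - ε s ≤ η s := by linarith [hε s hs]
    have e3 : η s - ε s ≤ s - ε s := by linarith [(hη s hs).2]
    rw [← claimA s' hs' _ _ e3 h1 h2 (hεz s hs)]
    have e4 : m a s (η s) = m a s' (η s') := (hηz s hs).trans (hηz s' hs').symm
    exact le_antisymm
      (hm.indep_low a ha b hb (hη s hs).2 (hη s' hs').2 e3 e1 h1 e2 h2 e4.ge)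
      (hm.indep_low a ha b hb (hη s' hs').2 (hη s hs).2 e3 h1 e1 h2 e2 e4.le)
  -- Since `ε s > 0`, the low bet of `s` is still dominated by `(s', η s')` for `s'` near `s`. So
  -- `G` is locally constant on an interval, and its values at `x` and `z` agree.
  have hloc : IsLocallyConstant fun s : Icc z x => G s := by
    rw [IsLocallyConstant.iff_eventually_eq]
    intro s
    have h1 : ∀ᶠ s' : Icc z x in 𝓝 s, (s : ℝ) - ε s < s' :=
      (continuous_subtype_val.tendsto s).eventually_const_lt (by linarith [hε s s.2])
    have h2 : ∀ᶠ s' : Icc z x in 𝓝 s, m a s' (η s - ε s) < z := by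
      refine (((hm.continuous_left haI (η s - ε s)).comp continuous_subtype_val).tendsto s
        ).eventually_lt_const ?_
      refine lt_of_lt_of_eq (hm.lt_right a ha2 s ?_) (hηz s s.2)
      linarith [hε s s.2]
    filter_upwards [h1, h2] with s' h1 h2
    refine claimB s s.2 s' s'.2 h1.le ?_
    by_contra hcon
    have := hm.lt_right a ha2 s' (not_le.1 hcon)
    rw [hηz s' s'.2] at this
    linarith
  have hxI : x ∈ Icc z x := ⟨hzI.2, le_rfl⟩
  have hzI' : z ∈ Icc z x := ⟨le_rfl, hzI.2⟩
  have hpre : PreconnectedSpace (Icc z x) := Subtype.preconnectedSpace isPreconnected_Icc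
  have hconst : G x = G z := hloc.apply_eq_of_preconnectedSpace ⟨x, hxI⟩ ⟨z, hzI'⟩
  have hηx : η x = y := hm.right_injective ha2 ((hηz x hxI).trans hz)
  have hηz' : η z = z := hm.right_injective ha2 ((hηz z hzI').trans (hm.self a haI z).symm)
  have hεz' : z - ε z = z'' := by
    have := hεz z hzI'
    rwa [hηz', hm.self a haI] at this
  have h1 := claimA x hxI x'' y'' hxy'' hx (by rw [hηx]; exact hy) rfl
  rw [hηx] at h1
  rw [h1, hconst, hG]
  simp only [hηz', hεz', hm.self a haI]

/-- Bisymmetry for bets whose second outcome is `x₀` throughout. Lowering towards a fixed amount is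
thus a homomorphism for all the means. -/
theorem left_hom {a b : ℝ} (ha : a ∈ Icc (0 : ℝ) 1) (hb : b ∈ Icc (0 : ℝ) 1) {t x x₀ : ℝ}
    (h1 : x ≤ t) (h0 : x₀ ≤ x) :
    m a (m b t x) x₀ = m b (m a t x₀) (m a x x₀) := by
  rcases ha.1.eq_or_lt with rfl | ha0
  · simp only [hm.zero, hm.self b hb]
  rcases ha.2.eq_or_lt with rfl | ha1
  · simp only [hm.one]
  have := hm.bisymm ⟨ha0, ha1⟩ hb (h0.trans h1) h0 h1 (le_refl x₀)
  rwa [hm.self b hb] at this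

theorem right_hom {a b : ℝ} (ha : a ∈ Icc (0 : ℝ) 1) (hb : b ∈ Icc (0 : ℝ) 1) {t x t₀ : ℝ}
    (h1 : x ≤ t) (h0 : t ≤ t₀) :
    m a t₀ (m b t x) = m b (m a t₀ t) (m a t₀ x) := by
  rcases ha.1.eq_or_lt with rfl | ha0
  · simp only [hm.zero]
  rcases ha.2.eq_or_lt with rfl | ha1
  · simp only [hm.one, hm.self b hb]
  have := hm.bisymm ⟨ha0, ha1⟩ hb h0 (h1.trans h0) (le_refl t₀) h1
  rwa [hm.self b hb] at this

/-- A lowering map carries `[x₀, t₀]` onto `[x₀, t]` and a raising map carries this onto `[x, t]`;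
both commute with all means, so identities between weights are carried along. -/
theorem law_of_subinterval {r p q s : ℝ} (hr : r ∈ Icc (0 : ℝ) 1) (hp : p ∈ Icc (0 : ℝ) 1)
    (hq : q ∈ Icc (0 : ℝ) 1) (hs : s ∈ Icc (0 : ℝ) 1) (hqp : q ≤ p) {t₀ x₀ t x : ℝ}
    (h1 : x₀ ≤ x) (h2 : x ≤ t) (h3 : t ≤ t₀)
    (h : m r (m p t₀ x₀) (m q t₀ x₀) = m s t₀ x₀) :
    m r (m p t x) (m q t x) = m s t x := by
  have h0 : x₀ ≤ t₀ := h1.trans (h2.trans h3)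
  have step1 : m r (m p t x₀) (m q t x₀) = m s t x₀ := by
    obtain ⟨a, ha, rfl⟩ := hm.exists_weight (h1.trans h2) h3
    have e : ∀ b ∈ Icc (0 : ℝ) 1, m b (m a t₀ x₀) x₀ = m a (m b t₀ x₀) x₀ := fun b hb => by
      rw [hm.left_hom ha hb h0 le_rfl, hm.self a ha]
    rw [e p hp, e q hq, e s hs, ← hm.left_hom ha hr (hm.le_weight hq hp h0 hqp)
      (hm.mem_Icc hq h0).1, h]
  obtain ⟨a, ha, rfl⟩ := hm.exists_weight h1 h2
  have h0' : x₀ ≤ t := h1.trans h2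
  have e : ∀ b ∈ Icc (0 : ℝ) 1, m b t (m a t x₀) = m a t (m b t x₀) := fun b hb => by
    rw [hm.right_hom ha hb h0' le_rfl, hm.self a ha]
  rw [e p hp, e q hq, e s hs, ← hm.right_hom ha hr (hm.le_weight hq hp h0' hqp)
    (hm.mem_Icc hp h0').2, step1]

/-- Compound weights do not depend on the amounts. -/
theorem exists_law {r p q : ℝ} (hr : r ∈ Icc (0 : ℝ) 1) (hp : p ∈ Icc (0 : ℝ) 1)
    (hq : q ∈ Icc (0 : ℝ) 1) (hqp : q ≤ p) :
    ∃ s ∈ Icc q p, ∀ {t x : ℝ}, x ≤ t → m r (m p t x) (m q t x) = m s t x := by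
  have hex : ∀ {t x : ℝ}, x ≤ t → ∃ s ∈ Icc (0 : ℝ) 1, m r (m p t x) (m q t x) = m s t x := by
    intro t x h
    have h1 := hm.mem_Icc hr (hm.le_weight hq hp h hqp)
    obtain ⟨s, hs, e⟩ := hm.exists_weight ((hm.mem_Icc hq h).1.trans h1.1)
      (h1.2.trans (hm.mem_Icc hp h).2)
    exact ⟨s, hs, e.symm⟩
  obtain ⟨s, hs, e⟩ := hex (zero_le_one (α := ℝ))
  have h1 := hm.mem_Icc hr (hm.le_weight hq hp zero_le_one hqp)
  rw [e, Set.mem_Icc, hm.le_weight_iff hq hs zero_lt_one, hm.le_weight_iff hs hp zero_lt_one] at h1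
  refine ⟨s, h1, fun {t x} h => ?_⟩
  -- An interval containing both `[0, 1]` and `[x, t]` has some weight; restricting it to `[0, 1]`
  -- shows that this weight is `s`.
  obtain ⟨s', hs', e'⟩ := hex (t := max t 1) (x := min x 0)
    ((min_le_right _ _).trans (zero_le_one.trans (le_max_right _ _)))
  have e1 := hm.law_of_subinterval hr hp hq hs' hqp (min_le_right x 0) zero_le_one
    (le_max_right t 1) e'
  have e2 := hm.law_of_subinterval hr hp hq hs' hqp (min_le_left x 0) h (le_max_left t 1) e'
  rwa [hm.weight_injective hs hs' zero_lt_one (e.symm.trans e1)]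

/-- The weight of the preference average is the same for all amounts. -/
theorem exists_midpoint_weight {a : ℝ} (ha : a ∈ Ioo (0 : ℝ) 1) : ∃ μ ∈ Ioo (0 : ℝ) 1,
    ∀ {t x : ℝ}, x ≤ t → m a t x = m a (m a t (m μ t x)) (m a (m μ t x) x) := by
  have haI := Ioo_subset_Icc_self ha
  have ha1 : a ∈ Ioc (0 : ℝ) 1 := ⟨ha.1, ha.2.le⟩
  have ha2 : a ∈ Ico (0 : ℝ) 1 := ⟨ha.1.le, ha.2⟩
  have h01 := zero_lt_one (α := ℝ)
  have h0I : (0 : ℝ) ∈ Icc (0 : ℝ) 1 := ⟨le_rfl, zero_le_one⟩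
  have h1I : (1 : ℝ) ∈ Icc (0 : ℝ) 1 := ⟨zero_le_one, le_rfl⟩
  have hlow : m a 1 0 < 1 := by
    have := hm.lt_weight a haI 1 h1I h01 ha.2
    rwa [hm.one] at this
  have hhigh : 0 < m a 1 0 := by
    have := hm.lt_weight 0 h0I a haI h01 ha.1
    rwa [hm.zero] at this
  have hcont : ContinuousOn
      (fun q => m a (m a 1 (m q 1 0)) (m a (m q 1 0) 0)) (Icc 0 1) := by
    refine (hm.continuous_pair haI).comp_continuousOn (f := fun q =>
      (m a 1 (m q 1 0), m a (m q 1 0) 0)) (ContinuousOn.prodMk ?_ ?_)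
    · exact (hm.continuous_right haI 1).comp_continuousOn (hm.continuousOn_weight 1 0)
    · exact (hm.continuous_left haI 0).comp_continuousOn (hm.continuousOn_weight 1 0)
  have h3 : m a (m a 1 0) 0 < m a 1 0 := hm.lt_left a ha1 0 hlow
  have h4 : m a 1 0 < m a 1 (m a 1 0) := hm.lt_right a ha2 1 hhigh
  obtain ⟨μ, hμ, e⟩ := intermediate_value_Icc zero_le_one hcont (show m a 1 0 ∈ Icc _ _ by
    simp only [hm.zero, hm.one, hm.self a haI]
    exact ⟨h3.le, h4.le⟩)
  simp only at e
  have hμ' : μ ∈ Ioo (0 : ℝ) 1 := by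
    refine ⟨hμ.1.lt_of_ne ?_, hμ.2.lt_of_ne ?_⟩
    · rintro rfl
      simp only [hm.zero, hm.self a haI] at e
      exact h3.ne e
    · rintro rfl
      simp only [hm.one, hm.self a haI] at e
      exact h4.ne' e
  refine ⟨μ, hμ', fun {t x} hxt => ?_⟩
  -- The threefold compound has one weight `s₃` for all amounts, and between `0` and `1` that weight
  -- is `a` by the choice of `μ`.
  obtain ⟨s₁, hs₁, e₁⟩ := hm.exists_law haI h1I hμ hμ.2
  obtain ⟨s₂, hs₂, e₂⟩ := hm.exists_law haI hμ h0I hμ.1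
  simp only [hm.one] at e₁
  simp only [hm.zero] at e₂
  have hs₁I : s₁ ∈ Icc (0 : ℝ) 1 := ⟨hμ.1.trans hs₁.1, hs₁.2⟩
  have hs₂I : s₂ ∈ Icc (0 : ℝ) 1 := ⟨hs₂.1, hs₂.2.trans hμ.2⟩
  obtain ⟨s₃, hs₃, e₃⟩ := hm.exists_law haI hs₁I hs₂I (hs₂.2.trans hs₁.1)
  have hs₃I : s₃ ∈ Icc (0 : ℝ) 1 := ⟨hs₂I.1.trans hs₃.1, hs₃.2.trans hs₁I.2⟩
  rw [e₁ zero_le_one, e₂ zero_le_one, e₃ zero_le_one] at e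
  rw [e₁ hxt, e₂ hxt, e₃ hxt, hm.weight_injective hs₃I haI h01 e]

end BinaryMean

/-- Binary means for which the addition of a constant, doubling the average with weight `μ`,
commutes with taking means. -/
structure TranslatableMean (m : ℝ → ℝ → ℝ → ℝ) (μ : ℝ) : Prop extends BinaryMean m where
  weight_mem : μ ∈ Ioo (0 : ℝ) 1
  translate : ∀ {p}, p ∈ Icc (0 : ℝ) 1 → ∀ {t x c t' x' k' : ℝ}, 0 ≤ x → x ≤ t → 0 ≤ c →
    0 ≤ t' → 0 ≤ x' → 0 ≤ k' → m μ t' 0 = m μ (max t c) (min t c) →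
    m μ x' 0 = m μ (max x c) (min x c) →
    m μ k' 0 = m μ (max (m p t x) c) (min (m p t x) c) → m p t' x' = k'

/-! ### Addition of amounts and the dyadic grid -/

namespace TranslatableMean

/-- The sum of two amounts, the double of their average. -/
def plus (m : ℝ → ℝ → ℝ → ℝ) (μ t c : ℝ) : ℝ :=
  Function.invFunOn (fun z => m μ z 0) (Icc 0 1) (m μ (max t c) (min t c))

/-- The amount that results from `1` by taking the average with `0` repeatedly. -/
def unit (m : ℝ → ℝ → ℝ → ℝ) (μ : ℝ) (n : ℕ) : ℝ := (fun t => m μ t 0)^[n + 2] 1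

/-- Multiples of `unit m μ n`. -/
def grid (m : ℝ → ℝ → ℝ → ℝ) (μ : ℝ) (n k : ℕ) : ℝ := (fun t => plus m μ t (unit m μ n))^[k] 0

theorem plus_comm (m : ℝ → ℝ → ℝ → ℝ) (μ t c : ℝ) : plus m μ t c = plus m μ c t := by
  rw [plus, plus, max_comm, min_comm]

theorem grid_zero (m : ℝ → ℝ → ℝ → ℝ) (μ : ℝ) (n : ℕ) : grid m μ n 0 = 0 := rfl

theorem grid_succ (m : ℝ → ℝ → ℝ → ℝ) (μ : ℝ) (n k : ℕ) :
    grid m μ n (k + 1) = plus m μ (grid m μ n k) (unit m μ n) :=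
  Function.iterate_succ_apply' _ _ _

theorem unit_succ (m : ℝ → ℝ → ℝ → ℝ) (μ : ℝ) (n : ℕ) :
    unit m μ (n + 1) = m μ (unit m μ n) 0 :=
  Function.iterate_succ_apply' _ _ _

variable {m : ℝ → ℝ → ℝ → ℝ} {μ : ℝ} (hm : TranslatableMean m μ)
include hm

theorem mem : μ ∈ Icc (0 : ℝ) 1 := Ioo_subset_Icc_self hm.weight_mem

theorem half_nonneg {t : ℝ} (h : 0 ≤ t) : 0 ≤ m μ t 0 := (hm.mem_Icc hm.mem h).1

theorem half_le {t : ℝ} (h : 0 ≤ t) : m μ t 0 ≤ t := (hm.mem_Icc hm.mem h).2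

theorem half_lt {t : ℝ} (h : 0 < t) : m μ t 0 < t := by
  have := hm.lt_right μ ⟨hm.weight_mem.1.le, hm.weight_mem.2⟩ t h
  rwa [hm.self μ hm.mem] at this

theorem half_pos {t : ℝ} (h : 0 < t) : 0 < m μ t 0 := by
  have := hm.lt_left μ ⟨hm.weight_mem.1, hm.weight_mem.2.le⟩ 0 h
  rwa [hm.self μ hm.mem] at this

theorem half_injective {t t' : ℝ} (h : m μ t 0 = m μ t' 0) : t = t' :=
  hm.left_injective ⟨hm.weight_mem.1, hm.weight_mem.2.le⟩ h

theorem half_one_le_one : m μ 1 0 ≤ 1 := hm.half_le zero_le_one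

theorem average_mem {t c : ℝ} (ht : t ∈ Icc 0 (m μ 1 0)) (hc : c ∈ Icc 0 (m μ 1 0)) :
    m μ (max t c) (min t c) ∈ Icc 0 (m μ 1 0) := by
  have := hm.mem_Icc hm.mem (min_le_max (a := t) (b := c))
  exact ⟨(le_min ht.1 hc.1).trans this.1, this.2.trans (max_le ht.2 hc.2)⟩

/-- Both summands are at most the half of `1`, hence so is their average, and its double exists in
`[0, 1]`. Outside this domain `plus` carries no information. -/
theorem plus_spec {t c : ℝ} (ht : t ∈ Icc 0 (m μ 1 0)) (hc : c ∈ Icc 0 (m μ 1 0)) :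
    plus m μ t c ∈ Icc (0 : ℝ) 1 ∧ m μ (plus m μ t c) 0 = m μ (max t c) (min t c) := by
  have h := intermediate_value_Icc zero_le_one (hm.continuous_left hm.mem 0).continuousOn
  rw [hm.self μ hm.mem] at h
  have h' := h (hm.average_mem ht hc)
  exact ⟨Function.invFunOn_mem h', Function.invFunOn_eq h'⟩

theorem plus_eq {t c z : ℝ} (ht : t ∈ Icc 0 (m μ 1 0)) (hc : c ∈ Icc 0 (m μ 1 0))
    (h : m μ z 0 = m μ (max t c) (min t c)) : plus m μ t c = z :=
  hm.half_injective ((hm.plus_spec ht hc).2.trans h.symm)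

theorem zero_mem : (0 : ℝ) ∈ Icc 0 (m μ 1 0) := ⟨le_rfl, hm.half_nonneg zero_le_one⟩

theorem half_mem {t : ℝ} (ht : t ∈ Icc (0 : ℝ) 1) : m μ t 0 ∈ Icc 0 (m μ 1 0) :=
  ⟨hm.half_nonneg ht.1, hm.le_left hm.mem 0 ht.2⟩

theorem plus_zero {t : ℝ} (ht : t ∈ Icc 0 (m μ 1 0)) : plus m μ t 0 = t :=
  hm.plus_eq ht hm.zero_mem (by rw [max_eq_left ht.1, min_eq_right ht.1])

theorem average_lt {t t' : ℝ} (c : ℝ) (h : t < t') :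
    m μ (max t c) (min t c) < m μ (max t' c) (min t' c) := by
  rcases lt_or_ge t c with h1 | h1
  · have : min t c < min t' c := by
      rw [min_eq_left h1.le]
      exact lt_min h h1
    exact (hm.lt_right μ ⟨hm.weight_mem.1.le, hm.weight_mem.2⟩ _ this).trans_le
      (hm.le_left hm.mem _ (max_le_max h.le le_rfl))
  · have : max t c < max t' c := by
      rw [max_eq_left h1]
      exact lt_max_of_lt_left h
    exact (hm.lt_left μ ⟨hm.weight_mem.1, hm.weight_mem.2.le⟩ _ this).trans_le
      (hm.le_right hm.mem _ (min_le_min h.le le_rfl))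

theorem plus_lt {t t' c : ℝ} (ht : t ∈ Icc 0 (m μ 1 0)) (ht' : t' ∈ Icc 0 (m μ 1 0))
    (hc : c ∈ Icc 0 (m μ 1 0)) (h : t < t') : plus m μ t c < plus m μ t' c := by
  have h1 := hm.average_lt c h
  rw [← (hm.plus_spec ht hc).2, ← (hm.plus_spec ht' hc).2] at h1
  by_contra hcon
  exact absurd h1 (not_lt.2 (hm.le_left hm.mem 0 (not_lt.1 hcon)))

theorem plus_le {t t' c : ℝ} (ht : t ∈ Icc 0 (m μ 1 0)) (ht' : t' ∈ Icc 0 (m μ 1 0))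
    (hc : c ∈ Icc 0 (m μ 1 0)) (h : t ≤ t') : plus m μ t c ≤ plus m μ t' c := by
  rcases h.eq_or_lt with rfl | h
  · exact le_rfl
  · exact (hm.plus_lt ht ht' hc h).le

theorem plus_mean {p t x c : ℝ} (hp : p ∈ Icc (0 : ℝ) 1) (hx : x ∈ Icc 0 (m μ 1 0))
    (ht : t ∈ Icc 0 (m μ 1 0)) (hc : c ∈ Icc 0 (m μ 1 0)) (hxt : x ≤ t) :
    plus m μ (m p t x) c = m p (plus m μ t c) (plus m μ x c) := by
  have hk := hm.mem_Icc hp hxt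
  have hk' : m p t x ∈ Icc 0 (m μ 1 0) := ⟨hx.1.trans hk.1, hk.2.trans ht.2⟩
  exact (hm.translate hp hx.1 hxt hc.1 (hm.plus_spec ht hc).1.1 (hm.plus_spec hx hc).1.1
    (hm.plus_spec hk' hc).1.1 (hm.plus_spec ht hc).2 (hm.plus_spec hx hc).2
    (hm.plus_spec hk' hc).2).symm

theorem half_plus {t c : ℝ} (ht : t ∈ Icc 0 (m μ 1 0)) (hc : c ∈ Icc 0 (m μ 1 0)) :
    m μ (plus m μ t c) 0 = plus m μ (m μ t 0) (m μ c 0) := by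
  have key : ∀ {t c : ℝ}, t ∈ Icc 0 (m μ 1 0) → c ∈ Icc 0 (m μ 1 0) → c ≤ t →
      m μ (plus m μ t c) 0 = plus m μ (m μ t 0) (m μ c 0) := by
    intro t c ht hc h
    have hh := hm.half_one_le_one
    symm
    refine hm.plus_eq (hm.half_mem ⟨ht.1, ht.2.trans hh⟩) (hm.half_mem ⟨hc.1, hc.2.trans hh⟩) ?_
    have h2 := hm.le_left hm.mem 0 h
    rw [(hm.plus_spec ht hc).2, max_eq_left h, min_eq_right h, max_eq_left h2, min_eq_right h2,
      hm.left_hom hm.mem hm.mem h hc.1]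
  rcases le_total c t with h | h
  · exact key ht hc h
  · rw [plus_comm, key hc ht h, plus_comm]

theorem plus_half_half {t : ℝ} (ht : t ∈ Icc (0 : ℝ) 1) : plus m μ (m μ t 0) (m μ t 0) = t :=
  hm.plus_eq (hm.half_mem ht) (hm.half_mem ht) (by rw [max_self, min_self, hm.self μ hm.mem])

theorem unit_pos (n : ℕ) : 0 < unit m μ n := by
  induction n with
  | zero => exact hm.half_pos (hm.half_pos one_pos)
  | succ n ih => rw [unit_succ]; exact hm.half_pos ih

theorem unit_succ_lt (n : ℕ) : unit m μ (n + 1) < unit m μ n := by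
  rw [unit_succ]; exact hm.half_lt (hm.unit_pos n)

theorem unit_antitone : Antitone (unit m μ) :=
  antitone_nat_of_succ_le fun n => (hm.unit_succ_lt n).le

theorem unit_zero_le : unit m μ 0 ≤ m μ 1 0 := hm.half_le (hm.half_nonneg zero_le_one)

theorem unit_le (n : ℕ) : unit m μ n ≤ unit m μ 0 := hm.unit_antitone (Nat.zero_le n)

theorem unit_mem (n : ℕ) : unit m μ n ∈ Icc 0 (m μ 1 0) :=
  ⟨(hm.unit_pos n).le, (hm.unit_le n).trans hm.unit_zero_le⟩

theorem mem_of_mem {t : ℝ} (ht : t ∈ Icc 0 (unit m μ 0)) : t ∈ Icc 0 (m μ 1 0) :=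
  ⟨ht.1, ht.2.trans hm.unit_zero_le⟩

theorem plus_unit_self (n : ℕ) : plus m μ (unit m μ (n + 1)) (unit m μ (n + 1)) = unit m μ n := by
  rw [unit_succ]
  exact hm.plus_half_half ⟨(hm.unit_mem n).1, (hm.unit_mem n).2.trans hm.half_one_le_one⟩

/-- The limit of the decreasing sequence is a fixed point of halving, and `0` is the only
nonnegative one. -/
theorem tendsto_unit : Tendsto (unit m μ) atTop (𝓝 0) := by
  have h := tendsto_atTop_ciInf hm.unit_antitone ⟨0, by rintro _ ⟨n, rfl⟩; exact (hm.unit_pos n).le⟩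
  set L := ⨅ n, unit m μ n
  have h1 : Tendsto (fun n => unit m μ (n + 1)) atTop (𝓝 (m μ L 0)) := by
    simp only [unit_succ]
    exact ((hm.continuous_left hm.mem 0).tendsto L).comp h
  have h2 : m μ L 0 = L := tendsto_nhds_unique h1 (h.comp (tendsto_add_atTop_nat 1))
  have h3 : 0 ≤ L := ge_of_tendsto' h fun n => (hm.unit_pos n).le
  rcases h3.eq_or_lt with h3 | h3
  · rwa [← h3] at h
  · exact absurd h2 (hm.half_lt h3).ne

/-- `unit m μ 0` is the half of the half of `1`; this is why `unit` starts with two halvings. Its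
double is the half of `1`, the largest amount admitted by `plus_spec`, so a further unit may still
be added. -/
theorem plus_mem {t : ℝ} (ht : t ∈ Icc 0 (unit m μ 0)) (n : ℕ) :
    plus m μ t (unit m μ n) ∈ Icc 0 (m μ 1 0) := by
  refine ⟨(hm.plus_spec (hm.mem_of_mem ht) (hm.unit_mem n)).1.1, ?_⟩
  have h0 := hm.unit_mem 0
  calc plus m μ t (unit m μ n) ≤ plus m μ (unit m μ 0) (unit m μ n) :=
        hm.plus_le (hm.mem_of_mem ht) h0 (hm.unit_mem n) ht.2
    _ = plus m μ (unit m μ n) (unit m μ 0) := plus_comm ..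
    _ ≤ plus m μ (unit m μ 0) (unit m μ 0) := hm.plus_le (hm.unit_mem n) h0 h0 (hm.unit_le n)
    _ = m μ 1 0 := hm.plus_half_half
        (t := m μ 1 0) ⟨hm.half_nonneg zero_le_one, hm.half_one_le_one⟩

theorem lt_plus {t : ℝ} (ht : t ∈ Icc 0 (m μ 1 0)) (n : ℕ) : t < plus m μ t (unit m μ n) := by
  have := hm.plus_lt hm.zero_mem (hm.unit_mem n) ht (hm.unit_pos n)
  rwa [plus_comm, hm.plus_zero ht, plus_comm] at this

/-- Adding a unit is the same as adding two half units. -/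
theorem plus_plus_unit {t : ℝ} (ht : t ∈ Icc 0 (unit m μ 0)) (n : ℕ) :
    plus m μ (plus m μ t (unit m μ (n + 1))) (unit m μ (n + 1)) = plus m μ t (unit m μ n) := by
  set e := unit m μ n with he
  set e' := unit m μ (n + 1) with he'
  have heI := hm.unit_mem n
  have heI' := hm.unit_mem (n + 1)
  have h0 : (0 : ℝ) ∈ Icc 0 (unit m μ 0) := ⟨le_rfl, (hm.unit_pos 0).le⟩
  have hen : e' ∈ Icc 0 (unit m μ 0) := ⟨heI'.1, hm.unit_le _⟩
  -- No associativity is at hand. Instead, `f` and `g` both commute with means between an amount and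
  -- `0`, and they agree at `0` and `e'`. If `t ≤ e'` then `t` is such a mean of `e'`; otherwise
  -- `e'` is one of `t` and the mean is cancelled.
  set f := fun t => plus m μ (plus m μ t e') e'
  set g := fun t => plus m μ t e
  have hf : ∀ p ∈ Icc (0 : ℝ) 1, ∀ x ∈ Icc 0 (unit m μ 0), f (m p x 0) = m p (f x) (f 0) := by
    intro p hp x hx
    simp only [f]
    rw [hm.plus_mean hp hm.zero_mem (hm.mem_of_mem hx) heI' hx.1, hm.plus_mean hp
      (hm.plus_mem h0 _) (hm.plus_mem hx _) heI' (hm.plus_le hm.zero_mem (hm.mem_of_mem hx) heI' hx.1)]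
  have hg : ∀ p ∈ Icc (0 : ℝ) 1, ∀ x ∈ Icc 0 (unit m μ 0), g (m p x 0) = m p (g x) (g 0) := by
    intro p hp x hx
    exact hm.plus_mean hp hm.zero_mem (hm.mem_of_mem hx) heI hx.1
  have e1 : plus m μ 0 e' = e' := by rw [plus_comm, hm.plus_zero heI']
  have hfg0 : f 0 = g 0 := by
    simp only [f, g]
    rw [e1, plus_comm m μ 0 e, hm.plus_zero heI]
    exact hm.plus_unit_self n
  have hfg1 : f e' = g e' := by
    simp only [f, g]
    rw [hm.plus_unit_self n, plus_comm]
  change f t = g t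
  rcases le_total t e' with h | h
  · obtain ⟨p, hp, rfl⟩ := hm.exists_weight ht.1 h
    rw [hf p hp e' hen, hg p hp e' hen, hfg0, hfg1]
  · obtain ⟨p, hp, hpe⟩ := hm.exists_weight heI'.1 h
    replace hpe : m p t 0 = e' := hpe
    have hp0 : 0 < p := by
      refine hp.1.lt_of_ne ?_
      rintro rfl
      rw [hm.zero] at hpe
      exact (hm.unit_pos (n + 1)).ne hpe
    have := hf p hp t ht
    rw [hpe, hfg1, ← hpe, hg p hp t ht, ← hfg0] at this
    exact (hm.left_injective ⟨hp0, hp.2⟩ this).symm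

/-- The even points of level `n + 1` are the points of level `n`, which needs that level to stay in
the domain of `plus`. Conversely an odd point is bounded by the next even one, so the domain
condition passes to level `n + 1`. -/
theorem grid_aux (n : ℕ) : (∀ k ≤ 2 ^ n, grid m μ n k ∈ Icc 0 (unit m μ 0)) ∧
    ∀ k ≤ 2 ^ n, grid m μ (n + 1) (2 * k) = grid m μ n k := by
  have key : ∀ n, (∀ k ≤ 2 ^ n, grid m μ n k ∈ Icc 0 (unit m μ 0)) →
      ∀ k ≤ 2 ^ n, grid m μ (n + 1) (2 * k) = grid m μ n k := by
    intro n hn k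
    induction k with
    | zero => intro; simp [grid_zero]
    | succ k ih =>
      intro hk
      rw [show 2 * (k + 1) = 2 * k + 1 + 1 by ring, grid_succ, grid_succ, ih (by omega),
        hm.plus_plus_unit (hn k (by omega)), grid_succ]
  have h : ∀ k ≤ 2 ^ n, grid m μ n k ∈ Icc 0 (unit m μ 0) := by
    induction n with
    | zero =>
      intro k hk
      have h0 : (0 : ℝ) ∈ Icc 0 (unit m μ 0) := ⟨le_rfl, (hm.unit_pos 0).le⟩
      obtain rfl | rfl : k = 0 ∨ k = 1 := by rw [pow_zero] at hk; omega
      · exact h0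
      · rw [← zero_add 1, grid_succ, grid_zero, plus_comm, hm.plus_zero (hm.unit_mem 0)]
        exact ⟨(hm.unit_pos 0).le, le_rfl⟩
    | succ n ih =>
      intro k hk
      rw [pow_succ] at hk
      obtain ⟨j, rfl | rfl⟩ : ∃ j, k = 2 * j ∨ k = 2 * j + 1 := ⟨k / 2, by omega⟩
      · rw [key n ih j (by omega)]
        exact ih j (by omega)
      · rw [grid_succ, key n ih j (by omega)]
        have hj := ih j (by omega)
        have hj1 := ih (j + 1) (by omega)
        rw [grid_succ] at hj1
        refine ⟨(hm.plus_mem hj _).1, le_trans ?_ hj1.2⟩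
        rw [plus_comm, plus_comm m μ (grid m μ n j)]
        exact hm.plus_le (hm.unit_mem _) (hm.unit_mem _) (hm.mem_of_mem hj) (hm.unit_succ_lt n).le
  exact ⟨h, key n h⟩

theorem grid_mem {n k : ℕ} (hk : k ≤ 2 ^ n) : grid m μ n k ∈ Icc 0 (unit m μ 0) :=
  (hm.grid_aux n).1 k hk

theorem grid_refine (n j : ℕ) {k : ℕ} (hk : k ≤ 2 ^ n) :
    grid m μ (n + j) (2 ^ j * k) = grid m μ n k := by
  induction j with
  | zero => simp
  | succ j ih =>
    rw [show 2 ^ (j + 1) * k = 2 * (2 ^ j * k) by ring, ← add_assoc, (hm.grid_aux (n + j)).2 _ ?_, ih]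
    rw [pow_add, mul_comm]
    exact Nat.mul_le_mul_right _ hk

theorem grid_top (n : ℕ) : grid m μ n (2 ^ n) = unit m μ 0 := by
  have := hm.grid_refine 0 n (k := 1) (by simp)
  rw [zero_add, mul_one] at this
  rw [this, ← zero_add 1, grid_succ, grid_zero, plus_comm, hm.plus_zero (hm.unit_mem 0)]

theorem grid_lt {n k l : ℕ} (hkl : k < l) (hl : l ≤ 2 ^ n) : grid m μ n k < grid m μ n l := by
  induction l with
  | zero => omega
  | succ l ih =>
    have h1 : grid m μ n l < grid m μ n (l + 1) := by
      rw [grid_succ]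
      exact hm.lt_plus (hm.mem_of_mem (hm.grid_mem (by omega))) n
    rcases (Nat.lt_succ_iff.1 hkl).eq_or_lt with rfl | h
    · exact h1
    · exact (ih h (by omega)).trans h1

theorem grid_le_iff {n k l : ℕ} (hk : k ≤ 2 ^ n) (hl : l ≤ 2 ^ n) :
    grid m μ n k ≤ grid m μ n l ↔ k ≤ l := by
  refine ⟨fun h => ?_, fun h => ?_⟩
  · by_contra hcon
    exact absurd h (not_le.2 (hm.grid_lt (not_le.1 hcon) hk))
  · rcases h.eq_or_lt with rfl | h
    · exact le_rfl
    · exact (hm.grid_lt h hl).le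

theorem grid_le_grid_iff {n k n' k' : ℕ} (hk : k ≤ 2 ^ n) (hk' : k' ≤ 2 ^ n') :
    grid m μ n k ≤ grid m μ n' k' ↔ (k : ℝ) / 2 ^ n ≤ k' / 2 ^ n' := by
  rw [← hm.grid_refine n n' hk, ← hm.grid_refine n' n hk', add_comm n' n, hm.grid_le_iff,
    div_le_div_iff₀ (by positivity) (by positivity), mul_comm, mul_comm (2 ^ n)]
  · exact_mod_cast Iff.rfl
  · rw [pow_add, mul_comm]; exact Nat.mul_le_mul_right _ hk
  · rw [pow_add]; exact Nat.mul_le_mul_left _ hk'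

theorem half_grid (n : ℕ) {k : ℕ} (hk : k ≤ 2 ^ n) : m μ (grid m μ n k) 0 = grid m μ (n + 1) k := by
  induction k with
  | zero => rw [grid_zero, grid_zero, hm.self μ hm.mem]
  | succ k ih =>
    rw [grid_succ, hm.half_plus (hm.mem_of_mem (hm.grid_mem (by omega))) (hm.unit_mem n),
      ih (by omega), grid_succ, unit_succ]

/-- Induction on `l`: adding a unit to both points adds it to the average, and a unit is two units
of the next level. -/
theorem average_grid (n : ℕ) {j l : ℕ} (h : j + l ≤ 2 ^ n) :
    m μ (grid m μ n (j + l)) (grid m μ n l) = grid m μ (n + 1) (j + 2 * l) := by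
  induction l with
  | zero => exact hm.half_grid n h
  | succ l ih =>
    have h1 := hm.grid_mem (show j + l ≤ 2 ^ n by omega)
    have h2 := hm.grid_mem (show l ≤ 2 ^ n by omega)
    have h3 : grid m μ n l ≤ grid m μ n (j + l) :=
      (hm.grid_le_iff (by omega) (by omega)).2 (by omega)
    rw [← add_assoc, grid_succ, grid_succ, ← hm.plus_mean hm.mem (hm.mem_of_mem h2)
      (hm.mem_of_mem h1) (hm.unit_mem n) h3, ih (by omega),
      show j + 2 * (l + 1) = j + 2 * l + 1 + 1 by ring, grid_succ, grid_succ, hm.plus_plus_unit]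
    exact hm.grid_mem (by rw [pow_succ]; omega)

/-- Only at the top of the interval can the upper bound fail to be strict; the strict form is what
density needs. -/
theorem exists_grid_bracket {y : ℝ} (hy : y ∈ Icc 0 (unit m μ 0)) (n : ℕ) :
    ∃ k, k + 1 ≤ 2 ^ n ∧ grid m μ n k ≤ y ∧ y ≤ grid m μ n (k + 1) ∧
      (y < unit m μ 0 → y < grid m μ n (k + 1)) := by
  classical
  rcases hy.2.eq_or_lt with rfl | h
  · have h1 : 1 ≤ 2 ^ n := Nat.one_le_two_pow
    refine ⟨2 ^ n - 1, by omega, ?_, ?_, fun h => absurd h (lt_irrefl _)⟩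
    · exact (hm.grid_mem (by omega)).2
    · rw [show 2 ^ n - 1 + 1 = 2 ^ n by omega, hm.grid_top]
  · have hex : ∃ k, y < grid m μ n k := ⟨2 ^ n, by rwa [hm.grid_top]⟩
    have h1 := Nat.find_spec hex
    have h0 : Nat.find hex ≠ 0 := by
      intro h0
      rw [h0, grid_zero] at h1
      exact absurd h1 (not_lt.2 hy.1)
    obtain ⟨k, hk⟩ := Nat.exists_eq_succ_of_ne_zero h0
    rw [hk] at h1
    have h2 : Nat.find hex ≤ 2 ^ n := Nat.find_min' hex (by rwa [hm.grid_top])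
    exact ⟨k, by omega, not_lt.1 (Nat.find_min hex (by omega)), h1.le, fun _ => h1⟩

/-- Adding a small unit to `y` keeps it below `y'`, because halves depend continuously on the unit.
The next grid point above `y` is at most `y` plus a unit. -/
theorem exists_grid_between {y y' : ℝ} (hy : y ∈ Icc 0 (unit m μ 0)) (hy' : y' ∈ Icc 0 (unit m μ 0))
    (h : y < y') : ∃ n k, k ≤ 2 ^ n ∧ y < grid m μ n k ∧ grid m μ n k < y' := by
  have hcont : Continuous fun e => m μ (max y e) (min y e) :=
    (hm.continuous_pair hm.mem).comp (f := fun e => (max y e, min y e)) (by fun_prop)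
  have h1 : m μ (max y 0) (min y 0) < m μ y' 0 := by
    rw [max_eq_left hy.1, min_eq_right hy.1]
    exact hm.lt_left μ ⟨hm.weight_mem.1, hm.weight_mem.2.le⟩ 0 h
  obtain ⟨n, hn⟩ := (((hcont.tendsto 0).comp hm.tendsto_unit).eventually_lt_const h1).exists
  obtain ⟨k, hk, hk1, -, hk2⟩ := hm.exists_grid_bracket hy n
  refine ⟨n, k + 1, hk, hk2 (h.trans_le hy'.2), ?_⟩
  rw [grid_succ]
  refine (hm.plus_le (hm.mem_of_mem (hm.grid_mem (by omega))) (hm.mem_of_mem hy) (hm.unit_mem n)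
    hk1).trans_lt ?_
  have h2 : m μ (plus m μ y (unit m μ n)) 0 < m μ y' 0 := by
    rw [(hm.plus_spec (hm.mem_of_mem hy) (hm.unit_mem n)).2]
    exact hn
  by_contra hcon
  exact absurd h2 (not_lt.2 (hm.le_left hm.mem 0 (not_lt.1 hcon)))

end TranslatableMean

/-! ### The scale, the distortion and the utility function of a translatable mean -/

namespace TranslatableMean

/-- The position of an amount in the grid. -/
def scale (m : ℝ → ℝ → ℝ → ℝ) (μ y : ℝ) : ℝ :=
  sSup {a : ℝ | ∃ n k : ℕ, k ≤ 2 ^ n ∧ grid m μ n k ≤ y ∧ a = k / 2 ^ n}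

variable {m : ℝ → ℝ → ℝ → ℝ} {μ : ℝ} (hm : TranslatableMean m μ)
include hm

omit hm in
theorem grid_weight_le_one {n k : ℕ} (hk : k ≤ 2 ^ n) : (k : ℝ) / 2 ^ n ≤ 1 := by
  rw [div_le_one (by positivity)]
  exact_mod_cast hk

omit hm in
theorem bddAbove_scale (m : ℝ → ℝ → ℝ → ℝ) (μ y : ℝ) :
    BddAbove {a : ℝ | ∃ n k : ℕ, k ≤ 2 ^ n ∧ grid m μ n k ≤ y ∧ a = k / 2 ^ n} := by
  refine ⟨1, ?_⟩
  rintro _ ⟨n, k, hk, -, rfl⟩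
  exact grid_weight_le_one hk

omit hm in
theorem scale_mono {y y' : ℝ} (hy : 0 ≤ y) (h : y ≤ y') : scale m μ y ≤ scale m μ y' := by
  refine csSup_le_csSup (bddAbove_scale m μ y') ⟨_, 0, 0, by simp, hy, rfl⟩ ?_
  rintro _ ⟨n, k, hk, hk', rfl⟩
  exact ⟨n, k, hk, hk'.trans h, rfl⟩

theorem scale_grid {n k : ℕ} (hk : k ≤ 2 ^ n) : scale m μ (grid m μ n k) = k / 2 ^ n := by
  refine IsGreatest.csSup_eq ⟨⟨n, k, hk, le_rfl, rfl⟩, ?_⟩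
  rintro _ ⟨n', k', hk', h, rfl⟩
  exact (hm.grid_le_grid_iff hk' hk).1 h

theorem scale_zero : scale m μ 0 = 0 := by
  have := hm.scale_grid (n := 0) (k := 0) (by simp)
  simpa [grid_zero] using this

theorem scale_unit : scale m μ (unit m μ 0) = 1 := by
  have := hm.scale_grid (n := 0) (k := 2 ^ 0) le_rfl
  rw [hm.grid_top] at this
  simpa using this

theorem scale_mem {y : ℝ} (hy : y ∈ Icc 0 (unit m μ 0)) : scale m μ y ∈ Icc (0 : ℝ) 1 :=
  ⟨hm.scale_zero.symm.trans_le (scale_mono le_rfl hy.1),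
    (scale_mono hy.1 hy.2).trans_eq hm.scale_unit⟩

theorem strictMonoOn_scale : StrictMonoOn (scale m μ) (Icc 0 (unit m μ 0)) := by
  intro y hy y' hy' h
  obtain ⟨n, k, hk, h1, h2⟩ := hm.exists_grid_between hy hy' h
  obtain ⟨n', k', hk', h1', h2'⟩ := hm.exists_grid_between (hm.grid_mem hk) hy' h2
  refine (scale_mono hy.1 h1.le).trans_lt (lt_of_lt_of_le ?_ (scale_mono (hm.grid_mem hk').1 h2'.le))
  rw [hm.scale_grid hk, hm.scale_grid hk']
  by_contra hcon
  exact absurd h1' (not_lt.2 ((hm.grid_le_grid_iff hk' hk).2 (not_lt.1 hcon)))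

/-- On the grid this is `average_grid`. In general both amounts are bracketed at level `n`, which
leaves an error of at most `(1 / 2) ^ n`. -/
theorem scale_average {x y : ℝ} (hx : x ∈ Icc 0 (unit m μ 0)) (hy : y ∈ Icc 0 (unit m μ 0))
    (h : y ≤ x) : scale m μ (m μ x y) = (scale m μ x + scale m μ y) / 2 := by
  rcases h.eq_or_lt with rfl | h
  · rw [hm.self μ hm.mem]; ring
  have key : ∀ n : ℕ, |scale m μ (m μ x y) - (scale m μ x + scale m μ y) / 2| ≤ (1 / 2) ^ n := by
    intro n
    obtain ⟨k, hk, hk1, hk2, -⟩ := hm.exists_grid_bracket hx n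
    obtain ⟨l, hl, hl1, hl2, -⟩ := hm.exists_grid_bracket hy n
    have hlk : l ≤ k := by
      by_contra hcon
      have h4 : grid m μ n (k + 1) ≤ grid m μ n l := (hm.grid_le_iff hk (by omega)).2 (by omega)
      linarith
    obtain ⟨j, rfl⟩ := Nat.exists_eq_add_of_le' hlk
    have a1 := hm.average_grid n (show j + l ≤ 2 ^ n by omega)
    have a2 := hm.average_grid n (show j + (l + 1) ≤ 2 ^ n by omega)
    rw [add_assoc] at hk2
    have b1 := hm.mono hm.mem hk1 hl1
    have b2 := hm.mono hm.mem hk2 hl2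
    rw [a1] at b1
    rw [a2] at b2
    have p1 : j + 2 * l ≤ 2 ^ (n + 1) := by rw [pow_succ]; omega
    have p2 : j + 2 * (l + 1) ≤ 2 ^ (n + 1) := by rw [pow_succ]; omega
    have hxy := (hm.grid_mem p1).1.trans b1
    have c1 := scale_mono (m := m) (μ := μ) (hm.grid_mem p1).1 b1
    have c2 := scale_mono (m := m) (μ := μ) hxy b2
    have c3 := scale_mono (m := m) (μ := μ) (hm.grid_mem (show j + l ≤ 2 ^ n by omega)).1 hk1
    have c4 := scale_mono (m := m) (μ := μ) hx.1 hk2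
    have c5 := scale_mono (m := m) (μ := μ) (hm.grid_mem (show l ≤ 2 ^ n by omega)).1 hl1
    have c6 := scale_mono (m := m) (μ := μ) hy.1 hl2
    rw [hm.scale_grid (by omega)] at c1 c2 c3 c4 c5 c6
    push_cast at c1 c2 c3 c4 c5 c6
    rw [pow_succ] at c1 c2
    have h2 : (0 : ℝ) < 2 ^ n := by positivity
    have e : (1 / 2 : ℝ) ^ n = 1 / 2 ^ n := by rw [one_div_pow]
    rw [e]
    set u : ℝ := 1 / 2 ^ n with hu
    have e1 : ∀ z : ℝ, z / 2 ^ n = z * u := fun z => by rw [hu]; ring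
    have e2 : ∀ z : ℝ, z / (2 ^ n * 2) = z * u / 2 := fun z => by rw [hu]; field_simp
    simp only [e1, e2] at c1 c2 c3 c4 c5 c6
    rw [abs_le]
    constructor <;> linarith
  have h0 := ge_of_tendsto' (tendsto_pow_atTop_nhds_zero_of_lt_one (by norm_num)
    (by norm_num : (1 / 2 : ℝ) < 1)) key
  exact sub_eq_zero.1 (abs_eq_zero.1 (le_antisymm h0 (abs_nonneg _)))

/-- The distortion of probabilities derived from a translatable mean. -/
def distort (m : ℝ → ℝ → ℝ → ℝ) (μ p : ℝ) : ℝ := scale m μ (m p (unit m μ 0) 0)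

theorem mean_unit_mem {p : ℝ} (hp : p ∈ Icc (0 : ℝ) 1) :
    m p (unit m μ 0) 0 ∈ Icc 0 (unit m μ 0) := hm.mem_Icc hp (hm.unit_pos 0).le

theorem strictMonoOn_distort : StrictMonoOn (distort m μ) (Icc 0 1) := fun _ hp _ hq h =>
  hm.strictMonoOn_scale (hm.mean_unit_mem hp) (hm.mean_unit_mem hq)
    (hm.lt_weight _ hp _ hq (hm.unit_pos 0) h)

theorem distort_zero : distort m μ 0 = 0 := by rw [distort, hm.zero, hm.scale_zero]

theorem distort_one : distort m μ 1 = 1 := by rw [distort, hm.one, hm.scale_unit]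

theorem distort_mem {p : ℝ} (hp : p ∈ Icc (0 : ℝ) 1) : distort m μ p ∈ Icc (0 : ℝ) 1 :=
  hm.scale_mem (hm.mean_unit_mem hp)

/-- A monotone function with dense range is continuous. The distortion is extended by the identity
outside `[0, 1]`, which keeps it monotone and makes the range dense in the line. -/
theorem continuousOn_distort : ContinuousOn (distort m μ) (Icc 0 1) := by
  set f : ℝ → ℝ := fun p => if p < 0 then p else if p ≤ 1 then distort m μ p else p with hf
  have f1 : ∀ p ∈ Icc (0 : ℝ) 1, f p = distort m μ p := fun p hp => by
    simp only [hf, if_neg (not_lt.2 hp.1), if_pos hp.2]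
  have f0 : ∀ p < 0, f p = p := fun p hp => by simp only [hf, if_pos hp]
  have f2 : ∀ p, 1 < p → f p = p := fun p hp => by
    simp only [hf, if_neg (not_lt.2 (zero_le_one.trans hp.le)), if_neg (not_le.2 hp)]
  have hmono : Monotone f := by
    intro p q h
    rcases lt_or_ge p 0 with hp0 | hp0
    · rw [f0 p hp0]
      rcases lt_or_ge q 0 with hq0 | hq0
      · rwa [f0 q hq0]
      · rcases le_or_gt q 1 with hq1 | hq1
        · rw [f1 q ⟨hq0, hq1⟩]
          exact hp0.le.trans (hm.distort_mem ⟨hq0, hq1⟩).1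
        · rwa [f2 q hq1]
    · have hq0 := hp0.trans h
      rcases le_or_gt q 1 with hq1 | hq1
      · have hp : p ∈ Icc (0 : ℝ) 1 := ⟨hp0, h.trans hq1⟩
        have hq : q ∈ Icc (0 : ℝ) 1 := ⟨hq0, hq1⟩
        rw [f1 p hp, f1 q hq]
        exact hm.strictMonoOn_distort.monotoneOn hp hq h
      · rw [f2 q hq1]
        rcases le_or_gt p 1 with hp1 | hp1
        · rw [f1 p ⟨hp0, hp1⟩]
          exact (hm.distort_mem ⟨hp0, hp1⟩).2.trans hq1.le
        · rwa [f2 p hp1]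
  have hdense : DenseRange f := by
    refine dense_iff_exists_between.2 fun a b hab => ?_
    rcases lt_or_ge a 0 with ha | ha
    · obtain ⟨y, hy1, hy2⟩ := exists_between (lt_min hab ha)
      exact ⟨y, ⟨y, f0 y (hy2.trans_le (min_le_right _ _))⟩, hy1, hy2.trans_le (min_le_left _ _)⟩
    rcases lt_or_ge 1 b with hb | hb
    · obtain ⟨y, hy1, hy2⟩ := exists_between (max_lt hab hb)
      exact ⟨y, ⟨y, f2 y ((le_max_right _ _).trans_lt hy1)⟩, (le_max_left _ _).trans_lt hy1, hy2⟩
    -- Dyadic numbers in the unit interval are values of the distortion, since every grid point is a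
    -- mean of `unit m μ 0` and `0`.
    obtain ⟨n, hn⟩ := exists_pow_lt_of_lt_one (sub_pos.2 hab) (by norm_num : (1 / 2 : ℝ) < 1)
    rw [one_div_pow] at hn
    have h2 : (0 : ℝ) < 2 ^ n := by positivity
    have h3 := Nat.lt_floor_add_one (a * 2 ^ n)
    have h4 := Nat.floor_le (show 0 ≤ a * 2 ^ n by positivity)
    set k := ⌊a * 2 ^ n⌋₊
    have h5 : a < ((k + 1 : ℕ) : ℝ) / 2 ^ n := by
      rw [lt_div_iff₀ h2]; push_cast; exact h3
    have h6 : ((k + 1 : ℕ) : ℝ) / 2 ^ n < b := by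
      rw [div_lt_iff₀ h2]
      push_cast
      rw [div_lt_iff₀ h2] at hn
      linarith
    have hk : k + 1 ≤ 2 ^ n := by
      have := (h6.le.trans hb)
      rw [div_le_one h2] at this
      exact_mod_cast this
    obtain ⟨p, hp, e⟩ := hm.exists_weight (hm.grid_mem hk).1 (hm.grid_mem hk).2
    exact ⟨_, ⟨p, by rw [f1 p hp, distort, e, hm.scale_grid hk]⟩, h5, h6⟩
  exact (hmono.continuous_of_denseRange hdense).continuousOn.congr fun p hp => (f1 p hp).symm

theorem exists_distort_eq {y : ℝ} (hy : y ∈ Icc (0 : ℝ) 1) :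
    ∃ p ∈ Icc (0 : ℝ) 1, distort m μ p = y := by
  have := intermediate_value_Icc zero_le_one hm.continuousOn_distort
  rw [hm.distort_zero, hm.distort_one] at this
  exact this hy

/-- The defect `D` vanishes at the weights `0` and `1`, and it is averaged whenever distorted
weights are. Halving repeatedly forces it to be zero, without any continuity. -/
theorem scale_mean {r x y : ℝ} (hr : r ∈ Icc (0 : ℝ) 1) (hx : x ∈ Icc 0 (unit m μ 0))
    (hy : y ∈ Icc 0 (unit m μ 0)) (h : y ≤ x) :
    scale m μ (m r x y) = distort m μ r * scale m μ x + (1 - distort m μ r) * scale m μ y := by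
  set ψ := distort m μ
  set D : ℝ → ℝ := fun r => scale m μ (m r x y) - (ψ r * scale m μ x + (1 - ψ r) * scale m μ y)
    with hD
  have h0I : (0 : ℝ) ∈ Icc (0 : ℝ) 1 := ⟨le_rfl, zero_le_one⟩
  have h1I : (1 : ℝ) ∈ Icc (0 : ℝ) 1 := ⟨zero_le_one, le_rfl⟩
  have hmem : ∀ r ∈ Icc (0 : ℝ) 1, m r x y ∈ Icc 0 (unit m μ 0) := fun r hr =>
    ⟨hy.1.trans (hm.mem_Icc hr h).1, (hm.mem_Icc hr h).2.trans hx.2⟩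
  have hD0 : D 0 = 0 := by simp only [hD, hm.zero, ψ, hm.distort_zero]; ring
  have hD1 : D 1 = 0 := by simp only [hD, hm.one, ψ, hm.distort_one]; ring
  -- The average of the means with weights `p` and `q` is a mean whose weight is the same for all
  -- amounts; read off at `unit m μ 0` and `0`, its distortion is the midpoint.
  have avg : ∀ p ∈ Icc (0 : ℝ) 1, ∀ q ∈ Icc (0 : ℝ) 1, q ≤ p → ∀ s ∈ Icc (0 : ℝ) 1,
      ψ s = (ψ p + ψ q) / 2 → D s = (D p + D q) / 2 := by
    intro p hp q hq hqp s hs e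
    obtain ⟨s', hs', law⟩ := hm.exists_law hm.mem hp hq hqp
    have hsI : s' ∈ Icc (0 : ℝ) 1 := ⟨hq.1.trans hs'.1, hs'.2.trans hp.2⟩
    have e1 : ψ s' = (ψ p + ψ q) / 2 := by
      simp only [ψ, distort]
      rw [← law (hm.unit_pos 0).le, hm.scale_average (hm.mean_unit_mem hp) (hm.mean_unit_mem hq)
        (hm.le_weight hq hp (hm.unit_pos 0).le hqp)]
    obtain rfl : s' = s := hm.strictMonoOn_distort.injOn hsI hs (e1.trans e.symm)
    simp only [hD]
    rw [← law h, hm.scale_average (hmem p hp) (hmem q hq) (hm.le_weight hq hp h hqp), e1]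
    ring
  -- A distorted weight is the midpoint of `0` and its double, or of `1` and its double minus `1`.
  -- One end has no defect, so each round halves the bound.
  have key : ∀ n : ℕ, ∀ r ∈ Icc (0 : ℝ) 1, |D r| ≤ 2 * (1 / 2) ^ n := by
    intro n
    induction n with
    | zero =>
      intro r hr
      have a1 := hm.scale_mem (hmem r hr)
      have a2 := hm.scale_mem hx
      have a3 := hm.scale_mem hy
      have a4 : ψ r ∈ Icc (0 : ℝ) 1 := hm.distort_mem hr
      have a5 := mul_nonneg a4.1 a2.1
      have a6 := mul_nonneg (sub_nonneg.2 a4.2) a3.1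
      have a7 := mul_le_of_le_one_right a4.1 a2.2
      have a8 := mul_le_of_le_one_right (sub_nonneg.2 a4.2) a3.2
      simp only [hD]
      rw [abs_le, pow_zero]
      constructor <;> linarith [a1.1, a1.2]
    | succ n ih =>
      intro r hr
      have hψ : ψ r ∈ Icc (0 : ℝ) 1 := hm.distort_mem hr
      rw [pow_succ]
      rcases le_total (ψ r) (1 / 2) with h1 | h1
      · obtain ⟨p, hp, e⟩ := hm.exists_distort_eq (y := 2 * ψ r) ⟨by linarith [hψ.1], by linarith⟩
        have := avg p hp 0 h0I hp.1 r hr (by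
          simp only [ψ, hm.distort_zero] at e ⊢
          linarith)
        rw [this, hD0, add_zero, abs_div, abs_two]
        linarith [ih p hp]
      · obtain ⟨p, hp, e⟩ := hm.exists_distort_eq (y := 2 * ψ r - 1)
          ⟨by linarith, by linarith [hψ.2]⟩
        have := avg 1 h1I p hp hp.2 r hr (by
          simp only [ψ, hm.distort_one] at e ⊢
          linarith)
        rw [this, hD1, zero_add, abs_div, abs_two]
        linarith [ih p hp]
  have hlim : Tendsto (fun n : ℕ => 2 * (1 / 2 : ℝ) ^ n) atTop (𝓝 (2 * 0)) :=
    (tendsto_pow_atTop_nhds_zero_of_lt_one (by norm_num) (by norm_num)).const_mul 2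
  rw [mul_zero] at hlim
  have h0 := ge_of_tendsto' hlim fun n => key n r hr
  exact sub_eq_zero.1 (abs_eq_zero.1 (le_antisymm h0 (abs_nonneg _)))

/-- Compound weights are compounded after distortion. -/
theorem exists_affine_law {r p q : ℝ} (hr : r ∈ Icc (0 : ℝ) 1) (hp : p ∈ Icc (0 : ℝ) 1)
    (hq : q ∈ Icc (0 : ℝ) 1) (hqp : q ≤ p) :
    ∃ s ∈ Icc (0 : ℝ) 1, (∀ {t x : ℝ}, x ≤ t → m r (m p t x) (m q t x) = m s t x) ∧
      distort m μ s = distort m μ r * distort m μ p + (1 - distort m μ r) * distort m μ q := by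
  obtain ⟨s, hs, law⟩ := hm.exists_law hr hp hq hqp
  refine ⟨s, ⟨hq.1.trans hs.1, hs.2.trans hp.2⟩, law, ?_⟩
  rw [distort, ← law (hm.unit_pos 0).le, hm.scale_mean hr (hm.mean_unit_mem hp)
    (hm.mean_unit_mem hq) (hm.le_weight hq hp (hm.unit_pos 0).le hqp)]
  rfl

/-- The position of `y` between `-N` and `N`. -/
def localUtility (m : ℝ → ℝ → ℝ → ℝ) (μ N y : ℝ) : ℝ :=
  distort m μ (Function.invFunOn (fun p => m p N (-N)) (Icc 0 1) y)

theorem localUtility_mean {N p : ℝ} (hN : 0 < N) (hp : p ∈ Icc (0 : ℝ) 1) :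
    localUtility m μ N (m p N (-N)) = distort m μ p := by
  have hex : ∃ q ∈ Icc (0 : ℝ) 1, (fun p => m p N (-N)) q = m p N (-N) := ⟨p, hp, rfl⟩
  rw [localUtility, hm.weight_injective (Function.invFunOn_mem hex) hp (by linarith : -N < N)
    (Function.invFunOn_eq hex)]

/-- Both amounts are means of `N` and `-N`, and compounding such means is affine in the distorted
weights. -/
theorem localUtility_affine {N r t x : ℝ} (hN : 0 < N) (hr : r ∈ Icc (0 : ℝ) 1) (h1 : -N ≤ x)
    (h2 : x ≤ t) (h3 : t ≤ N) : localUtility m μ N (m r t x) =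
      distort m μ r * localUtility m μ N t + (1 - distort m μ r) * localUtility m μ N x := by
  have hNN : -N < N := by linarith
  obtain ⟨p, hp, rfl⟩ := hm.exists_weight (h1.trans h2) h3
  obtain ⟨q, hq, rfl⟩ := hm.exists_weight h1 (h2.trans h3)
  obtain ⟨s, hs, law, e⟩ := hm.exists_affine_law hr hp hq ((hm.le_weight_iff hq hp hNN).1 h2)
  rw [law hNN.le, hm.localUtility_mean hN hp, hm.localUtility_mean hN hq,
    hm.localUtility_mean hN hs, e]

theorem localUtility_lt {N x t : ℝ} (hN : 0 < N) (h1 : -N ≤ x) (h2 : x < t) (h3 : t ≤ N) :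
    localUtility m μ N x < localUtility m μ N t := by
  have hNN : -N < N := by linarith
  obtain ⟨p, hp, rfl⟩ := hm.exists_weight (h1.trans h2.le) h3
  obtain ⟨q, hq, rfl⟩ := hm.exists_weight h1 (h2.le.trans h3)
  rw [hm.localUtility_mean hN hp, hm.localUtility_mean hN hq]
  refine hm.strictMonoOn_distort hq hp ?_
  by_contra hcon
  exact absurd h2 (not_lt.2 ((hm.le_weight_iff hp hq hNN).2 (not_lt.1 hcon)))

/-- The utility function derived from a translatable mean, normalized at `0` and `1`. -/
def utility (m : ℝ → ℝ → ℝ → ℝ) (μ y : ℝ) : ℝ :=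
  (localUtility m μ (max |y| 1) y - localUtility m μ (max |y| 1) 0) /
    (localUtility m μ (max |y| 1) 1 - localUtility m μ (max |y| 1) 0)

/-- Local utilities for different `N` are affinely related on the smaller interval, so after
normalization at `0` and `1` the choice of `N` does not matter. -/
theorem utility_eq {N y : ℝ} (hN : 1 ≤ N) (hy : |y| ≤ N) : utility m μ y =
    (localUtility m μ N y - localUtility m μ N 0) /
      (localUtility m μ N 1 - localUtility m μ N 0) := by
  rw [utility]
  set L := max |y| 1
  have hL1 : 1 ≤ L := le_max_right _ _
  have hyL := abs_le.1 (le_max_left |y| 1 : |y| ≤ L)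
  have hLN : L ≤ N := max_le hy hN
  have hL0 : 0 < L := by linarith
  have hN0 : 0 < N := by linarith
  have e : ∀ z, -L ≤ z → z ≤ L → localUtility m μ N z = localUtility m μ L z *
      localUtility m μ N L + (1 - localUtility m μ L z) * localUtility m μ N (-L) := by
    intro z h1 h2
    obtain ⟨p, hp, rfl⟩ := hm.exists_weight h1 h2
    rw [hm.localUtility_affine hN0 hp (by linarith) (by linarith) hLN, hm.localUtility_mean hL0 hp]
  rw [e y hyL.1 hyL.2, e 0 (by linarith) hL0.le, e 1 (by linarith) hL1]
  have h1 := hm.localUtility_lt hN0 (show -N ≤ -L by linarith) (show -L < L by linarith) hLN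
  have h2 := hm.localUtility_lt hL0 (show -L ≤ 0 by linarith) (zero_lt_one) hL1
  rw [div_eq_div_iff (by linarith) ?_]
  · ring
  · have : (localUtility m μ L 1 - localUtility m μ L 0) *
      (localUtility m μ N L - localUtility m μ N (-L)) ≠ 0 :=
      mul_ne_zero (by linarith) (by linarith)
    intro hcon
    apply this
    linarith

theorem utility_zero : utility m μ 0 = 0 := by
  rw [hm.utility_eq le_rfl (by simp), sub_self, zero_div]

theorem utility_mean {r t x : ℝ} (hr : r ∈ Icc (0 : ℝ) 1) (h : x ≤ t) : utility m μ (m r t x) =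
    distort m μ r * utility m μ t + (1 - distort m μ r) * utility m μ x := by
  set N := max (max |t| |x|) 1
  have hN1 : 1 ≤ N := le_max_right _ _
  have ht : |t| ≤ N := (le_max_left _ _).trans (le_max_left _ _)
  have hx : |x| ≤ N := (le_max_right _ _).trans (le_max_left _ _)
  have hN : 0 < N := by linarith
  have hr' := hm.mem_Icc hr h
  have ht' := abs_le.1 ht
  have hx' := abs_le.1 hx
  rw [hm.utility_eq hN1 ht, hm.utility_eq hN1 hx, hm.utility_eq hN1 (y := m r t x)
    (abs_le.2 ⟨hx'.1.trans hr'.1, hr'.2.trans ht'.2⟩), hm.localUtility_affine hN hr hx'.1 h ht'.2]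
  ring

theorem utility_strictMono : StrictMono (utility m μ) := by
  intro x t h
  set N := max (max |t| |x|) 1
  have hN1 : 1 ≤ N := le_max_right _ _
  have ht : |t| ≤ N := (le_max_left _ _).trans (le_max_left _ _)
  have hx : |x| ≤ N := (le_max_right _ _).trans (le_max_left _ _)
  have hN : 0 < N := by linarith
  rw [hm.utility_eq hN1 ht, hm.utility_eq hN1 hx]
  have h1 := hm.localUtility_lt hN (abs_le.1 hx).1 h (abs_le.1 ht).2
  have h2 := hm.localUtility_lt hN (show -N ≤ 0 by linarith) (zero_lt_one) hN1
  exact div_lt_div_of_pos_right (by linarith) (by linarith)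

/-- Means of `y - 1` and `y + 1` take every utility between those of the two ends, since the
distortion is onto `[0, 1]`; a strictly increasing function without gaps is continuous. -/
theorem utility_continuous : Continuous (utility m μ) := by
  refine continuous_iff_continuousAt.2 fun y => ?_
  have h1 : y - 1 < y := by linarith
  have h2 : y < y + 1 := by linarith
  refine (hm.utility_strictMono.strictMonoOn (Icc (y - 1) (y + 1))).continuousAt_of_image_mem_nhds
    (Icc_mem_nhds h1 h2) ?_
  refine mem_of_superset (Icc_mem_nhds (hm.utility_strictMono h1) (hm.utility_strictMono h2)) ?_
  intro v hv
  have hlt := hm.utility_strictMono (h1.trans h2)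
  obtain ⟨p, hp, e⟩ := hm.exists_distort_eq
    (y := (v - utility m μ (y - 1)) / (utility m μ (y + 1) - utility m μ (y - 1)))
    ⟨div_nonneg (by linarith [hv.1]) (by linarith), by
      rw [div_le_one (by linarith)]; linarith [hv.2]⟩
  refine ⟨_, hm.mem_Icc hp (h1.trans h2).le, ?_⟩
  rw [hm.utility_mean hp (h1.trans h2).le, e]
  have : utility m μ (y + 1) - utility m μ (y - 1) ≠ 0 := by linarith
  field_simp
  ring

theorem distortion : Distortion (distort m μ) where
  continuousOn := hm.continuousOn_distort
  strictMonoOn := hm.strictMonoOn_distort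
  zero := hm.distort_zero
  one := hm.distort_one

end TranslatableMean

/-! ### Bets under the axioms -/

section Bets
variable {W S : Type*} [MeasurableSpace W] [MeasurableSpace S] [Nonempty W] {P : Kernel W S}
  [IsMarkovKernel P] {R : (W × S → ℝ) → (W × S → ℝ) → Prop}

/-- A certainty equivalent of `v`, if there is one. -/
def ce (R : (W × S → ℝ) → (W × S → ℝ) → Prop) (v : W × S → ℝ) : ℝ := Classical.epsilon (IsCE R v)

variable (hP : HasUniform P) (hA : SatisfiesAxioms P (finiteRV W S) R)
include hP hA

theorem SatisfiesAxioms.isCE_ce {v : W × S → ℝ} (hv : v ∈ finiteRV W S) : IsCE R v (ce R v) :=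
  Classical.epsilon_spec
    (hA.exists_isCE Subset.rfl finiteRV_subset_boundedRV (exists_copy_finiteRV hP) hv)

theorem SatisfiesAxioms.rel_iff {v u : W × S → ℝ} (hv : v ∈ finiteRV W S)
    (hu : u ∈ finiteRV W S) : R v u ↔ ce R u ≤ ce R v := by
  have h1 := hA.isCE_ce hP hv
  have h2 := hA.isCE_ce hP hu
  have s1 := sure_mem_finiteRV (W := W) (S := S) (ce R v)
  have s2 := sure_mem_finiteRV (W := W) (S := S) (ce R u)
  have tr := hA.weakOrder.2
  rw [← hA.sure_sure Subset.rfl]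
  exact ⟨fun h => tr _ s1 _ hv _ s2 h1.1 (tr _ hv _ hu _ s2 h h2.2),
    fun h => tr _ hv _ s1 _ hu h1.2 (tr _ s1 _ s2 _ hu h h2.1)⟩

theorem SatisfiesAxioms.ce_sure (m : ℝ) : ce R (sure m : W × S → ℝ) = m := by
  have h := hA.isCE_ce hP (sure_mem_finiteRV m)
  exact le_antisymm ((hA.sure_sure Subset.rfl).1 h.2) ((hA.sure_sure Subset.rfl).1 h.1)

theorem SatisfiesAxioms.strict_iff {v u : W × S → ℝ} (hv : v ∈ finiteRV W S)
    (hu : u ∈ finiteRV W S) : Strict R v u ↔ ce R u < ce R v := by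
  rw [Strict, hA.rel_iff hP hv hu, hA.rel_iff hP hu hv, not_le]
  exact ⟨fun h => h.2, fun h => ⟨h.le, h⟩⟩

theorem SatisfiesAxioms.indiff_iff {v u : W × S → ℝ} (hv : v ∈ finiteRV W S)
    (hu : u ∈ finiteRV W S) : Indiff R v u ↔ ce R v = ce R u := by
  rw [Indiff, hA.rel_iff hP hv hu, hA.rel_iff hP hu hv, le_antisymm_iff, and_comm]

theorem SatisfiesAxioms.isCE_iff {v : W × S → ℝ} (hv : v ∈ finiteRV W S) (m : ℝ) :
    IsCE R v m ↔ ce R v = m := by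
  rw [IsCE, hA.indiff_iff hP (sure_mem_finiteRV m) hv, hA.ce_sure hP, eq_comm]

theorem SatisfiesAxioms.ce_congr {v u : W × S → ℝ} (hv : v ∈ finiteRV W S)
    (hu : u ∈ finiteRV W S) (h : ∀ w t, condCDF P v w t = condCDF P u w t) : ce R v = ce R u :=
  (hA.indiff_iff hP hv hu).1 (hA.neutrality v hv u hu h)

theorem SatisfiesAxioms.ce_bet_congr {B B' : Set (W × S)} {p : ℝ} (h : HasProb P B p)
    (h' : HasProb P B' p) (t x : ℝ) : ce R (bet t B x) = ce R (bet t B' x) :=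
  hA.ce_congr hP (bet_mem_finiteRV h.1 t x) (bet_mem_finiteRV h'.1 t x) fun w r => by
    rw [condCDF_bet h, condCDF_bet h']

theorem SatisfiesAxioms.ce_lt {v u : W × S → ℝ} (hv : v ∈ finiteRV W S)
    (hu : u ∈ finiteRV W S) (hv' : Unambiguous P v) (hu' : Unambiguous P u)
    (h : ∀ w t, condCDF P v w t ≤ condCDF P u w t)
    (h' : ∃ w t, condCDF P v w t < condCDF P u w t) : ce R u < ce R v :=
  (hA.strict_iff hP hv hu).1 ((hA.dominance v hv u hu hv' hu' h).2 h')

omit hP hA in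
omit [Nonempty W] [MeasurableSpace W] [MeasurableSpace S] in
theorem comonotonic_bet {A : Set (W × S)} {x y x' y' : ℝ} (h : y ≤ x) (h' : y' ≤ x') :
    Comonotonic (bet x A y) (bet x' A y') := by
  intro w s s'
  by_cases h1 : (w, s) ∈ A <;> by_cases h2 : (w, s') ∈ A
  · simp [bet_of_mem h1, bet_of_mem h2]
  · rw [bet_of_mem h1, bet_of_notMem h2, bet_of_mem h1, bet_of_notMem h2]
    exact mul_nonneg_of_nonpos_of_nonpos (sub_nonpos.2 h) (sub_nonpos.2 h')
  · rw [bet_of_notMem h1, bet_of_mem h2, bet_of_notMem h1, bet_of_mem h2]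
    exact mul_nonneg (sub_nonneg.2 h) (sub_nonneg.2 h')
  · simp [bet_of_notMem h1, bet_of_notMem h2]

omit hP hA in
omit [Nonempty W] [MeasurableSpace W] [MeasurableSpace S] in
theorem comonotonic_sure (v : W × S → ℝ) (m : ℝ) : Comonotonic v (sure m) := fun w s s' => by
  simp [sure]

omit hP hA in
omit [MeasurableSpace W] [MeasurableSpace S] [Nonempty W] [IsMarkovKernel P] in
-- The contribution of one atom to the distribution function. At `r = t` the indicator may
-- oscillate, which is harmless only if the mass vanishes in the limit.
theorem tendsto_ite_le {ts ps : ℕ → ℝ} {t p r : ℝ} (ht : Tendsto ts atTop (𝓝 t))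
    (hp : Tendsto ps atTop (𝓝 p)) (h0 : ∀ n, 0 ≤ ps n) (h : t = r → p = 0) :
    Tendsto (fun n => if ts n ≤ r then ps n else 0) atTop (𝓝 (if t ≤ r then p else 0)) := by
  rcases lt_trichotomy t r with h1 | h1 | h1
  · rw [if_pos h1.le]
    refine hp.congr' ?_
    filter_upwards [ht.eventually_lt_const h1] with n hn
    rw [if_pos hn.le]
  · rw [h h1, ite_self]
    rw [h h1] at hp
    refine squeeze_zero (fun n => ?_) (fun n => ?_) hp
    · split_ifs
      exacts [h0 n, le_rfl]
    · split_ifs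
      exacts [le_rfl, h0 n]
  · rw [if_neg (not_le.2 h1)]
    refine tendsto_const_nhds.congr' ?_
    filter_upwards [ht.eventually_const_lt h1] with n hn
    rw [if_neg (not_le.2 hn)]

omit hP hA in
theorem convInDist_bet {B : Set (W × S)} {p t x : ℝ} (hB : HasProb P B p)
    {Bs : ℕ → Set (W × S)} {ps ts xs : ℕ → ℝ} (hBs : ∀ n, HasProb P (Bs n) (ps n))
    (hp : Tendsto ps atTop (𝓝 p)) (ht : Tendsto ts atTop (𝓝 t)) (hx : Tendsto xs atTop (𝓝 x)) :
    ConvInDist P (fun n => bet (ts n) (Bs n) (xs n)) (bet t B x) := by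
  intro w r hr
  have hpI := hB.mem_Icc
  -- Continuity at `r` rules out a positive jump, so an outcome equal to `r` has probability zero.
  have hle : ∀ {k : ℝ}, (∀ s < r, condCDF P (bet t B x) w s ≤ condCDF P (bet t B x) w r - k) →
      k ≤ 0 := fun {k} h => by
    have h1 : Tendsto (condCDF P (bet t B x) w) (𝓝[<] r) (𝓝 (condCDF P (bet t B x) w r)) :=
      hr.tendsto.mono_left nhdsWithin_le_nhds
    have := le_of_tendsto h1 (eventually_mem_nhdsWithin.mono h)
    linarith
  simp only [condCDF_bet hB, fun n => condCDF_bet (hBs n)] at hle ⊢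
  have mono : ∀ {a s y : ℝ}, 0 ≤ a → s < r →
      (if y ≤ s then a else 0) ≤ if y ≤ r then a else 0 := fun {a s y} ha hs => by
    split_ifs with h1 h2
    exacts [le_rfl, absurd (h1.trans hs.le) h2, ha, le_rfl]
  refine (tendsto_ite_le ht hp (fun n => (hBs n).mem_Icc.1) fun h => ?_).add
    (tendsto_ite_le hx (hp.const_sub 1) (fun n => sub_nonneg.2 (hBs n).mem_Icc.2) fun h => ?_)
  · refine le_antisymm (hle fun s hs => ?_) hpI.1
    rw [if_neg (not_le.2 (h ▸ hs)), if_pos h.le]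
    linarith [mono (y := x) (sub_nonneg.2 hpI.2) hs]
  · refine le_antisymm (hle fun s hs => ?_) (sub_nonneg.2 hpI.2)
    rw [if_neg (show ¬ x ≤ s by linarith), if_pos h.le]
    linarith [mono (y := t) hpI.1 hs]

variable {E : ℝ → Set (W × S)} (hE : ∀ p ∈ Icc (0 : ℝ) 1, HasProb P (E p) p)
include hE

theorem SatisfiesAxioms.ce_bet_lt_weight {p q : ℝ} (hp : p ∈ Icc (0 : ℝ) 1)
    (hq : q ∈ Icc (0 : ℝ) 1) {t x : ℝ} (hxt : x < t) (hpq : p < q) :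
    ce R (bet t (E p) x) < ce R (bet t (E q) x) := by
  refine hA.ce_lt hP (bet_mem_finiteRV (hE q hq).1 _ _) (bet_mem_finiteRV (hE p hp).1 _ _)
    (unambiguous_bet (hE q hq) _ _) (unambiguous_bet (hE p hp) _ _) (fun w r => ?_)
    ⟨Classical.arbitrary W, x, ?_⟩
  · rw [condCDF_bet (hE q hq), condCDF_bet (hE p hp)]
    split_ifs <;> linarith
  · rw [condCDF_bet (hE q hq), condCDF_bet (hE p hp), if_neg (not_le.2 hxt), if_pos le_rfl,
      if_neg (not_le.2 hxt), if_pos le_rfl]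
    linarith

theorem SatisfiesAxioms.ce_bet_zero (t x : ℝ) : ce R (bet t (E 0) x) = x := by
  have h := hE 0 ⟨le_rfl, zero_le_one⟩
  refine Eq.trans ?_ (hA.ce_sure hP x)
  rw [← bet_self x (E 0)]
  refine hA.ce_congr hP (bet_mem_finiteRV h.1 _ _) (bet_mem_finiteRV h.1 _ _) fun w r => ?_
  simp [condCDF_bet h]

theorem SatisfiesAxioms.ce_bet_one (t x : ℝ) : ce R (bet t (E 1) x) = t := by
  have h := hE 1 ⟨zero_le_one, le_rfl⟩
  refine Eq.trans ?_ (hA.ce_sure hP t)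
  rw [← bet_self t (E 1)]
  refine hA.ce_congr hP (bet_mem_finiteRV h.1 _ _) (bet_mem_finiteRV h.1 _ _) fun w r => ?_
  simp [condCDF_bet h]

theorem SatisfiesAxioms.essential {p : ℝ} (hp : p ∈ Ioo (0 : ℝ) 1) : Essential P R (E p) := by
  have hpI := Ioo_subset_Icc_self hp
  have h0 : (0 : ℝ) ∈ Icc (0 : ℝ) 1 := ⟨le_rfl, zero_le_one⟩
  have h1 : (1 : ℝ) ∈ Icc (0 : ℝ) 1 := ⟨zero_le_one, le_rfl⟩
  have hb := bet_mem_finiteRV (hE p hpI).1 1 0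
  refine ⟨(hE p hpI).unambiguousEvent, 1, 0, zero_lt_one, ?_, ?_⟩
  · rw [hA.strict_iff hP (sure_mem_finiteRV _) hb, hA.ce_sure hP]
    have := hA.ce_bet_lt_weight hP hE hpI h1 zero_lt_one hp.2
    rwa [hA.ce_bet_one hP hE] at this
  · rw [hA.strict_iff hP hb (sure_mem_finiteRV _), hA.ce_sure hP]
    have := hA.ce_bet_lt_weight hP hE h0 hpI zero_lt_one hp.1
    rwa [hA.ce_bet_zero hP hE] at this

theorem SatisfiesAxioms.continuousOn_ce_bet :
    ContinuousOn (fun z : ℝ × ℝ × ℝ => ce R (bet z.2.1 (E z.1) z.2.2)) (Icc 0 1 ×ˢ univ) := by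
  have hbet : ∀ {z : ℝ × ℝ × ℝ}, z ∈ Icc (0 : ℝ) 1 ×ˢ (univ : Set (ℝ × ℝ)) →
      bet z.2.1 (E z.1) z.2.2 ∈ finiteRV W S := fun hz => bet_mem_finiteRV (hE _ hz.1).1 _ _
  have hs := fun m => sure_mem_finiteRV (W := W) (S := S) m
  intro z hz
  have hz0 : z.1 ∈ Icc (0 : ℝ) 1 := hz.1
  -- The axiom concerns uniformly bounded sequences. If a property failed arbitrarily near `z`, a
  -- convergent bounded sequence of counterexamples could be chosen.
  have key : ∀ p : ℝ × ℝ × ℝ → Prop,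
      (∀ zs : ℕ → ℝ × ℝ × ℝ, (∀ n, zs n ∈ Icc (0 : ℝ) 1 ×ˢ (univ : Set (ℝ × ℝ))) →
        (∃ C, ∀ n x, |bet (zs n).2.1 (E (zs n).1) (zs n).2.2 x| ≤ C) →
        ConvInDist P (fun n => bet (zs n).2.1 (E (zs n).1) (zs n).2.2)
          (bet z.2.1 (E z.1) z.2.2) → ∃ n, p (zs n)) →
      ∀ᶠ z' in 𝓝[Icc 0 1 ×ˢ univ] z, p z' := by
    intro p h
    by_contra hcon
    rw [not_eventually] at hcon
    have hball : ∀ᶠ z' in 𝓝[Icc (0 : ℝ) 1 ×ˢ (univ : Set (ℝ × ℝ))] z,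
        z' ∈ Icc (0 : ℝ) 1 ×ˢ (univ : Set (ℝ × ℝ)) ∧ ‖z'‖ ≤ ‖z‖ + 1 := by
      refine eventually_mem_nhdsWithin.and (mem_nhdsWithin_of_mem_nhds ?_)
      exact ((continuous_norm.tendsto z).eventually_lt_const (by linarith)).mono fun _ h => h.le
    obtain ⟨zs, hzs, hzs'⟩ := exists_seq_forall_of_frequently (hcon.and_eventually hball)
    have hlim : Tendsto zs atTop (𝓝 z) := hzs.mono_right nhdsWithin_le_nhds
    refine (h zs (fun n => (hzs' n).2.1) ⟨‖z‖ + 1, fun n x => ?_⟩ ?_).elim fun n => (hzs' n).1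
    · have h1 := (hzs' n).2.2
      have h2 : ‖(zs n).2‖ ≤ ‖zs n‖ := norm_snd_le _
      have h3 : ‖(zs n).2.1‖ ≤ ‖(zs n).2‖ := norm_fst_le _
      have h4 : ‖(zs n).2.2‖ ≤ ‖(zs n).2‖ := norm_snd_le _
      rw [Real.norm_eq_abs] at h3 h4
      by_cases hx : x ∈ E (zs n).1
      · rw [bet_of_mem hx]; linarith
      · rw [bet_of_notMem hx]; linarith
    · exact convInDist_bet (hE _ hz0) (fun n => hE _ (hzs' n).2.1.1)
        ((continuous_fst.tendsto z).comp hlim)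
        (((continuous_fst.comp continuous_snd).tendsto z).comp hlim)
        (((continuous_snd.comp continuous_snd).tendsto z).comp hlim)
  refine tendsto_order.2 ⟨fun a ha => key _ fun zs hzs hb hlim => ?_,
    fun a ha => key _ fun zs hzs hb hlim => ?_⟩
  · have hstr : Strict R (bet z.2.1 (E z.1) z.2.2) (sure a) := by
      rw [hA.strict_iff hP (hbet hz) (hs a), hA.ce_sure hP]
      exact ha
    obtain ⟨N, hN⟩ := hA.continuity.1 _ (hbet hz) _ (hs a) (unambiguous_bet (hE _ hz0) _ _)
      (unambiguous_sure a) hstr _ (fun _ => sure a)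
      (fun n => ⟨hbet (hzs n), unambiguous_bet (hE _ (hzs n).1) _ _⟩)
      (fun _ => ⟨hs a, unambiguous_sure a⟩) hb ⟨|a|, fun _ _ => le_rfl⟩ hlim
      fun _ _ _ => tendsto_const_nhds
    have := (hN N le_rfl).1
    rw [hA.strict_iff hP (hbet (hzs N)) (hs a), hA.ce_sure hP] at this
    exact ⟨N, this⟩
  · have hstr : Strict R (sure a) (bet z.2.1 (E z.1) z.2.2) := by
      rw [hA.strict_iff hP (hs a) (hbet hz), hA.ce_sure hP]
      exact ha
    obtain ⟨N, hN⟩ := hA.continuity.1 _ (hs a) _ (hbet hz) (unambiguous_sure a)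
      (unambiguous_bet (hE _ hz0) _ _) hstr (fun _ => sure a) _
      (fun _ => ⟨hs a, unambiguous_sure a⟩)
      (fun n => ⟨hbet (hzs n), unambiguous_bet (hE _ (hzs n).1) _ _⟩)
      ⟨|a|, fun _ _ => le_rfl⟩ hb (fun _ _ _ => tendsto_const_nhds) hlim
    have := (hN N le_rfl).2
    rw [hA.strict_iff hP (hs a) (hbet (hzs N)), hA.ce_sure hP] at this
    exact ⟨N, this⟩

theorem SatisfiesAxioms.binaryMean : BinaryMean fun p t x => ce R (bet t (E p) x) where
  cont := hA.continuousOn_ce_bet hP hE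
  zero := hA.ce_bet_zero hP hE
  one := hA.ce_bet_one hP hE
  self p _ x := by simp only [bet_self, hA.ce_sure hP]
  lt_left p hp t t' x h := by
    have hb := hE p (Ioc_subset_Icc_self hp)
    refine hA.ce_lt hP (bet_mem_finiteRV hb.1 _ _) (bet_mem_finiteRV hb.1 _ _)
      (unambiguous_bet hb _ _) (unambiguous_bet hb _ _) (fun w r => ?_)
      ⟨Classical.arbitrary W, t, ?_⟩
    · rw [condCDF_bet hb, condCDF_bet hb]
      split_ifs <;> linarith [hp.1]
    · rw [condCDF_bet hb, condCDF_bet hb, if_neg (not_le.2 h), if_pos le_rfl]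
      linarith [hp.1]
  lt_right p hp t x x' h := by
    have hb := hE p (Ico_subset_Icc_self hp)
    refine hA.ce_lt hP (bet_mem_finiteRV hb.1 _ _) (bet_mem_finiteRV hb.1 _ _)
      (unambiguous_bet hb _ _) (unambiguous_bet hb _ _) (fun w r => ?_)
      ⟨Classical.arbitrary W, x, ?_⟩
    · rw [condCDF_bet hb, condCDF_bet hb]
      split_ifs <;> linarith [hp.2]
    · rw [condCDF_bet hb, condCDF_bet hb, if_neg (not_le.2 h), if_pos (le_refl x)]
      linarith [hp.2]
  lt_weight p hp q hq t x h hpq := hA.ce_bet_lt_weight hP hE hp hq h hpq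
  indep_low a ha b hb x x' x'' y y' y'' h h' h'' h1 h2 h3 h4 hle := by
    have hAE := hE a (Ioo_subset_Icc_self ha)
    have hBE := hE b hb
    have hbm := fun t x => bet_mem_finiteRV (W := W) (S := S) hAE.1 t x
    have hBm := fun t x => bet_mem_finiteRV (W := W) (S := S) hBE.1 t x
    have hsub : ∀ x y, IsSub R (E b) (bet x (E a) y) (bet x'' (E a) y'')
        (bet (ce R (bet x (E b) x'')) (E a) (ce R (bet y (E b) y''))) := by
      intro x y z
      rw [hA.isCE_iff hP (hBm _ _)]
      by_cases hz : z ∈ E a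
      · simp only [bet_of_mem hz]
      · simp only [bet_of_notMem hz]
    have := hA.binaryIndependence (E a) (E b) (hA.essential hP hE ha) hBE.unambiguousEvent
      x x' x'' y y' y'' (comonotonic_bet h h') (comonotonic_bet h h'') (comonotonic_bet h' h'')
      (Or.inl ⟨h1, h2, h3, h4⟩) _ (hbm _ _) _ (hbm _ _) (hsub x y) (hsub x' y')
      ((hA.rel_iff hP (hbm _ _) (hbm _ _)).2 hle)
    exact (hA.rel_iff hP (hbm _ _) (hbm _ _)).1 this
  -- Now the common bet is the better one; betting on the complement of `E b` gives it the weight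
  -- `b`.
  indep_high a ha b hb x x' x'' y y' y'' h h' h'' h1 h2 h3 h4 hle := by
    have hAE := hE a (Ioo_subset_Icc_self ha)
    have hBE := hE b hb
    have hbm := fun t x => bet_mem_finiteRV (W := W) (S := S) hAE.1 t x
    have hBm := fun t x => bet_mem_finiteRV (W := W) (S := S) hBE.1 t x
    have hsub : ∀ x y, IsSub R (E b)ᶜ (bet x (E a) y) (bet x'' (E a) y'')
        (bet (ce R (bet x'' (E b) x)) (E a) (ce R (bet y'' (E b) y))) := by
      intro x y z
      rw [bet_compl, hA.isCE_iff hP (hBm _ _)]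
      by_cases hz : z ∈ E a
      · simp only [bet_of_mem hz]
      · simp only [bet_of_notMem hz]
    have := hA.binaryIndependence (E a) (E b)ᶜ (hA.essential hP hE ha)
      hBE.compl.unambiguousEvent
      x x' x'' y y' y'' (comonotonic_bet h h') (comonotonic_bet h h'') (comonotonic_bet h' h'')
      (Or.inr ⟨h1, h2, h3, h4⟩) _ (hbm _ _) _ (hbm _ _) (hsub x y) (hsub x' y')
      ((hA.rel_iff hP (hbm _ _) (hbm _ _)).2 hle)
    exact (hA.rel_iff hP (hbm _ _) (hbm _ _)).1 this

/-- Dual independence is applied in both directions to a bet and its certainty equivalent, with a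
constant as the common summand: the sums are again indifferent. An event of probability `1 / 2`
serves to define averages and doubles. -/
theorem SatisfiesAxioms.exists_translatableMean :
    ∃ μ, TranslatableMean (fun p t x => ce R (bet t (E p) x)) μ := by
  have hm := hA.binaryMean hP hE
  have ha : (1 / 2 : ℝ) ∈ Ioo (0 : ℝ) 1 := by norm_num
  have haE := hE _ (Ioo_subset_Icc_self ha)
  have hess := hA.essential hP hE ha
  obtain ⟨μ, hμ, law⟩ := hm.exists_midpoint_weight ha
  have hμI := Ioo_subset_Icc_self hμ
  refine ⟨μ, hm, hμ, ?_⟩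
  intro p hp t x c t' x' k' hx hxt hc ht' hx' hk' e1 e2 e3
  have hs := fun m => sure_mem_finiteRV (W := W) (S := S) m
  have hbm := fun t x => bet_mem_finiteRV (W := W) (S := S) haE.1 t x
  -- The choice of `μ` makes the mean with weight `μ` a preference average, for all amounts at once.
  have avg : ∀ {t x : ℝ}, x ≤ t →
      OrderedPrefAverage R (E (1 / 2)) t x (ce R (bet t (E μ) x)) := by
    intro t x h
    have hI := hm.mem_Icc hμI h
    refine ⟨(hA.sure_sure Subset.rfl).2 h, (hA.sure_sure Subset.rfl).2 hI.2,
      (hA.sure_sure Subset.rfl).2 hI.1, t, x, _, _, ?_, ?_, (hA.isCE_iff hP (hbm _ _) _).2 rfl,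
      (hA.isCE_iff hP (hbm _ _) _).2 rfl, ?_, ?_⟩
    · rw [hA.isCE_iff hP (hbm _ _), bet_self, hA.ce_sure hP]
    · rw [hA.isCE_iff hP (hbm _ _), bet_self, hA.ce_sure hP]
    · exact (hA.indiff_iff hP (hbm _ _) (hbm _ _)).2 rfl
    · exact (hA.indiff_iff hP (hbm _ _) (hbm _ _)).2 (law h)
  have sum : ∀ {t t' : ℝ}, 0 ≤ t → 0 ≤ t' →
      ce R (bet t' (E μ) 0) = ce R (bet (max t c) (E μ) (min t c)) → SubjSum P R t c t' := by
    intro t t' ht ht' e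
    refine ⟨_, ?_, E (1 / 2), hess, Or.inl ⟨?_, ?_, _, _, (hA.isCE_iff hP (hbm _ _) _).2 rfl,
      (hA.isCE_iff hP (hbm _ _) _).2 rfl, (hA.indiff_iff hP (hbm _ _) (hbm _ _)).2 (law ht')⟩⟩
    · have : PrefAverage R (E (1 / 2)) t c (ce R (bet t' (E μ) 0)) := by
        rw [e]
        rcases le_total c t with h | h
        · rw [max_eq_left h, min_eq_right h]
          exact Or.inl (avg h)
        · rw [max_eq_right h, min_eq_left h]
          exact Or.inr (avg h)
      have := SubjMix.average (P := P) (R := R) SubjMix.one SubjMix.zero hess this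
      convert this using 1
      norm_num
    · exact (hm.mem_Icc hμI ht').1
    · exact (hA.sure_sure Subset.rfl).2 (hm.mem_Icc hμI ht').2
  have hpE := hE p hp
  have hpm := fun t x => bet_mem_finiteRV (W := W) (S := S) hpE.1 t x
  have h0 := hx.trans (hm.mem_Icc hp hxt).1
  have hv : ∀ y, SubjSum P R (bet t (E p) x y) (sure c y) (bet t' (E p) x' y) := fun y => by
    by_cases hy : y ∈ E p
    · rw [bet_of_mem hy, bet_of_mem hy]
      exact sum (hx.trans hxt) ht' e1
    · rw [bet_of_notMem hy, bet_of_notMem hy]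
      exact sum hx hx' e2
  have hu : ∀ y, SubjSum P R (sure (ce R (bet t (E p) x)) y) (sure c y) ((sure k' : W × S → ℝ) y) :=
    fun y => sum h0 hk' e3
  have hind : Indiff R (bet t (E p) x) (sure (ce R (bet t (E p) x))) := by
    rw [hA.indiff_iff hP (hpm _ _) (hs _), hA.ce_sure hP]
  have r1 := hA.dualIndependence _ (hpm t x) _ (hs _) _ (hs c) (unambiguous_sure c)
    (comonotonic_sure _ _) (comonotonic_sure _ _) _ (hpm t' x') _ (hs k') hv hu hind.1
  have r2 := hA.dualIndependence _ (hs _) _ (hpm t x) _ (hs c) (unambiguous_sure c)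
    (comonotonic_sure _ _) (comonotonic_sure _ _) _ (hs k') _ (hpm t' x') hu hv hind.2
  have := (hA.indiff_iff hP (hpm _ _) (hs _)).1 ⟨r1, r2⟩
  rwa [hA.ce_sure hP] at this

omit hE in
/-- Under the axioms bets on unambiguous events are ranked by rank-dependent utility. -/
theorem SatisfiesAxioms.exists_binRep : ∃ φ ψ : ℝ → ℝ, Continuous φ ∧ StrictMono φ ∧ φ 0 = 0 ∧
    Distortion ψ ∧ BinRep P R φ ψ := by
  obtain ⟨E, hE⟩ := exists_event hP
  obtain ⟨μ, hm⟩ := hA.exists_translatableMean hP hE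
  refine ⟨_, _, hm.utility_continuous, hm.utility_strictMono, hm.utility_zero, hm.distortion, ?_⟩
  set φ := TranslatableMean.utility (fun p t x => ce R (bet t (E p) x)) μ
  set ψ := TranslatableMean.distort (fun p t x => ce R (bet t (E p) x)) μ
  have key : ∀ {B : Set (W × S)} {p : ℝ}, HasProb P B p → ∀ {t x : ℝ}, x ≤ t →
      φ (ce R (bet t B x)) = binVal ψ p (φ t) (φ x) := by
    intro B p hB t x h
    rw [binVal_of_le (hm.utility_strictMono.monotone h),
      hA.ce_bet_congr hP hB (hE p hB.mem_Icc)]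
    exact hm.utility_mean hB.mem_Icc h
  have key' : ∀ {B : Set (W × S)} {p : ℝ}, HasProb P B p → ∀ t x : ℝ,
      φ (ce R (bet t B x)) = binVal ψ p (φ t) (φ x) := by
    intro B p hB t x
    rcases le_total x t with h | h
    · exact key hB h
    · rw [← bet_compl, key hB.compl h, binVal_compl]
  intro B B' p p' hB hB' t x t' x'
  rw [hA.rel_iff hP (bet_mem_finiteRV hB.1 _ _) (bet_mem_finiteRV hB'.1 _ _),
    ← hm.utility_strictMono.le_iff_le]
  exact (congrArg₂ (· ≤ ·) (key' hB' t' x') (key' hB t x)).to_iff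

end Bets

/-! ### The value of random variables under the axioms -/

section Value
variable {W S : Type*} [MeasurableSpace W] [MeasurableSpace S]

/-- A preference that satisfies the axioms and ranks bets by rank-dependent utility, with the utility
function normalized at `0`. -/
structure BetUtility (P : Kernel W S) (R : (W × S → ℝ) → (W × S → ℝ) → Prop) (φ ψ : ℝ → ℝ) :
    Prop where
  uniform : HasUniform P
  axioms : SatisfiesAxioms P (finiteRV W S) R
  cont : Continuous φ
  strictMono : StrictMono φ
  zero : φ 0 = 0
  distortion : Distortion ψ
  binRep : BinRep P R φ ψ

/-- The utility of the certainty equivalent. -/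
def value (R : (W × S → ℝ) → (W × S → ℝ) → Prop) (φ : ℝ → ℝ) (v : W × S → ℝ) : ℝ := φ (ce R v)

theorem finiteRV_comp {v : W × S → ℝ} (hv : v ∈ finiteRV W S) (h : ℝ → ℝ) :
    (fun x => h (v x)) ∈ finiteRV W S :=
  ⟨((⟨v, fun x => hv.1 (measurableSet_singleton x), hv.2⟩ : SimpleFunc (W × S) ℝ).map h).measurable,
    (hv.2.image h).subset (by rintro _ ⟨x, rfl⟩; exact ⟨_, ⟨x, rfl⟩, rfl⟩)⟩

/-- Distribution functions determine laws, so independence of the state passes from half-lines to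
all Borel sets. -/
theorem Unambiguous.real_preimage_eq {P : Kernel W S} [IsMarkovKernel P] {v : W × S → ℝ}
    (hv : Unambiguous P v) (hm : Measurable v) {B : Set ℝ} (hB : MeasurableSet B) (w₁ w₂ : W) :
    (P w₁).real {s | v (w₁, s) ∈ B} = (P w₂).real {s | v (w₂, s) ∈ B} := by
  have hmw := fun w => measurable_section hm w
  have hprob := fun w => Measure.isProbabilityMeasure_map (μ := P w) (hmw w).aemeasurable
  have e : (P w₁).map (fun s => v (w₁, s)) = (P w₂).map fun s => v (w₂, s) := by
    have := hprob w₁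
    have := hprob w₂
    refine Measure.ext_of_Iic _ _ fun t => ?_
    rw [Measure.map_apply (hmw w₁) measurableSet_Iic, Measure.map_apply (hmw w₂) measurableSet_Iic,
      ← ENNReal.toReal_eq_toReal_iff' (measure_ne_top _ _) (measure_ne_top _ _)]
    exact hv w₁ w₂ t
  have := congrArg (fun μ : Measure ℝ => μ.real B) e
  rwa [map_measureReal_apply (hmw w₁) hB, map_measureReal_apply (hmw w₂) hB] at this

theorem Unambiguous.comp {P : Kernel W S} [IsMarkovKernel P] {v : W × S → ℝ}
    (hv : Unambiguous P v) (hf : v ∈ finiteRV W S) (h : ℝ → ℝ) :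
    Unambiguous P fun x => h (v x) := fun w₁ w₂ t => by
  have hB : (range v ∩ {y | h y ≤ t}).Finite := hf.2.inter_of_left _
  have e : ∀ w, {s | h (v (w, s)) ≤ t} = {s | v (w, s) ∈ range v ∩ {y | h y ≤ t}} := fun w => by
    ext s
    exact ⟨fun hs => ⟨mem_range_self _, hs⟩, fun hs => hs.2⟩
  rw [condCDF, condCDF, e, e]
  exact hv.real_preimage_eq hf.1 hB.measurableSet w₁ w₂

omit [MeasurableSpace W] [MeasurableSpace S] in
theorem comonotonic_comp (v : W × S → ℝ) {h k : ℝ → ℝ} (hh : Monotone h) (hk : Monotone k) :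
    Comonotonic (fun x => h (v x)) fun x => k (v x) := fun w s s' => by
  rcases le_total (v (w, s)) (v (w, s')) with h1 | h1
  · exact mul_nonneg (sub_nonneg.2 (hh h1)) (sub_nonneg.2 (hk h1))
  · exact mul_nonneg_of_nonpos_of_nonpos (sub_nonpos.2 (hh h1)) (sub_nonpos.2 (hk h1))

namespace BetUtility
variable [Nonempty W] {P : Kernel W S} [IsMarkovKernel P]
  {R : (W × S → ℝ) → (W × S → ℝ) → Prop} {φ ψ : ℝ → ℝ} (h : BetUtility P R φ ψ)
include h

theorem rel_iff {v u : W × S → ℝ} (hv : v ∈ finiteRV W S) (hu : u ∈ finiteRV W S) :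
    R v u ↔ value R φ u ≤ value R φ v := by
  rw [h.axioms.rel_iff h.uniform hv hu, value, value, h.strictMono.le_iff_le]

theorem value_sure (m : ℝ) : value R φ (sure m : W × S → ℝ) = φ m := by
  rw [value, h.axioms.ce_sure h.uniform]

theorem value_mono {v u : W × S → ℝ} (hv : v ∈ finiteRV W S) (hu : u ∈ finiteRV W S)
    (hle : ∀ x, u x ≤ v x) : value R φ u ≤ value R φ v :=
  (h.rel_iff hv hu).1 (h.axioms.of_le (exists_copy_finiteRV h.uniform) hv hu hle)

theorem exists_le_value {v : W × S → ℝ} (hv : v ∈ finiteRV W S) : ∃ x, φ (v x) ≤ value R φ v := by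
  have : Nonempty S := nonempty_state P
  obtain ⟨_, ⟨x, rfl⟩, hx⟩ := exists_min_image (range v) id hv.2 (range_nonempty v)
  refine ⟨x, ?_⟩
  rw [← h.value_sure]
  exact h.value_mono hv (sure_mem_finiteRV _) fun y => hx _ (mem_range_self y)

theorem exists_value_le {v : W × S → ℝ} (hv : v ∈ finiteRV W S) : ∃ x, value R φ v ≤ φ (v x) := by
  have : Nonempty S := nonempty_state P
  obtain ⟨_, ⟨x, rfl⟩, hx⟩ := exists_max_image (range v) id hv.2 (range_nonempty v)
  refine ⟨x, ?_⟩
  rw [← h.value_sure]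
  exact h.value_mono (sure_mem_finiteRV _) hv fun y => hx _ (mem_range_self y)

theorem exists_between {a b y : ℝ} (h1 : φ a ≤ y) (h2 : y ≤ φ b) : ∃ z, φ z = y :=
  mem_range_of_exists_le_of_exists_ge h.cont ⟨a, h1⟩ ⟨b, h2⟩

/-- Dual independence in terms of utilities; since `φ 0 = 0`, subjective sums are plain sums. -/
theorem value_le_of_add {v u r v' u' : W × S → ℝ} (hv : v ∈ finiteRV W S)
    (hu : u ∈ finiteRV W S) (hr : r ∈ finiteRV W S) (hv' : v' ∈ finiteRV W S)
    (hu' : u' ∈ finiteRV W S) (hur : Unambiguous P r) (hvr : Comonotonic v r)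
    (hur' : Comonotonic u r) (ev : ∀ x, φ (v' x) = φ (v x) + φ (r x))
    (eu : ∀ x, φ (u' x) = φ (u x) + φ (r x)) (hle : value R φ u ≤ value R φ v) :
    value R φ u' ≤ value R φ v' := by
  refine (h.rel_iff hv' hu').1 (h.axioms.dualIndependence v hv u hu r hr hur hvr hur' v' hv' u' hu'
    (fun x => ?_) (fun x => ?_) ((h.rel_iff hv hu).2 hle))
  · exact h.binRep.subjSum_of_utility h.cont h.strictMono h.distortion h.uniform
      (by rw [ev, h.zero, sub_zero])
  · exact h.binRep.subjSum_of_utility h.cont h.strictMono h.distortion h.uniform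
      (by rw [eu, h.zero, sub_zero])

/-- The constant is added to `v` and to its certainty equivalent alike. The second sum exists
because its utility lies between two utilities of `v'`. -/
theorem value_add_sure {v v' : W × S → ℝ} (hv : v ∈ finiteRV W S) (hv' : v' ∈ finiteRV W S)
    {c : ℝ} (ev : ∀ x, φ (v' x) = φ (v x) + φ c) : value R φ v' = value R φ v + φ c := by
  obtain ⟨x₁, h1⟩ := h.exists_le_value hv
  obtain ⟨x₂, h2⟩ := h.exists_value_le hv
  obtain ⟨z, hz⟩ := h.exists_between (y := value R φ v + φ c) (a := v' x₁) (b := v' x₂)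
    (by rw [ev]; linarith) (by rw [ev]; linarith)
  have hs := fun m => sure_mem_finiteRV (W := W) (S := S) m
  have e : value R φ (sure (ce R v) : W × S → ℝ) = value R φ v := h.value_sure _
  have es : ∀ x, φ ((sure z : W × S → ℝ) x) = φ ((sure (ce R v) : W × S → ℝ) x) + φ (sure c x) :=
    fun x => hz
  rw [← hz, ← h.value_sure z]
  exact le_antisymm
    (h.value_le_of_add (hs _) hv (hs c) (hs z) hv' (unambiguous_sure c) (comonotonic_sure _ _)
      (comonotonic_sure _ _) es ev e.ge)
    (h.value_le_of_add hv (hs _) (hs c) hv' (hs z) (unambiguous_sure c) (comonotonic_sure _ _)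
      (comonotonic_sure _ _) ev es e.le)

/-- Additivity for a comonotonic unambiguous summand. -/
theorem value_add {v r v' : W × S → ℝ} (hv : v ∈ finiteRV W S) (hr : r ∈ finiteRV W S)
    (hv' : v' ∈ finiteRV W S) (hur : Unambiguous P r) (hvr : Comonotonic v r)
    (hrange : ∀ x y, ∃ z, φ z = φ (v x) + φ (r y)) (ev : ∀ x, φ (v' x) = φ (v x) + φ (r x)) :
    value R φ v' = value R φ v + value R φ r := by
  obtain ⟨x₁, h1⟩ := h.exists_le_value hv
  obtain ⟨x₂, h2⟩ := h.exists_value_le hv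
  have hex : ∀ y, ∃ z, φ z = value R φ v + φ (r y) := fun y => by
    obtain ⟨a, ha⟩ := hrange x₁ y
    obtain ⟨b, hb⟩ := hrange x₂ y
    exact h.exists_between (a := a) (b := b) (by linarith) (by linarith)
  -- `v` is exchanged for its certainty equivalent, which is comonotonic with everything. The result
  -- `k (r x)` is `r` plus a constant, so `value_add_sure` evaluates it.
  set k : ℝ → ℝ := fun y => Function.invFun φ (value R φ v + φ y) with hk
  have hku : ∀ x, φ (k (r x)) = value R φ v + φ (r x) := fun x => Function.invFun_eq (hex x)
  have hu' := finiteRV_comp hr k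
  have e : value R φ (sure (ce R v) : W × S → ℝ) = value R φ v := h.value_sure _
  have hs := sure_mem_finiteRV (W := W) (S := S) (ce R v)
  have hsr : Comonotonic (sure (ce R v)) r := fun w s s' => by simp [sure]
  have e1 : value R φ v' = value R φ fun x => k (r x) := le_antisymm
    (h.value_le_of_add hs hv hr hu' hv' hur hsr hvr hku ev e.ge)
    (h.value_le_of_add hv hs hr hv' hu' hur hvr hsr ev hku e.le)
  rw [e1, h.value_add_sure hr hu' (c := ce R v) fun x => by rw [hku, add_comm]; rfl]
  exact add_comm _ _

theorem value_bet {B : Set (W × S)} {p : ℝ} (hB : HasProb P B p) (t x : ℝ) (w : W) :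
    value R φ (bet t B x) = lotteryUtility P φ ψ (bet t B x) w := by
  rw [lotteryUtility_bet h.strictMono.monotone h.distortion hB]
  exact (h.binRep.isCE_bet hB _ _ _).1 (h.axioms.isCE_ce h.uniform (bet_mem_finiteRV hB.1 _ _))

theorem exists_pos_range : ∃ k, 0 < k ∧ ∀ y, |y| ≤ k → ∃ z, φ z = y := by
  have h1 := h.strictMono (show (0 : ℝ) < 1 by norm_num)
  have h2 := h.strictMono (show (-1 : ℝ) < 0 by norm_num)
  rw [h.zero] at h1 h2
  refine ⟨min (φ 1) (-φ (-1)), lt_min h1 (by linarith), fun y hy => ?_⟩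
  rw [abs_le] at hy
  exact h.exists_between (a := -1) (b := 1) (by linarith [min_le_right (φ 1) (-φ (-1))])
    (hy.2.trans (min_le_left _ _))

/-- Induction on the number of values: the top layer is a bet on the event where `v` is largest,
comonotonic with `v` truncated at its second largest value. The bound on the oscillation makes the
height of the layer a utility, so that the decomposition exists. -/
theorem value_eq_of_oscillation {k : ℝ} (hk : ∀ y, |y| ≤ k → ∃ z, φ z = y) (w : W) (n : ℕ) :
    ∀ v ∈ finiteRV W S, Unambiguous P v → (range v).ncard = n →
      (∀ x y, |φ (v x) - φ (v y)| ≤ k) → value R φ v = lotteryUtility P φ ψ v w := by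
  have : Nonempty S := nonempty_state P
  induction n using Nat.strong_induction_on with
  | _ n ih =>
  intro v hv huv hn hosc
  obtain ⟨_, ⟨x₀, rfl⟩, hx₀⟩ := exists_max_image (range v) id hv.2 (range_nonempty v)
  rcases (range v \ {v x₀}).eq_empty_or_nonempty with hemp | hne
  · have : v = sure (v x₀) := funext fun y => by
      by_contra hcon
      exact (hemp.le ⟨mem_range_self y, hcon⟩).elim
    rw [this, h.value_sure, lotteryUtility_sure h.distortion]
  obtain ⟨_, ⟨⟨x₁, rfl⟩, hne1⟩, hx₁⟩ :=
    exists_max_image (range v \ {v x₀}) id (hv.2.subset sdiff_subset) hne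
  have hlt : v x₁ < v x₀ := lt_of_le_of_ne (hx₀ _ (mem_range_self x₁)) hne1
  have hle : ∀ y, v y = v x₀ ∨ v y ≤ v x₁ := fun y => by
    by_cases hy : v y = v x₀
    · exact Or.inl hy
    · exact Or.inr (hx₁ _ ⟨mem_range_self y, hy⟩)
  obtain ⟨c, hc⟩ := hk _ (hosc x₀ x₁)
  set f : ℝ → ℝ := fun y => min y (v x₁) with hf
  have hφlt := h.strictMono hlt
  have hc0 : 0 ≤ c := h.strictMono.le_iff_le.1 (by rw [h.zero, hc]; linarith)
  have hB : HasProb P {x | v x₀ ≤ v x} ((P w).real {s | v x₀ ≤ v (w, s)}) :=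
    ⟨measurableSet_le measurable_const hv.1, fun w' =>
      huv.real_preimage_eq hv.1 (measurableSet_Ici (a := v x₀)) w' w⟩
  set r := bet c {x | v x₀ ≤ v x} (0 : ℝ) with hr
  have hr1 : ∀ x, v x = v x₀ → r x = c := fun x hx => bet_of_mem (show v x₀ ≤ v x from hx.ge)
  have hr0 : ∀ x, v x ≤ v x₁ → r x = 0 := fun x hx =>
    bet_of_notMem (show ¬ v x₀ ≤ v x from not_le.2 (hx.trans_lt hlt))
  have hf1 : ∀ x, v x = v x₀ → f (v x) = v x₁ := fun x hx => by
    simp only [hf]; rw [hx, min_eq_right hlt.le]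
  have hf0 : ∀ x, v x ≤ v x₁ → f (v x) = v x := fun x hx => min_eq_left hx
  have hfR := finiteRV_comp hv f
  have hrR : r ∈ finiteRV W S := bet_mem_finiteRV hB.1 _ _
  have ev : ∀ x, φ (v x) = φ (f (v x)) + φ (r x) := fun x => by
    rcases hle x with hx | hx
    · rw [hr1 x hx, hf1 x hx, hc, hx]; ring
    · rw [hr0 x hx, hf0 x hx, h.zero, add_zero]
  have hcom : Comonotonic (fun x => f (v x)) r := by
    have e : r = fun x => (fun y => if v x₀ ≤ y then c else 0) (v x) := funext fun x => by
      by_cases hx : v x₀ ≤ v x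
      · exact (bet_of_mem (B := {x | v x₀ ≤ v x}) hx).trans (if_pos hx).symm
      · exact (bet_of_notMem (B := {x | v x₀ ≤ v x}) hx).trans (if_neg hx).symm
    rw [e]
    refine comonotonic_comp v (h := f) (k := fun y => if v x₀ ≤ y then c else 0)
      (fun a b hab => min_le_min hab le_rfl) fun a b hab => ?_
    dsimp only
    split_ifs with h1 h2
    exacts [le_rfl, absurd (h1.trans hab) h2, hc0, le_rfl]
  have hfx : ∀ x, f (v x) ≤ v x₁ := fun x => min_le_right _ _
  have hvf : ∀ x, ∃ y, f (v x) = v y := fun x => by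
    rcases hle x with hx | hx
    · exact ⟨x₁, hf1 x hx⟩
    · exact ⟨x, hf0 x hx⟩
  have h1 := h.value_add hfR hrR hv (unambiguous_bet hB _ _) hcom (fun x y => by
    have hxr : φ (r y) = 0 ∨ φ (r y) = φ (v x₀) - φ (v x₁) := by
      rcases hle y with hy | hy
      · exact Or.inr (by rw [hr1 y hy, hc])
      · exact Or.inl (by rw [hr0 y hy, h.zero])
    have h2 := h.strictMono.monotone (hfx x)
    rcases hxr with hxr | hxr
    · exact ⟨f (v x), by rw [hxr, add_zero]⟩
    · exact h.exists_between (a := f (v x)) (b := v x₀) (by rw [hxr]; linarith)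
        (by rw [hxr]; linarith)) ev
  have h2 := lotteryUtility_add (P := P) h.distortion h.cont h.strictMono.monotone
    (finiteRV_subset_boundedRV hfR) (finiteRV_subset_boundedRV hrR) hcom (k := 0)
    (fun x => by rw [ev, sub_zero]) w
  have hcard : (range fun x => f (v x)).ncard < n := by
    rw [← hn]
    refine ncard_lt_ncard ⟨?_, fun hsub => ?_⟩ hv.2
    · rintro _ ⟨x, rfl⟩
      obtain ⟨y, hy⟩ := hvf x
      exact ⟨y, hy.symm⟩
    · obtain ⟨y, hy⟩ := hsub (mem_range_self x₀)
      exact absurd (hfx y) (not_le.2 (hlt.trans_eq hy.symm))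
  rw [h1, h2, h.value_bet hB c 0 w, ih _ hcard _ hfR (huv.comp hv f) rfl fun x y => by
    obtain ⟨x', hx'⟩ := hvf x
    obtain ⟨y', hy'⟩ := hvf y
    rw [hx', hy']
    exact hosc x' y', sub_zero]

/-- Unambiguous random variables are ranked by rank-dependent utility. -/
theorem value_eq_of_unambiguous {v : W × S → ℝ} (hv : v ∈ finiteRV W S) (huv : Unambiguous P v)
    (w : W) : value R φ v = lotteryUtility P φ ψ v w := by
  have : Nonempty S := nonempty_state P
  obtain ⟨k, hk0, hk⟩ := h.exists_pos_range
  -- Large oscillations are reduced by halving utilities: `v` is the sum of two copies of its half,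
  -- which is comonotonic with itself, and halves stay in the range since `φ 0 = 0`.
  have key : ∀ n : ℕ, ∀ v ∈ finiteRV W S, Unambiguous P v →
      (∀ x y, |φ (v x) - φ (v y)| ≤ 2 ^ n * k) → value R φ v = lotteryUtility P φ ψ v w := by
    intro n
    induction n with
    | zero =>
      intro v hv huv hosc
      refine h.value_eq_of_oscillation hk w _ v hv huv rfl fun x y => ?_
      simpa using hosc x y
    | succ n ih =>
      intro v hv huv hosc
      have hex : ∀ y, ∃ z, φ z = φ y / 2 := fun y => by
        rcases le_total 0 (φ y) with h1 | h1
        · exact h.exists_between (a := 0) (b := y) (by rw [h.zero]; linarith) (by linarith)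
        · exact h.exists_between (a := y) (b := 0) (by linarith) (by rw [h.zero]; linarith)
      choose g hg using hex
      have hgm : Monotone g := fun a b hab => by
        rw [← h.strictMono.le_iff_le, hg, hg]
        linarith [h.strictMono.monotone hab]
      have hgv := finiteRV_comp hv g
      have hug := huv.comp hv g
      have hcom := comonotonic_comp v hgm hgm
      have ev : ∀ x, φ (v x) = φ (g (v x)) + φ (g (v x)) := fun x => by rw [hg]; ring
      have h1 := h.value_add hgv hgv hv hug hcom (fun x y => by
        rw [hg, hg]
        rcases le_total (φ (v x)) (φ (v y)) with h1 | h1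
        · exact h.exists_between (a := v x) (b := v y) (by linarith) (by linarith)
        · exact h.exists_between (a := v y) (b := v x) (by linarith) (by linarith)) ev
      have h2 := lotteryUtility_add (P := P) h.distortion h.cont h.strictMono.monotone
        (finiteRV_subset_boundedRV hgv) (finiteRV_subset_boundedRV hgv) hcom (k := 0)
        (fun x => by rw [ev, sub_zero]) w
      rw [h1, h2, ih _ hgv hug fun x y => ?_, sub_zero]
      have := hosc x y
      rw [hg, hg, ← sub_div, abs_div, abs_two, div_le_iff₀ two_pos]
      rw [pow_succ] at this
      linarith
  obtain ⟨C, hC⟩ := (comp_mem_boundedRV (finiteRV_subset_boundedRV hv) h.cont).2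
  obtain ⟨n, hn⟩ := pow_unbounded_of_one_lt (2 * C / k) one_lt_two
  refine key n v hv huv fun x y => ?_
  rw [div_lt_iff₀ hk0] at hn
  have h1 := abs_le.1 (hC x)
  have h2 := abs_le.1 (hC y)
  rw [abs_le]
  constructor <;> linarith [h1.1, h1.2, h2.1, h2.2]

/-- The value is monotone in the utility of the lotteries. -/
theorem value_le_of_lotteryUtility_le {v u : W × S → ℝ} (hv : v ∈ finiteRV W S)
    (hu : u ∈ finiteRV W S) (hle : ∀ w, lotteryUtility P φ ψ u w ≤ lotteryUtility P φ ψ v w) :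
    value R φ u ≤ value R φ v := by
  refine (h.rel_iff hv hu).1 (h.axioms.monotonicity v hv u hu fun w => ?_)
  obtain ⟨v₀, hv₀, ev⟩ := exists_copy_finiteRV h.uniform v hv w
  obtain ⟨u₀, hu₀, eu⟩ := exists_copy_finiteRV h.uniform u hu w
  refine ⟨v₀, hv₀, u₀, hu₀, ev, eu, (h.rel_iff hv₀ hu₀).2 ?_⟩
  have hb := finiteRV_subset_boundedRV (W := W) (S := S)
  rw [h.value_eq_of_unambiguous hv₀ (fun w₁ w₂ t => by rw [ev, ev]) w,
    h.value_eq_of_unambiguous hu₀ (fun w₁ w₂ t => by rw [eu, eu]) w,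
    lotteryUtility_congr_dist h.cont h.strictMono h.distortion (hb hv₀) (hb hv) (ev w),
    lotteryUtility_congr_dist h.cont h.strictMono h.distortion (hb hu₀) (hb hu) (eu w)]
  exact hle w

end BetUtility
end Value

/-! ### Concave functions and supergradients -/

/-- A continuous function on the unit interval that is midpoint concave near each point is nonnegative
if it is so at the end points. -/
theorem nonneg_of_local_midpoint {h : ℝ → ℝ} (hc : ContinuousOn h (Icc 0 1)) (h0 : 0 ≤ h 0)
    (h1 : 0 ≤ h 1) (hmid : ∀ s ∈ Ioo (0 : ℝ) 1, ∃ ε > 0, s - ε ∈ Icc (0 : ℝ) 1 ∧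
      s + ε ∈ Icc (0 : ℝ) 1 ∧ (h (s - ε) + h (s + ε)) / 2 ≤ h s) :
    ∀ s ∈ Icc (0 : ℝ) 1, 0 ≤ h s := by
  obtain ⟨s₀, hs₀, hmin⟩ := isCompact_Icc.exists_isMinOn (nonempty_Icc.2 zero_le_one) hc
  rw [isMinOn_iff] at hmin
  suffices 0 ≤ h s₀ from fun s hs => this.trans (hmin s hs)
  by_contra! hneg
  -- At the leftmost minimizer the left neighbour is strictly larger and the right one not smaller,
  -- against midpoint concavity; a negative minimum is not at an end.
  have hT : IsCompact (Icc (0 : ℝ) 1 ∩ h ⁻¹' {h s₀}) :=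
    isCompact_Icc.of_isClosed_subset
      (hc.preimage_isClosed_of_isClosed isClosed_Icc isClosed_singleton) inter_subset_left
  obtain ⟨s, ⟨hs, hsv⟩, hleast⟩ := hT.exists_isLeast ⟨s₀, hs₀, rfl⟩
  have hsv : h s = h s₀ := hsv
  have hs' : s ∈ Ioo (0 : ℝ) 1 := by
    refine ⟨hs.1.lt_of_ne ?_, hs.2.lt_of_ne ?_⟩
    · rintro rfl; linarith
    · rintro rfl; linarith
  obtain ⟨ε, hε, hl, hr, hle⟩ := hmid s hs'
  have h2 := hmin _ hr
  have h3 : h s₀ < h (s - ε) := by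
    refine (hmin _ hl).lt_of_ne fun hcon => ?_
    have := hleast ⟨hl, hcon.symm⟩
    linarith
  linarith

section Supergradient
variable {V : Type*} [AddCommGroup V] [Module ℝ V] {K : Set V} {J : V → ℝ}

/-- The difference quotients of `J` at `x` in the direction `v`. -/
def slopes (K : Set V) (J : V → ℝ) (x v : V) : Set ℝ :=
  {q | ∃ ε : ℝ, 0 < ε ∧ x + ε • v ∈ K ∧ q = (J (x + ε • v) - J x) / ε}

/-- The combination of the two points with weights `δ / (ε + δ)` and `ε / (ε + δ)` is a point in the
direction `v + w`. So directional derivatives are superadditive. -/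
theorem slope_add_slope_le (hJ : ConcaveOn ℝ K J) {x v w : V} {q r : ℝ} (hq : q ∈ slopes K J x v)
    (hr : r ∈ slopes K J x w) : ∃ p ∈ slopes K J x (v + w), q + r ≤ p := by
  obtain ⟨ε, hε, hεK, rfl⟩ := hq
  obtain ⟨δ, hδ, hδK, rfl⟩ := hr
  have hs : 0 < ε + δ := add_pos hε hδ
  have e1 : δ / (ε + δ) + ε / (ε + δ) = 1 := by field_simp; ring
  have e2 : (δ / (ε + δ)) • (x + ε • v) + (ε / (ε + δ)) • (x + δ • w) =
      x + (ε * δ / (ε + δ)) • (v + w) := by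
    have : (δ / (ε + δ)) • x + (ε / (ε + δ)) • x = x := by rw [← add_smul, e1, one_smul]
    rw [smul_add, smul_add, smul_smul, smul_smul, smul_add,
      show δ / (ε + δ) * ε = ε * δ / (ε + δ) by ring,
      show ε / (ε + δ) * δ = ε * δ / (ε + δ) by ring, add_add_add_comm, this]
  have h1 := hJ.1 hεK hδK (by positivity) (by positivity) e1
  have h2 := hJ.2 hεK hδK (by positivity) (by positivity) e1
  rw [e2] at h1 h2
  refine ⟨_, ⟨ε * δ / (ε + δ), by positivity, h1, rfl⟩, ?_⟩
  rw [le_div_iff₀ (by positivity)]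
  simp only [smul_eq_mul] at h2
  have e3 : ((J (x + ε • v) - J x) / ε + (J (x + δ • w) - J x) / δ) * (ε * δ / (ε + δ)) =
      δ / (ε + δ) * J (x + ε • v) + ε / (ε + δ) * J (x + δ • w) - J x := by
    have e4 : J x = (δ / (ε + δ) + ε / (ε + δ)) * J x := by rw [e1, one_mul]
    rw [e4]
    field_simp
    ring
  rw [e3]
  linarith

/-- A concave function has a supergradient at each algebraic interior point of its domain. -/
theorem exists_supergradient (hJ : ConcaveOn ℝ K J) {x : V}
    (hx : ∀ v, ∃ ε : ℝ, 0 < ε ∧ x + ε • v ∈ K) :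
    ∃ l : V →ₗ[ℝ] ℝ, ∀ y ∈ K, J y ≤ J x + l (y - x) := by
  have hne : ∀ v, (slopes K J x v).Nonempty := fun v => by
    obtain ⟨ε, hε, h⟩ := hx v
    exact ⟨_, ε, hε, h, rfl⟩
  have hzero : ∀ q ∈ slopes K J x 0, q = 0 := by
    rintro _ ⟨ε, hε, -, rfl⟩
    rw [smul_zero, add_zero, sub_self, zero_div]
  have hbdd : ∀ v, BddAbove (slopes K J x v) := fun v => by
    obtain ⟨r, hr⟩ := hne (-v)
    refine ⟨-r, fun q hq => ?_⟩
    obtain ⟨p, hp, hle⟩ := slope_add_slope_le hJ hq hr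
    rw [add_neg_cancel] at hp
    rw [hzero p hp] at hle
    linarith
  -- Minus the directional derivative is sublinear. Hahn–Banach, extending from the zero subspace,
  -- gives a linear `g ≤ N`, and `-g` then bounds all slopes.
  set N : V → ℝ := fun v => -sSup (slopes K J x v) with hN
  have hhom : ∀ c : ℝ, 0 < c → ∀ v, c * sSup (slopes K J x v) ≤ sSup (slopes K J x (c • v)) := by
    intro c hc v
    rw [← le_div_iff₀' hc]
    refine csSup_le (hne v) ?_
    rintro _ ⟨ε, hε, hK, rfl⟩
    rw [le_div_iff₀' hc]
    refine le_csSup (hbdd _) ⟨ε / c, by positivity, ?_, ?_⟩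
    · rwa [smul_smul, div_mul_cancel₀ _ hc.ne']
    · rw [smul_smul, div_mul_cancel₀ _ hc.ne']
      field_simp
  obtain ⟨g, -, hg⟩ := exists_extension_of_le_sublinear (⊥ : V →ₗ.[ℝ] ℝ) N (fun c hc v => by
      have h1 := hhom c hc v
      have h2 := hhom c⁻¹ (inv_pos.2 hc) (c • v)
      rw [smul_smul, inv_mul_cancel₀ hc.ne', one_smul, inv_mul_le_iff₀ hc] at h2
      simp only [hN]
      linarith) (fun v w => by
      have : sSup (slopes K J x v) ≤ sSup (slopes K J x (v + w)) - sSup (slopes K J x w) := by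
        refine csSup_le (hne v) fun q hq => ?_
        rw [le_sub_comm]
        refine csSup_le (hne w) fun r hr => ?_
        obtain ⟨p, hp, hle⟩ := slope_add_slope_le hJ hq hr
        linarith [le_csSup (hbdd _) hp]
      simp only [hN]
      linarith) (fun v => by
      have hv : (v : V) = 0 := (Submodule.mem_bot ℝ).1 v.2
      have hv' : v = 0 := Subtype.ext hv
      rw [hv', LinearPMap.map_zero]
      simp only [hN]
      have : sSup (slopes K J x ((0 : (⊥ : V →ₗ.[ℝ] ℝ).domain) : V)) ≤ 0 :=
        csSup_le (hne _) fun q hq => (hzero q hq).le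
      linarith)
  refine ⟨-g, fun y hy => ?_⟩
  have h1 := hg (y - x)
  have h2 : (J y - J x) ∈ slopes K J x (y - x) :=
    ⟨1, one_pos, by rwa [one_smul, add_sub_cancel], by rw [one_smul, add_sub_cancel, div_one]⟩
  have h3 := le_csSup (hbdd _) h2
  simp only [hN] at h1
  rw [LinearMap.neg_apply]
  linarith

end Supergradient

/-! ### Positive linear forms on simple functions -/

section LinearForm
variable {W : Type*} [MeasurableSpace W]

/-- The simple function that is `1` on `A` and `0` elsewhere. -/
def simpleIndicator (A : Set W) (hA : MeasurableSet A) : SimpleFunc W ℝ :=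
  SimpleFunc.piecewise A hA (SimpleFunc.const W 1) (SimpleFunc.const W 0)

theorem simpleIndicator_apply {A : Set W} (hA : MeasurableSet A) (w : W) :
    simpleIndicator A hA w = A.indicator (fun _ => (1 : ℝ)) w := by
  classical
  rw [simpleIndicator, SimpleFunc.piecewise_apply, indicator_apply]
  rfl

/-- Positive normalized linear forms on simple functions are expectations. -/
theorem exists_simpleIntegral_eq (l : SimpleFunc W ℝ →ₗ[ℝ] ℝ)
    (hl : ∀ f : SimpleFunc W ℝ, (∀ w, 0 ≤ f w) → 0 ≤ l f) (h1 : l (SimpleFunc.const W 1) = 1) :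
    ∃ Q : FinAddProb W, ∀ f, Q.simpleIntegral f = l f := by
  classical
  refine ⟨⟨fun A => if hA : MeasurableSet A then l (simpleIndicator A hA) else 0, fun A => ?_, ?_,
    fun A B hA hB hAB => ?_, fun A hA => dif_neg hA⟩, fun f => ?_⟩
  · split_ifs with hA
    · refine hl _ fun w => ?_
      rw [simpleIndicator_apply]
      exact indicator_nonneg (fun _ _ => zero_le_one) w
    · exact le_rfl
  · rw [dif_pos MeasurableSet.univ, ← h1]
    congr 1
    ext w
    simp [simpleIndicator_apply]
  · rw [dif_pos hA, dif_pos hB, dif_pos (hA.union hB), ← map_add]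
    congr 1
    ext w
    rw [SimpleFunc.coe_add, Pi.add_apply, simpleIndicator_apply, simpleIndicator_apply,
      simpleIndicator_apply, indicator_union_of_disjoint hAB]
  · have hsum : f = ∑ y ∈ f.range, y • simpleIndicator (f ⁻¹' {y}) (f.measurableSet_fiber y) := by
      ext w
      have hev : ∀ s : Finset ℝ, (∑ y ∈ s,
          y • simpleIndicator (f ⁻¹' {y}) (f.measurableSet_fiber y)) w =
          ∑ y ∈ s, if f w = y then y else 0 := fun s => by
        induction s using Finset.induction_on with
        | empty => simp
        | insert a s ha ih =>
          rw [Finset.sum_insert ha, Finset.sum_insert ha, SimpleFunc.coe_add, Pi.add_apply, ih,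
            SimpleFunc.coe_smul, Pi.smul_apply, simpleIndicator_apply]
          by_cases h : f w = a <;> simp [indicator, h]
      rw [hev, Finset.sum_ite_eq, if_pos (f.mem_range_self w)]
    conv_rhs => rw [hsum]
    rw [map_sum]
    refine Finset.sum_congr rfl fun y _ => ?_
    rw [map_smul, smul_eq_mul]
    dsimp only
    rw [dif_pos (f.measurableSet_fiber y)]

end LinearForm

/-! ### The value of riskless random variables as a function of their utilities -/

section Riskless
variable {W S : Type*} [MeasurableSpace W] [MeasurableSpace S]

/-- The simple functions with values in the range of the utility function. -/
def utilityRange (W : Type*) [MeasurableSpace W] (φ : ℝ → ℝ) : Set (SimpleFunc W ℝ) :=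
  {f | ∀ w, ∃ z, φ z = f w}

/-- The riskless random variable with given utilities. -/
def ofUtility (φ : ℝ → ℝ) (f : W → ℝ) : W × S → ℝ := riskless fun w => Function.invFun φ (f w)

/-- The value as a function of the utilities. -/
def utilityValue (R : (W × S → ℝ) → (W × S → ℝ) → Prop) (φ : ℝ → ℝ) (f : SimpleFunc W ℝ) : ℝ :=
  value R φ (ofUtility φ f)

theorem ofUtility_mem (φ : ℝ → ℝ) (f : SimpleFunc W ℝ) :
    (ofUtility φ f : W × S → ℝ) ∈ finiteRV W S :=
  riskless_mem_finiteRV (f.map (Function.invFun φ)).measurable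
    (f.map (Function.invFun φ)).finite_range

theorem utility_ofUtility {φ : ℝ → ℝ} {f : SimpleFunc W ℝ} (hf : f ∈ utilityRange W φ)
    (x : W × S) : φ (ofUtility φ f x) = f x.1 :=
  Function.invFun_eq (hf x.1)

namespace BetUtility
variable [Nonempty W] {P : Kernel W S} [IsMarkovKernel P]
  {R : (W × S → ℝ) → (W × S → ℝ) → Prop} {φ ψ : ℝ → ℝ} (h : BetUtility P R φ ψ)
include h

theorem exists_bounds_of_mem {f : SimpleFunc W ℝ} (hf : f ∈ utilityRange W φ) :
    ∃ a b, ∀ w, φ a ≤ f w ∧ f w ≤ φ b := by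
  obtain ⟨_, ⟨w₁, rfl⟩, h1⟩ := exists_min_image (range f) id f.finite_range (range_nonempty f)
  obtain ⟨_, ⟨w₂, rfl⟩, h2⟩ := exists_max_image (range f) id f.finite_range (range_nonempty f)
  obtain ⟨a, ha⟩ := hf w₁
  obtain ⟨b, hb⟩ := hf w₂
  exact ⟨a, b, fun w => ⟨ha.trans_le (h1 _ (mem_range_self w)),
    (h2 _ (mem_range_self w)).trans_eq hb.symm⟩⟩

theorem mem_utilityRange {f : SimpleFunc W ℝ} {a b : ℝ} (hab : ∀ w, φ a ≤ f w ∧ f w ≤ φ b) :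
    f ∈ utilityRange W φ := fun w => h.exists_between (hab w).1 (hab w).2

theorem convex_utilityRange : Convex ℝ (utilityRange W φ) := by
  intro f hf g hg a b ha hb hab w
  obtain ⟨y, hy⟩ := hf w
  obtain ⟨z, hz⟩ := hg w
  rw [SimpleFunc.coe_add, Pi.add_apply, SimpleFunc.coe_smul, SimpleFunc.coe_smul, Pi.smul_apply,
    Pi.smul_apply, smul_eq_mul, smul_eq_mul, ← hy, ← hz]
  have hr : (range φ).OrdConnected := (isPreconnected_range h.cont).ordConnected
  exact hr.convex (mem_range_self y) (mem_range_self z) ha hb hab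

theorem utilityValue_mono {f g : SimpleFunc W ℝ} (hf : f ∈ utilityRange W φ)
    (hg : g ∈ utilityRange W φ) (hle : ∀ w, f w ≤ g w) :
    utilityValue R φ f ≤ utilityValue R φ g :=
  h.value_mono (ofUtility_mem φ g) (ofUtility_mem φ f) fun x => by
    rw [← h.strictMono.le_iff_le, utility_ofUtility hf, utility_ofUtility hg]
    exact hle x.1

theorem utilityValue_const (m : ℝ) : utilityValue R φ (SimpleFunc.const W (φ m)) = φ m := by
  refine Eq.trans (congrArg (value R φ) ?_) (h.value_sure m)
  funext x
  exact Function.leftInverse_invFun h.strictMono.injective m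

/-- Translation invariance. -/
theorem utilityValue_add {f g : SimpleFunc W ℝ} (hf : f ∈ utilityRange W φ)
    (hg : g ∈ utilityRange W φ) {k : ℝ} (hk : ∀ w, g w = f w + k) :
    utilityValue R φ g = utilityValue R φ f + k := by
  -- The shift `k` need not be a utility, but `k / n` is one for large `n`. The intermediate
  -- functions have values in the range because it is an interval.
  obtain ⟨κ, hκ, hrange⟩ := h.exists_pos_range
  obtain ⟨n, hn⟩ := exists_nat_gt (|k| / κ)
  have hn0 : (0 : ℝ) < n := (by positivity : 0 ≤ |k| / κ).trans_lt hn
  rw [div_lt_iff₀ hκ] at hn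
  obtain ⟨c, hc⟩ := hrange (k / n) (by
    rw [abs_div, abs_of_pos hn0, div_le_iff₀ hn0]; linarith)
  have key : ∀ i : ℕ, i ≤ n → f.map (fun y => y + i * (k / n)) ∈ utilityRange W φ ∧
      utilityValue R φ (f.map fun y => y + i * (k / n)) = utilityValue R φ f + i * (k / n) := by
    intro i hi
    have hmem : ∀ i : ℕ, i ≤ n → f.map (fun y => y + i * (k / n)) ∈ utilityRange W φ := by
      intro i hi w
      have hi' : (i : ℝ) ≤ n := by exact_mod_cast hi
      obtain ⟨y, hy⟩ := hf w
      obtain ⟨z, hz⟩ := hg w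
      have hr : (range φ).OrdConnected := (isPreconnected_range h.cont).ordConnected
      have := hr.convex (mem_range_self y) (mem_range_self z) (a := 1 - (i : ℝ) / n)
        (b := (i : ℝ) / n)
        (by rw [sub_nonneg, div_le_one hn0]; exact hi') (by positivity) (by ring)
      rw [hy, hz, hk, smul_eq_mul, smul_eq_mul,
        show (1 - (i : ℝ) / n) * f w + (i : ℝ) / n * (f w + k) = f w + i * (k / n) by ring] at this
      exact this
    refine ⟨hmem i hi, ?_⟩
    induction i with
    | zero =>
      have : (f.map fun y => y + ((0 : ℕ) : ℝ) * (k / n)) = f := by ext w; simp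
      rw [this]; simp
    | succ i ih =>
      have h1 := h.value_add_sure (ofUtility_mem (S := S) φ (f.map fun y => y + i * (k / n)))
        (ofUtility_mem φ (f.map fun y => y + (i + 1 : ℕ) * (k / n))) (c := c) fun x => by
          rw [utility_ofUtility (hmem _ hi), utility_ofUtility (hmem i (by omega)), hc]
          simp only [SimpleFunc.map_apply]
          push_cast
          ring
      have h2 := ih (by omega)
      rw [utilityValue] at h2 ⊢
      rw [h1, h2, hc]
      push_cast
      ring
  have e : (f.map fun y => y + n * (k / n)) = g := by
    ext w
    rw [SimpleFunc.map_apply, hk, mul_div_cancel₀ _ hn0.ne']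
  have := (key n le_rfl).2
  rwa [e, mul_div_cancel₀ _ hn0.ne'] at this

/-- The value is nonexpansive in the utilities. -/
theorem utilityValue_le_add {f g : SimpleFunc W ℝ} (hf : f ∈ utilityRange W φ)
    (hg : g ∈ utilityRange W φ) {k : ℝ} (hk0 : 0 ≤ k) (hk : ∀ w, f w ≤ g w + k) :
    utilityValue R φ f ≤ utilityValue R φ g + k := by
  obtain ⟨a₁, b₁, h1⟩ := h.exists_bounds_of_mem hf
  obtain ⟨a₂, b₂, h2⟩ := h.exists_bounds_of_mem hg
  set b := max b₁ b₂
  have hb := h.strictMono (show b < b + 1 by linarith)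
  have hfb : ∀ w, f w ≤ φ b := fun w =>
    (h1 w).2.trans (h.strictMono.monotone (le_max_left _ _))
  have hgb : ∀ w, g w ≤ φ b := fun w =>
    (h2 w).2.trans (h.strictMono.monotone (le_max_right _ _))
  -- `g + k` may leave the range of `φ`, so `g` is raised towards `f` in `n` steps of size `δ`, each
  -- fitting between `φ b` and `φ (b + 1)`.
  have key : ∀ (δ : ℝ), 0 ≤ δ → φ b + δ ≤ φ (b + 1) → ∀ n : ℕ, ∀ g ∈ utilityRange W φ,
      (∀ w, g w ≤ φ b) → (∀ w, f w ≤ g w + n * δ) →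
        utilityValue R φ f ≤ utilityValue R φ g + n * δ := by
    intro δ hδ hδb n
    induction n with
    | zero =>
      intro g hg _ hk
      have := h.utilityValue_mono hf hg fun w => by simpa using hk w
      simpa using this
    | succ n ih =>
      intro g hg hgb hk
      obtain ⟨a, _, h2⟩ := h.exists_bounds_of_mem hg
      -- Raised by at most `δ`, and never above the larger of `f` and `g`: this stays below `φ b`
      -- and reduces the remaining gap to `f` by `δ`.
      set g₁ := (f ⊔ g) ⊓ g.map fun y => y + δ with hg₁
      have hg₁a : ∀ w, g₁ w = min (max (f w) (g w)) (g w + δ) := fun w => rfl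
      have hge : ∀ w, g w ≤ g₁ w := fun w => by
        rw [hg₁a]
        exact le_min (le_max_right _ _) (by linarith)
      have hg₁b : ∀ w, g₁ w ≤ φ b := fun w => by
        rw [hg₁a]
        exact (min_le_left _ _).trans (max_le (hfb w) (hgb w))
      have hg₁m : g₁ ∈ utilityRange W φ :=
        h.mem_utilityRange fun w => ⟨(h2 w).1.trans (hge w), hg₁b w⟩
      have hgδ : g.map (fun y => y + δ) ∈ utilityRange W φ :=
        h.mem_utilityRange (a := a) (b := b + 1) fun w => by
          rw [SimpleFunc.map_apply]
          exact ⟨by linarith [(h2 w).1], by linarith [hgb w]⟩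
      have e1 := ih g₁ hg₁m hg₁b fun w => by
        have := hk w
        push_cast at this
        rw [hg₁a]
        rcases le_total (max (f w) (g w)) (g w + δ) with h3 | h3
        · rw [min_eq_left h3]
          have : 0 ≤ n * δ := by positivity
          linarith [le_max_left (f w) (g w)]
        · rw [min_eq_right h3]
          linarith
      have e2 := h.utilityValue_mono hg₁m hgδ fun w => by
        rw [hg₁a]
        exact min_le_right _ _
      rw [h.utilityValue_add hg hgδ (k := δ) fun w => rfl] at e2
      push_cast
      linarith
  obtain ⟨n, hn⟩ := exists_nat_gt (k / (φ (b + 1) - φ b))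
  have hpos : 0 < φ (b + 1) - φ b := by linarith
  have hn0 : (0 : ℝ) < n := (by positivity : 0 ≤ k / (φ (b + 1) - φ b)).trans_lt hn
  rw [div_lt_iff₀ hpos] at hn
  have hδ : k / n ≤ φ (b + 1) - φ b := by
    rw [div_le_iff₀ hn0]; linarith
  have := key (k / n) (by positivity) (by linarith) n g hg hgb
  rw [mul_div_cancel₀ _ hn0.ne'] at this
  exact this hk

theorem le_utilityValue_midpoint {f g k : SimpleFunc W ℝ} (hf : f ∈ utilityRange W φ)
    (hg : g ∈ utilityRange W φ) (hk : k ∈ utilityRange W φ) (hfgk : ∀ w, k w = (f w + g w) / 2)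
    (heq : utilityValue R φ f = utilityValue R φ g) : utilityValue R φ f ≤ utilityValue R φ k := by
  have : Nonempty S := nonempty_state P
  have s : S := Classical.arbitrary S
  have hm := fun f : SimpleFunc W ℝ => ofUtility_mem (S := S) φ f
  refine (h.rel_iff (hm k) (hm f)).1 (h.axioms.ambiguityAversion _ _ _ (1 / 2) (hm f) (hm g) (hm k)
    (by norm_num) (by norm_num) ⟨(h.rel_iff (hm f) (hm g)).2 heq.ge,
      (h.rel_iff (hm g) (hm f)).2 heq.le⟩ fun w => ?_)
  refine h.binRep.subjMix_half h.cont h.strictMono h.distortion h.uniform ?_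
  have e1 := utility_ofUtility hk (w, s)
  have e2 := utility_ofUtility hf (w, s)
  have e3 := utility_ofUtility hg (w, s)
  simp only [ofUtility, riskless] at e1 e2 e3
  rw [e1, e2, e3, hfgk]

/-- Ambiguity aversion gives the midpoint inequality only between functions of equal value.
Translation invariance levels the values first, which is possible only for nearby functions as the
range may be bounded; continuity then passes from local midpoint concavity to concavity on the
segment. -/
theorem concaveOn_utilityValue : ConcaveOn ℝ (utilityRange W φ) (utilityValue R φ) := by
  refine ⟨h.convex_utilityRange, fun f hf g hg a b ha hb hab => ?_⟩
  set p : ℝ → SimpleFunc W ℝ := fun s => (1 - s) • f + s • g with hp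
  have hpw : ∀ s w, p s w = (1 - s) * f w + s * g w := fun s w => rfl
  have hpm : ∀ s ∈ Icc (0 : ℝ) 1, p s ∈ utilityRange W φ := fun s hs =>
    h.convex_utilityRange hf hg (sub_nonneg.2 hs.2) hs.1 (by ring)
  obtain ⟨a₁, b₁, h1⟩ := h.exists_bounds_of_mem hf
  obtain ⟨a₂, b₂, h2⟩ := h.exists_bounds_of_mem hg
  set A := min a₁ a₂
  set B := max b₁ b₂
  have hf1 : ∀ w, φ A ≤ f w ∧ f w ≤ φ B := fun w =>
    ⟨(h.strictMono.monotone (min_le_left _ _)).trans (h1 w).1,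
      (h1 w).2.trans (h.strictMono.monotone (le_max_left _ _))⟩
  have hg1 : ∀ w, φ A ≤ g w ∧ g w ≤ φ B := fun w =>
    ⟨(h.strictMono.monotone (min_le_right _ _)).trans (h2 w).1,
      (h2 w).2.trans (h.strictMono.monotone (le_max_right _ _))⟩
  have hp1 : ∀ s ∈ Icc (0 : ℝ) 1, ∀ w, φ A ≤ p s w ∧ p s w ≤ φ B := fun s hs w => by
    rw [hpw]
    have hs' := sub_nonneg.2 hs.2
    constructor <;> nlinarith [mul_le_mul_of_nonneg_left (hf1 w).1 hs',
      mul_le_mul_of_nonneg_left (hf1 w).2 hs', mul_le_mul_of_nonneg_left (hg1 w).1 hs.1,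
      mul_le_mul_of_nonneg_left (hg1 w).2 hs.1]
  set C := φ B - φ A
  have hC : 0 ≤ C := by
    obtain ⟨w⟩ := ‹Nonempty W›
    exact sub_nonneg.2 ((hf1 w).1.trans (hf1 w).2)
  have hfg : ∀ w, |f w - g w| ≤ C := fun w => by
    rw [abs_le]
    constructor <;> linarith [(hf1 w).1, (hf1 w).2, (hg1 w).1, (hg1 w).2]
  set j : ℝ → ℝ := fun s => utilityValue R φ (p s) with hj
  have hlip : ∀ s ∈ Icc (0 : ℝ) 1, ∀ s' ∈ Icc (0 : ℝ) 1, j s - j s' ≤ C * |s - s'| := by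
    intro s hs s' hs'
    have := h.utilityValue_le_add (hpm s hs) (hpm s' hs') (k := C * |s - s'|) (by positivity)
      fun w => by
        rw [hpw, hpw]
        have e : (1 - s) * f w + s * g w = (1 - s') * f w + s' * g w + -((f w - g w) * (s - s')) := by
          ring
        rw [e]
        have := neg_le_abs ((f w - g w) * (s - s'))
        rw [abs_mul] at this
        linarith [mul_le_mul_of_nonneg_right (hfg w) (abs_nonneg (s - s'))]
    linarith
  have hjc : ContinuousOn j (Icc 0 1) := by
    refine LipschitzOnWith.continuousOn (K := ⟨C, hC⟩)
      (LipschitzOnWith.of_dist_le_mul fun s hs s' hs' => ?_)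
    rw [Real.dist_eq, Real.dist_eq]
    refine abs_le.2 ⟨?_, hlip s hs s' hs'⟩
    have := hlip s' hs' s hs
    rw [abs_sub_comm] at this
    change -(C * |s - s'|) ≤ _
    linarith
  have hA1 := h.strictMono (show A - 1 < A by linarith)
  have hB1 := h.strictMono (show B < B + 1 by linarith)
  -- At distance at most `η` the levelling shift, of size at most `2 * C * η`, does not leave the
  -- interval from `φ (A - 1)` to `φ (B + 1)`.
  obtain ⟨η, hη0, hη⟩ : ∃ η > 0, η * (2 * C) ≤ min (φ (B + 1) - φ B) (φ A - φ (A - 1)) := by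
    have hpos : 0 < min (φ (B + 1) - φ B) (φ A - φ (A - 1)) :=
      lt_min (by linarith) (by linarith)
    refine ⟨min (φ (B + 1) - φ B) (φ A - φ (A - 1)) / (2 * C + 1), by positivity, ?_⟩
    rw [div_mul_eq_mul_div, div_le_iff₀ (by positivity)]
    nlinarith
  have hmid : ∀ s ∈ Ioo (0 : ℝ) 1, ∃ ε > 0, s - ε ∈ Icc (0 : ℝ) 1 ∧ s + ε ∈ Icc (0 : ℝ) 1 ∧
      (j (s - ε) + j (s + ε)) / 2 ≤ j s := by
    intro s hs
    set ε := min η (min s (1 - s))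
    have hε : 0 < ε := lt_min hη0 (lt_min hs.1 (by linarith [hs.2]))
    have hεη : ε ≤ η := min_le_left _ _
    have hεs : ε ≤ s := (min_le_right _ _).trans (min_le_left _ _)
    have hεs' : ε ≤ 1 - s := (min_le_right _ _).trans (min_le_right _ _)
    have hl : s - ε ∈ Icc (0 : ℝ) 1 := ⟨by linarith, by linarith [hs.2]⟩
    have hr : s + ε ∈ Icc (0 : ℝ) 1 := ⟨by linarith [hs.1], by linarith⟩
    refine ⟨ε, hε, hl, hr, ?_⟩
    -- Adding `d` to the right neighbour equalizes the values; the midpoint then moves by `d / 2`,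
    -- which translation invariance takes off again.
    set d := j (s - ε) - j (s + ε) with hd
    have hdb : |d| ≤ min (φ (B + 1) - φ B) (φ A - φ (A - 1)) := by
      refine le_trans ?_ hη
      have e1 := hlip _ hl _ hr
      have e2 := hlip _ hr _ hl
      rw [show s - ε - (s + ε) = -(2 * ε) by ring, abs_neg, abs_of_pos (by linarith)] at e1
      rw [show s + ε - (s - ε) = 2 * ε by ring, abs_of_pos (by linarith)] at e2
      have e3 := mul_le_mul_of_nonneg_right hεη hC
      rw [abs_le]
      constructor <;> linarith
    have hd1 := (abs_le.1 (hdb.trans (min_le_left _ _))).2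
    have hd2 := (abs_le.1 (hdb.trans (min_le_right _ _))).1
    have hd3 := (abs_le.1 (hdb.trans (min_le_left _ _))).1
    have hd4 := (abs_le.1 (hdb.trans (min_le_right _ _))).2
    have m1 : (p (s + ε)).map (fun y => y + d) ∈ utilityRange W φ :=
      h.mem_utilityRange (a := A - 1) (b := B + 1) fun w => by
        rw [SimpleFunc.map_apply]
        have := hp1 _ hr w
        constructor <;> linarith [this.1, this.2]
    have m2 : (p s).map (fun y => y + d / 2) ∈ utilityRange W φ :=
      h.mem_utilityRange (a := A - 1) (b := B + 1) fun w => by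
        rw [SimpleFunc.map_apply]
        have := hp1 s ⟨hs.1.le, hs.2.le⟩ w
        constructor <;> linarith [this.1, this.2]
    have t1 := h.utilityValue_add (hpm _ hr) m1 (k := d) fun w => rfl
    have t2 := h.utilityValue_add (hpm s ⟨hs.1.le, hs.2.le⟩) m2 (k := d / 2) fun w => rfl
    have t3 := h.le_utilityValue_midpoint (hpm _ hl) m1 m2 (fun w => by
      rw [SimpleFunc.map_apply, SimpleFunc.map_apply, hpw, hpw, hpw]; ring) (by
      rw [t1]; simp only [hd, hj]; ring)
    rw [t2] at t3
    simp only [hd, hj] at t3 ⊢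
    linarith
  -- Applied to the deviation from the chord, which vanishes at both ends.
  have := nonneg_of_local_midpoint (h := fun s => j s - ((1 - s) * j 0 + s * j 1))
    (hjc.sub (by fun_prop)) (by simp) (by simp) (fun s hs => by
      obtain ⟨ε, hε, hl, hr, hle⟩ := hmid s hs
      refine ⟨ε, hε, hl, hr, ?_⟩
      linarith) b ⟨hb, by linarith⟩
  have e0 : p 0 = f := by ext w; rw [hpw]; ring
  have e1 : p 1 = g := by ext w; rw [hpw]; ring
  have e2 : a = 1 - b := by linarith
  simp only [hj, e0, e1] at this
  rw [e2, smul_eq_mul, smul_eq_mul]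
  exact sub_nonneg.1 this

/-- The value has supergradients, which are finitely additive probabilities. -/
theorem exists_supergradient_prob {f : SimpleFunc W ℝ} (hf : f ∈ utilityRange W φ) :
    ∃ Q : FinAddProb W, ∀ g ∈ utilityRange W φ,
      utilityValue R φ g ≤ utilityValue R φ f + (Q.expect g - Q.expect f) := by
  obtain ⟨a, b, hab⟩ := h.exists_bounds_of_mem hf
  have ha := h.strictMono (show a - 1 < a by linarith)
  have hb := h.strictMono (show b < b + 1 by linarith)
  -- Simple functions have bounded values and `φ` is strictly increasing on the whole line, so there
  -- is room in every direction.
  have hint : ∀ v : SimpleFunc W ℝ, ∃ ε : ℝ, 0 < ε ∧ f + ε • v ∈ utilityRange W φ := by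
    intro v
    obtain ⟨C, hC⟩ := Bdd.simpleFunc v
    have hpos : 0 < min (φ (b + 1) - φ b) (φ a - φ (a - 1)) := lt_min (by linarith) (by linarith)
    set η := min (φ (b + 1) - φ b) (φ a - φ (a - 1))
    refine ⟨η / (|C| + 1), by positivity, h.mem_utilityRange (a := a - 1) (b := b + 1) fun w => ?_⟩
    have e : (f + (η / (|C| + 1)) • v) w = f w + η / (|C| + 1) * v w := rfl
    rw [e]
    have h1 : |η / (|C| + 1) * v w| ≤ η := by
      rw [abs_mul, abs_of_pos (by positivity), div_mul_eq_mul_div, div_le_iff₀ (by positivity)]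
      exact mul_le_mul_of_nonneg_left (by linarith [hC w, le_abs_self C]) hpos.le
    have h2 := abs_le.1 (h1.trans (min_le_left _ _))
    have h3 := abs_le.1 (h1.trans (min_le_right _ _))
    constructor <;> linarith [(hab w).1, (hab w).2]
  obtain ⟨l, hl⟩ := exists_supergradient (h.concaveOn_utilityValue (R := R)) hint
  have hadd : ∀ (v : SimpleFunc W ℝ) (ε : ℝ), f + ε • v ∈ utilityRange W φ →
      utilityValue R φ (f + ε • v) ≤ utilityValue R φ f + ε * l v := fun v ε hε => by
    have := hl _ hε
    rwa [add_sub_cancel_left, map_smul, smul_eq_mul] at this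
  have hpos : ∀ v : SimpleFunc W ℝ, (∀ w, 0 ≤ v w) → 0 ≤ l v := fun v hv => by
    obtain ⟨ε, hε, hm⟩ := hint v
    have h1 := hadd v ε hm
    have h2 := h.utilityValue_mono hf hm fun w => by
      have : (f + ε • v) w = f w + ε * v w := rfl
      rw [this]
      linarith [mul_nonneg hε.le (hv w)]
    exact nonneg_of_mul_nonneg_right (by linarith) hε
  -- Translation invariance against the supergradient inequality; with `k` equal to `1` and `-1` it
  -- normalizes `l`.
  have hconst : ∀ k : ℝ, k ≤ l (SimpleFunc.const W k) := fun k => by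
    obtain ⟨ε, hε, hm⟩ := hint (SimpleFunc.const W k)
    have h1 := hadd _ ε hm
    rw [h.utilityValue_add hf hm (k := ε * k) fun w => rfl] at h1
    exact le_of_mul_le_mul_left (by linarith) hε
  have hone : l (SimpleFunc.const W 1) = 1 := by
    refine le_antisymm ?_ (hconst 1)
    have h1 := hconst (-1)
    have : SimpleFunc.const W (-1 : ℝ) = -SimpleFunc.const W 1 := rfl
    rw [this, map_neg] at h1
    linarith
  obtain ⟨Q, hQ⟩ := exists_simpleIntegral_eq l hpos hone
  refine ⟨Q, fun g hg => ?_⟩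
  rw [Q.expect_simple, Q.expect_simple, hQ, hQ, ← map_sub]
  exact hl g hg

end BetUtility
end Riskless

/-! ### The representation -/

section Representation
variable {W S : Type*} [MeasurableSpace W] [MeasurableSpace S] [Nonempty W] {P : Kernel W S}
  [IsMarkovKernel P] {R : (W × S → ℝ) → (W × S → ℝ) → Prop} {φ ψ : ℝ → ℝ}

namespace BetUtility
variable (h : BetUtility P R φ ψ)
include h

theorem utilityValue_eq {f : SimpleFunc W ℝ} {g : W → ℝ} (hfg : ∀ w, f w = φ (g w)) :
    utilityValue R φ f = value R φ (riskless g) := by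
  refine congrArg (value R φ) (funext fun x => ?_)
  rw [ofUtility, riskless, riskless, hfg]
  exact Function.leftInverse_invFun h.strictMono.injective _

/-- The supergradient inequality says that the supremum defining the penalty at `Q` is attained at
`f`. -/
theorem minPenalty_le_of_supergradient {f : SimpleFunc W ℝ} {Q : FinAddProb W}
    (hQ : ∀ g ∈ utilityRange W φ,
      utilityValue R φ g ≤ utilityValue R φ f + (Q.expect g - Q.expect f)) :
    minPenalty R φ Q ≤ ENNReal.ofReal (utilityValue R φ f - Q.expect f) := by
  have : Nonempty S := nonempty_state P
  refine minPenalty_le R fun g m hg hm => ENNReal.ofReal_le_ofReal ?_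
  obtain ⟨s, hs⟩ := exists_simpleFunc_of_riskless φ hg
  have h1 := hQ s fun w => ⟨g w, (congrFun hs w).symm⟩
  rw [h.utilityValue_eq (congrFun hs), value, (h.axioms.isCE_iff h.uniform hg m).1 hm, hs] at h1
  linarith

theorem value_le_add {v : W × S → ℝ} (hv : v ∈ finiteRV W S) (g : SimpleFunc W ℝ) {k : ℝ}
    (hk : 0 < k) (hle : ∀ w, lotteryUtility P φ ψ v w ≤ φ (g w) + k) :
    value R φ v ≤ value R φ (riskless g) + k := by
  obtain ⟨a, b, hab⟩ :=
    exists_utility_bounds (P := P) h.distortion h.strictMono (finiteRV_subset_boundedRV hv)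
  have hg : g.map φ ∈ utilityRange W φ := fun w => ⟨g w, rfl⟩
  -- Capping at `φ b`, a bound for the lottery utility, keeps the shifted function in the range of
  -- `φ`.
  set t : SimpleFunc W ℝ := g.map fun y => min (φ y + k) (φ b) with ht
  have htw : ∀ w, t w = min (φ (g w) + k) (φ b) := fun w => rfl
  have hlt : ∀ w, lotteryUtility P φ ψ v w ≤ t w := fun w => by
    rw [htw]
    exact le_min (hle w) (hab w).2
  have htm : t ∈ utilityRange W φ := h.mem_utilityRange (a := a) (b := b) fun w =>
    ⟨(hab w).1.trans (hlt w), by rw [htw]; exact min_le_right _ _⟩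
  rw [← h.utilityValue_eq (f := g.map φ) fun w => rfl]
  refine le_trans ?_ (h.utilityValue_le_add htm hg hk.le fun w => ?_)
  · refine h.value_le_of_lotteryUtility_le (ofUtility_mem φ t) hv fun w => ?_
    have : lotteryUtility P φ ψ (ofUtility φ t) w = t w := by
      rw [ofUtility, lotteryUtility_riskless h.distortion]
      exact Function.invFun_eq (htm w)
    rw [this]
    exact hlt w
  · rw [htw]
    exact min_le_left _ _

/-- That the value is a lower bound is `le_penExpect_minPenalty`. It is attained, up to `k`, at a
supergradient for a riskless approximation of the lottery utility from below; a minimizer exists by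
compactness. -/
theorem represents : Represents P (finiteRV W S) R φ ψ (minPenalty R φ) := by
  have : Nonempty S := nonempty_state P
  have hψ := h.distortion
  have hground : Grounded (minPenalty R φ) := by
    refine ⟨?_, fun _ _ => bot_le⟩
    obtain ⟨Q, hQ⟩ := h.exists_supergradient_prob (f := SimpleFunc.const W (φ 0)) fun _ => ⟨0, rfl⟩
    have h1 := h.minPenalty_le_of_supergradient hQ
    have h2 : Q.expect (SimpleFunc.const W (φ 0)) = φ 0 := Q.expect_const _
    rw [h.utilityValue_const, h2, sub_self, ENNReal.ofReal_zero] at h1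
    exact ⟨Q, le_antisymm h1 bot_le⟩
  refine ⟨h.cont, h.strictMono, hψ.continuousOn, hψ.strictMonoOn, hψ.zero, hψ.one, hground,
    convexPenalty_minPenalty R, lowerSemicontinuous_minPenalty R, value R φ, fun v hv => ?_,
    fun v hv u hu => h.rel_iff hv hu⟩
  have hvb := finiteRV_subset_boundedRV hv
  have hlow := le_penExpect_minPenalty (R := R) (P := P) (V := value R φ) h.cont h.strictMono hψ hvb
    (fun g => ⟨_, h.axioms.isCE_ce h.uniform
      (riskless_mem_finiteRV g.measurable g.finite_range), rfl⟩)
    fun g k hk hle => h.value_le_add hv g hk hle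
  have hLm := measurable_lotteryUtility (P := P) h.cont hψ hvb
  have hLb := bdd_lotteryUtility (P := P) h.cont hψ hvb
  obtain ⟨r, hr⟩ := exists_isLeast_penExpect hground (lowerSemicontinuous_minPenalty R) hLm hLb
  suffices r = value R φ v by rw [← this]; exact hr
  refine le_antisymm (le_of_forall_pos_le_add fun k hk => ?_) ?_
  · obtain ⟨a, b, hab⟩ := exists_utility_bounds (P := P) hψ h.strictMono hvb
    obtain ⟨g, hg⟩ := exists_riskless_approx h.cont hLm hab hk
    obtain ⟨Q, hQ⟩ := h.exists_supergradient_prob (f := g.map φ) fun w => ⟨g w, rfl⟩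
    have h1 := h.minPenalty_le_of_supergradient hQ
    have h2 := hr.2 ⟨Q, rfl⟩
    rw [coe_le_penExpect_iff] at h2
    have h3 := h2.trans h1
    have h4 : Q.expect (lotteryUtility P φ ψ v) ≤ Q.expect (g.map φ) + k :=
      Q.expect_le_add hLb (Bdd.simpleFunc _) fun w => (hg w).2
    have h5 : utilityValue R φ (g.map φ) ≤ value R φ v := by
      rw [h.utilityValue_eq (f := g.map φ) fun w => rfl]
      refine h.value_le_of_lotteryUtility_le hv
        (riskless_mem_finiteRV g.measurable g.finite_range) fun w => ?_
      rw [lotteryUtility_riskless hψ]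
      exact (hg w).1
    -- The comparison with a constant; it removes the truncation in `ENNReal.ofReal`.
    have h6 : 0 ≤ utilityValue R φ (g.map φ) - Q.expect (g.map φ) := by
      have := hQ (SimpleFunc.const W (φ 0)) fun _ => ⟨0, rfl⟩
      have hQc : Q.expect (SimpleFunc.const W (φ 0)) = φ 0 := Q.expect_const _
      rw [h.utilityValue_const, hQc] at this
      linarith
    rw [ENNReal.ofReal_le_ofReal_iff h6] at h3
    linarith
  · obtain ⟨⟨Q, hQ⟩, -⟩ := hr
    have := hlow Q
    rwa [hQ, EReal.coe_le_coe_iff] at this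

end BetUtility

theorem SatisfiesAxioms.exists_represents (hP : HasUniform P)
    (hA : SatisfiesAxioms P (finiteRV W S) R) :
    ∃ (φ ψ : ℝ → ℝ) (c : FinAddProb W → ℝ≥0∞), Represents P (finiteRV W S) R φ ψ c := by
  obtain ⟨φ, ψ, hc, hm, h0, hψ, H⟩ := hA.exists_binRep hP
  exact ⟨φ, ψ, _, (BetUtility.mk hP hA hc hm h0 hψ H).represents⟩

end Representation


end RDV

end

theorem theorem1 {W S : Type*} [MeasurableSpace W] [MeasurableSpace S] [Nonempty W]
    (P : Kernel W S) [IsMarkovKernel P] (hP : HasUniform P)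
    (R : (W × S → ℝ) → (W × S → ℝ) → Prop) :
    -- the axioms characterize the representation
    (SatisfiesAxioms P (finiteRV W S) R ↔
      ∃ (φ ψ : ℝ → ℝ) (c : FinAddProb W → ℝ≥0∞), Represents P (finiteRV W S) R φ ψ c) ∧
    -- for each utility function there is a least penalty, given by the formula
    (∀ (φ ψ : ℝ → ℝ) (c : FinAddProb W → ℝ≥0∞), Represents P (finiteRV W S) R φ ψ c →
      Represents P (finiteRV W S) R φ ψ (minPenalty R φ) ∧
      IsLeast {c' : FinAddProb W → ℝ≥0∞ | ∃ ψ', Represents P (finiteRV W S) R φ ψ' c'}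
        (minPenalty R φ)) ∧
    -- unique extension to all bounded random variables
    (SatisfiesAxioms P (finiteRV W S) R →
      ∃ R' : (W × S → ℝ) → (W × S → ℝ) → Prop,
        (∀ v ∈ finiteRV W S, ∀ u ∈ finiteRV W S, (R' v u ↔ R v u)) ∧
        SatisfiesAxioms P (boundedRV W S) R' ∧
        (∀ (φ ψ : ℝ → ℝ) (c : FinAddProb W → ℝ≥0∞), Represents P (finiteRV W S) R φ ψ c →
          Represents P (boundedRV W S) R' φ ψ c) ∧
        ∀ R'' : (W × S → ℝ) → (W × S → ℝ) → Prop,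
          (∀ v ∈ finiteRV W S, ∀ u ∈ finiteRV W S, (R'' v u ↔ R v u)) →
          SatisfiesAxioms P (boundedRV W S) R'' →
          ∀ v ∈ boundedRV W S, ∀ u ∈ boundedRV W S, (R'' v u ↔ R' v u)) := by
  have ext_axioms : ∀ {φ ψ : ℝ → ℝ} {c : FinAddProb W → ℝ≥0∞},
      Represents P (finiteRV W S) R φ ψ c →
        SatisfiesAxioms P (boundedRV W S) (RDV.extRel P φ ψ c) := fun h =>
    h.extRel.satisfiesAxioms finiteRV_subset_boundedRV Subset.rfl
  refine ⟨⟨fun hA => hA.exists_represents hP, ?_⟩, fun φ ψ c h => ?_, fun hA => ?_⟩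
  · rintro ⟨φ, ψ, c, h⟩
    exact h.satisfiesAxioms Subset.rfl finiteRV_subset_boundedRV
  · refine ⟨h.minPenalty, ⟨ψ, h.minPenalty⟩, ?_⟩
    -- The formula for the penalty does not involve the distortion, so it is least among
    -- representations with any `ψ'`.
    rintro c' ⟨ψ', h'⟩ Q
    exact h'.minPenalty_le Q
  · obtain ⟨φ, ψ, c, h⟩ := hA.exists_represents hP
    refine ⟨RDV.extRel P φ ψ c, fun v hv u hu => h.extRel_iff hv hu, ext_axioms h,
      fun φ₂ ψ₂ c₂ h₂ => ?_, fun R'' hR hA'' v hv u hu => h.extension_unique hP hR hA'' hv hu⟩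
    -- Another representation of `R` gives another extension by formula; uniqueness identifies the
    -- two.
    have agree : ∀ v ∈ boundedRV W S, ∀ u ∈ boundedRV W S,
        (RDV.extRel P φ ψ c v u ↔ RDV.extRel P φ₂ ψ₂ c₂ v u) := fun v hv u hu =>
      h₂.extension_unique hP (fun v hv u hu => h.extRel_iff hv hu) (ext_axioms h) hv hu
    have h₂' := h₂.extRel
    obtain ⟨V, hV, hrel⟩ := h₂'.represents
    exact { h₂' with
      represents := ⟨V, hV, fun v hv u hu => (agree v hv u hu).trans (hrel v hv u hu)⟩ }
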